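/- Let $n\ge 2$. Equip $\mathbb R^{n+2}$ with a scalar product $(\cdot,\cdot)$ of signature $(n+1,1)$; let $Q^n=\{(x,x)=0\}\subset P^{n+1}$ be the absolute, which is a model of the conformal space $C^n$, and let the de Sitter space $S^{n+1}_1=\{(x,x)>0\}\subset P^{n+1}$ be its exterior; the point $b\in S^{n+1}_1$ represents the hypersphere $\{y\in Q^n:(y,b)=0\}$ of $C^n$. Let $U^n$ be a lightlike hypersurface of $S^{n+1}_1$, that is, a smooth family of lightlike projective lines $l(u)$ (rectilinear generators), $u\in M$, where $M$ is a smooth manifold of dimension $n-1$, each line carrying a regular point of the map $M\times l\to P^{n+1}$ in $S^{n+1}_1$, such that at the regular points in $S^{n+1}_1$ the tangent hyperplanes are tangent to $Q^n$. Locally $l(u)$ is the line joining $A_0(u)$ and $A_n(u)$, where $A_0,A_n$ are smooth, $(A_0,A_0)=(A_0,A_n)=0$ and $(A_n,A_n)=1$. Let $U^n$ have the maximal rank $n-1$, that is, $u\mapsto [A_0(u)]\in Q^n$ is an immersion; it describes a hypersurface $V^{n-1}$ of $C^n$. Put $g_{ij}=(\partial_iA_0,\partial_jA_0)$ and $\lambda_{ij}=-(\partial_iA_0,\partial_jA_n)$.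 (1) The singular points (foci) of a generator, i.e. the points at which the tangent subspace to $U^n$ has dimension less than $n$, are exactly the points $A_n+sA_0$ with $\det(\lambda_{ij}-s\,g_{ij})=0$. This polynomial in $s$ has degree $n-1$ and all its roots are real, so that each generator carries $n-1$ real foci, counted with multiplicity. Every simple focus belongs to a continuous field of simple foci, defined on a neighbourhood in $M$. (2) Let $B$ be a continuous field of foci of constant multiplicity $m$ on an open set $N\subset M$. It is smooth. Call the directions in $T_uM$ in which $B(u)$, taken as a point moving together with the generator, is displaced only along the generator, the singular directions; they form an $m$-dimensional subspace of $T_uM$. The focus $B(u)$ is called a fold if $dB$ vanishes in no nonzero singular direction, and conic if $dB$ vanishes in all singular directions. If $m=1$, each focus $B(u)$ is either a fold or conic, and not both; the set of folds is open. Over the set of folds, $M$ is foliated by the integral curves of the singular directions, and $U^n$ is thereby foliated into an $(n-2)$-parameter family of torses (families of tangent lines of smooth regular curves without inflections), whose edges of regression are described by $B$. Over the interior of the set of conic points, the assertion (3) holds with $m=1$. If $m\ge2$, all the foci $B(u)$, $u\in N$, are conic, and the assertion (3) holds over $N$. (3) $M$ is foliated by $m$-dimensional leaves tangent to the singular directions,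 which depend locally on $n-m-1$ parameters. On each plaque of a suitable foliated chart near any point, $B$ is constant, and the generators sweep out an open part of an $(m+1)$-dimensional second-order cone with the vertex $B$; thus $U^n$ is foliated into an $(n-m-1)$-parameter family of $(m+1)$-dimensional second-order cones. Locally the vertices describe an $(n-m-1)$-dimensional spacelike submanifold of $S^{n+1}_1$. The hypersurface $V^{n-1}$ is an $m$-canal hypersurface: it envelops the $(n-m-1)$-parameter family of hyperspheres represented by the vertices, and it is tangent to each of these hyperspheres along an open part of an $m$-dimensional sphere (spherical generator). -/

import Mathlib

open Set Filter Topology Module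
open scoped Manifold ContDiff LinearAlgebra.Projectivization Polynomial

namespace DeSitter

noncomputable section

/-! ### The Lorentzian space, the absolute, the de Sitter space -/

/-- The vector space `ℝ^{n+2}` whose projectivization is the projective space `P^{n+1}`. -/
abbrev LSpace (n : ℕ) : Type := Fin (n + 2) → ℝ

/-- The scalar product `(x, y) = -x⁰y⁰ + x¹y¹ + ⋯ + xⁿ⁺¹yⁿ⁺¹` of signature `(n+1, 1)`. -/
def lorentz (n : ℕ) : LinearMap.BilinForm ℝ (LSpace n) :=
  Matrix.toBilin' (Matrix.diagonal fun i : Fin (n + 2) => if i = 0 then -1 else 1)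

theorem lorentz_apply (n : ℕ) (x y : LSpace n) :
    lorentz n x y = -(x 0 * y 0) + ∑ i : Fin (n + 1), x i.succ * y i.succ := by
  simp [lorentz, Matrix.toBilin'_apply', dotProduct, Matrix.mulVec_diagonal, Fin.sum_univ_succ,
    Fin.succ_ne_zero]

/-- A point of `P^{n+1}` belongs to the de Sitter space (the exterior of the absolute quadric
`(x, x) = 0`) if `(x, x) > 0`. -/
def InDeSitter {n : ℕ} (p : ℙ ℝ (LSpace n)) : Prop := 0 < lorentz n p.rep p.rep

/-- A hyperplane of `P^{n+1}` is lightlike if it is tangent to the absolute quadric, that is, if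
it is the polar hyperplane of a point of that quadric. -/
def IsLightlikeHyperplane {n : ℕ} (T : Submodule ℝ (LSpace n)) : Prop :=
  ∃ y : LSpace n, y ≠ 0 ∧ lorentz n y y = 0 ∧ T = (lorentz n).orthogonal (ℝ ∙ y)

/-! ### Ruled families of lines -/

section Ruled

variable {n : ℕ} {M : Type*} [TopologicalSpace M] [ChartedSpace (EuclideanSpace ℝ (Fin (n - 1))) M]

/-- The differential of a vector-valued function on `M`. -/
def diff (σ : M → LSpace n) (u : M) : TangentSpace (𝓡 (n - 1)) u →ₗ[ℝ] LSpace n :=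
  (mfderiv (𝓡 (n - 1)) 𝓘(ℝ, LSpace n) σ u).toLinearMap

/-- The vector-valued function `σ` is of class `C^∞` in a neighbourhood of `u`. -/
def IsSmoothNear (σ : M → LSpace n) (u : M) : Prop :=
  ∀ᶠ w in 𝓝 u, ContMDiffAt (𝓡 (n - 1)) 𝓘(ℝ, LSpace n) ∞ σ w

/-- A family of projective lines `gen u`, each represented by a linear subspace, has `(A₀, Aₙ)` as
a smooth adapted frame near `u`: the line through `A₀` and `Aₙ` is `gen`, the point `A₀` lies on the
absolute quadric, `(Aₙ, Aₙ) = 1` and `(A₀, Aₙ) = 0`; so the line is tangent to the quadric at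
`A₀`, that is, lightlike. -/
structure IsFrameAt (gen : M → Submodule ℝ (LSpace n)) (u : M) (A₀ Aₙ : M → LSpace n) : Prop where
  smooth_zero : IsSmoothNear A₀ u
  smooth_last : IsSmoothNear Aₙ u
  adapted : ∀ᶠ w in 𝓝 u, A₀ w ≠ 0 ∧ lorentz n (A₀ w) (A₀ w) = 0 ∧ lorentz n (A₀ w) (Aₙ w) = 0 ∧
    lorentz n (Aₙ w) (Aₙ w) = 1 ∧ gen w = Submodule.span ℝ {A₀ w, Aₙ w}

/-- `σ` is, near `u`, a smooth nowhere zero section of the family of lines, that is, it describes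
a point moving smoothly together with the line on which it lies. -/
def IsSectionAt (gen : M → Submodule ℝ (LSpace n)) (u : M) (σ : M → LSpace n) : Prop :=
  IsSmoothNear σ u ∧ ∀ᶠ w in 𝓝 u, σ w ∈ gen w ∧ σ w ≠ 0

/-- A section that describes the point of contact of the line with the absolute quadric. -/
def IsNullSectionAt (gen : M → Submodule ℝ (LSpace n)) (u : M) (σ : M → LSpace n) : Prop :=
  IsSectionAt gen u σ ∧ ∀ᶠ w in 𝓝 u, lorentz n (σ w) (σ w) = 0

/-- The tangent subspace of the ruled hypersurface at the point `p` of the line `gen u`, that is,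
the image of the differential at `(u, p)` of the map `M × l → P^{n+1}` (as a linear subspace: a
projective subspace of dimension `k` has `finrank` equal to `k + 1`). -/
def tangentSubspace (gen : M → Submodule ℝ (LSpace n)) (u : M) (p : ℙ ℝ (LSpace n)) :
    Submodule ℝ (LSpace n) :=
  gen u ⊔ ⨆ σ : {σ : M → LSpace n // IsSectionAt gen u σ ∧ σ u ∈ p.submodule},
    LinearMap.range (diff σ.1 u)

/-- A point of the line `gen u` is regular if the tangent subspace at it has dimension `n`. -/
def IsRegularPoint (gen : M → Submodule ℝ (LSpace n)) (u : M) (p : ℙ ℝ (LSpace n)) : Prop :=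
  p.submodule ≤ gen u ∧ finrank ℝ (tangentSubspace gen u p) = n + 1

/-- A point of the line `gen u` is singular if the tangent subspace at it has dimension less
than `n`. -/
def IsSingularPoint (gen : M → Submodule ℝ (LSpace n)) (u : M) (p : ℙ ℝ (LSpace n)) : Prop :=
  p.submodule ≤ gen u ∧ finrank ℝ (tangentSubspace gen u p) < n + 1

/-- The directions on `M` in which the point `p` of the line `gen u`, moving together with the line,
is displaced only along this line. At a singular point these are the directions annihilated by the
degenerate affinor `λⁱⱼ - s δⁱⱼ`. -/
def singularDirections (gen : M → Submodule ℝ (LSpace n)) (u : M) (p : ℙ ℝ (LSpace n)) :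
    Submodule ℝ (TangentSpace (𝓡 (n - 1)) u) :=
  ⨅ σ : {σ : M → LSpace n // IsSectionAt gen u σ ∧ σ u ∈ p.submodule},
    (gen u).comap (diff σ.1 u)

/-- The `i`-th vector of the standard basis of a tangent space of `M`. -/
def basisVec (u : M) (i : Fin (n - 1)) : TangentSpace (𝓡 (n - 1)) u :=
  (EuclideanSpace.single i (1 : ℝ) : EuclideanSpace ℝ (Fin (n - 1)))

/-- The matrix `gᵢⱼ = (∂ᵢA₀, ∂ⱼA₀)`. -/
def gMatrix (A₀ : M → LSpace n) (u : M) : Matrix (Fin (n - 1)) (Fin (n - 1)) ℝ :=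
  Matrix.of fun i j => lorentz n (diff A₀ u (basisVec u i)) (diff A₀ u (basisVec u j))

/-- The matrix `λᵢⱼ = -(∂ᵢA₀, ∂ⱼAₙ)`: the coefficients of `ωᵢⁿ = λᵢⱼ ω₀ʲ` in the moving frame with
`Aᵢ = ∂ᵢA₀`. -/
def lambdaMatrix (A₀ Aₙ : M → LSpace n) (u : M) : Matrix (Fin (n - 1)) (Fin (n - 1)) ℝ :=
  Matrix.of fun i j => -lorentz n (diff A₀ u (basisVec u i)) (diff Aₙ u (basisVec u j))

/-- The polynomial `det (λᵢⱼ - s gᵢⱼ)` in `s`. -/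
def charPoly (A₀ Aₙ : M → LSpace n) (u : M) : ℝ[X] :=
  ((lambdaMatrix A₀ Aₙ u).map Polynomial.C
    - (Polynomial.X : ℝ[X]) • (gMatrix A₀ u).map Polynomial.C).det

/-- `p` is the point `Aₙ + s A₀` of the line `gen u`, where `s` is a root of multiplicity `m ≥ 1`
of the characteristic equation `det (λᵢⱼ - s gᵢⱼ) = 0`. -/
def IsFocus (gen : M → Submodule ℝ (LSpace n)) (u : M) (p : ℙ ℝ (LSpace n)) (m : ℕ) : Prop :=
  1 ≤ m ∧ ∃ (A₀ Aₙ : M → LSpace n) (s : ℝ), IsFrameAt gen u A₀ Aₙ ∧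
    p.submodule = ℝ ∙ (Aₙ u + s • A₀ u) ∧ charPoly A₀ Aₙ u ≠ 0 ∧
    (charPoly A₀ Aₙ u).rootMultiplicity s = m

/-- `v` is, near `u`, a nowhere zero field of representatives of a field of points `B`. -/
def IsLiftAt (B : M → ℙ ℝ (LSpace n)) (u : M) (v : M → LSpace n) : Prop :=
  ∀ᶠ w in 𝓝 u, v w ∈ (B w).submodule ∧ v w ≠ 0

/-- `B` is, on the open set `N`, a continuous field of singular points of multiplicity `m` of the
lines `gen u`. -/
structure IsFocusField (gen : M → Submodule ℝ (LSpace n)) (N : Set M) (B : M → ℙ ℝ (LSpace n))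
    (m : ℕ) : Prop where
  isOpen : IsOpen N
  continuous : ∀ u ∈ N, ∃ v : M → LSpace n, IsLiftAt B u v ∧ ContinuousAt v u
  focus : ∀ u ∈ N, IsFocus gen u (B u) m

/-- The focus `B u` is a fold: near `u` the field of foci is smooth, and in every nonzero singular
direction the focus is really displaced (the coefficient `s₁₁` does not vanish). -/
def IsFoldAt (gen : M → Submodule ℝ (LSpace n)) (B : M → ℙ ℝ (LSpace n)) (u : M) : Prop :=
  ∃ v : M → LSpace n, IsLiftAt B u v ∧ IsSmoothNear v u ∧
    ∀ X ∈ singularDirections gen u (B u), X ≠ 0 → diff v u X ∉ (B u).submodule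

/-- The focus `B u` is conic: near `u` the field of foci is smooth, and the focus is stationary in
all singular directions (the coefficients `s₀ₐ` vanish). -/
def IsConicAt (gen : M → Submodule ℝ (LSpace n)) (B : M → ℙ ℝ (LSpace n)) (u : M) : Prop :=
  ∃ v : M → LSpace n, IsLiftAt B u v ∧ IsSmoothNear v u ∧
    ∀ X ∈ singularDirections gen u (B u), diff v u X ∈ (B u).submodule

/-! ### Foliations -/

/-- A smooth foliated chart of `M`, with `k`-dimensional plaques depending on `c` parameters. -/
structure FoliatedChart (n : ℕ) (M : Type*) [TopologicalSpace M]
    [ChartedSpace (EuclideanSpace ℝ (Fin (n - 1))) M] (k c : ℕ) where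
  /-- the coordinates: `k` coordinates along the plaques and `c` transversal ones -/
  toHomeo : OpenPartialHomeomorph M (EuclideanSpace ℝ (Fin k) × EuclideanSpace ℝ (Fin c))
  /-- the range of the coordinates along the plaques -/
  leafDom : Set (EuclideanSpace ℝ (Fin k))
  /-- the range of the transversal coordinates -/
  paramDom : Set (EuclideanSpace ℝ (Fin c))
  leaf_open : IsOpen leafDom
  leaf_convex : Convex ℝ leafDom
  param_open : IsOpen paramDom
  param_convex : Convex ℝ paramDom
  target_eq : toHomeo.target = leafDom ×ˢ paramDom
  smooth : ContMDiffOn (𝓡 (n - 1))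
    𝓘(ℝ, EuclideanSpace ℝ (Fin k) × EuclideanSpace ℝ (Fin c)) ∞ toHomeo toHomeo.source
  smooth_symm : ContMDiffOn 𝓘(ℝ, EuclideanSpace ℝ (Fin k) × EuclideanSpace ℝ (Fin c))
    (𝓡 (n - 1)) ∞ toHomeo.symm toHomeo.target

/-- The transversal parameters of a point. -/
def FoliatedChart.param {k c : ℕ} (Φ : FoliatedChart n M k c) (u : M) :
    EuclideanSpace ℝ (Fin c) := (Φ.toHomeo u).2

/-- The plaque with the transversal parameters `y`. -/
def FoliatedChart.plaque {k c : ℕ} (Φ : FoliatedChart n M k c) (y : EuclideanSpace ℝ (Fin c)) :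
    Set M := {u | u ∈ Φ.toHomeo.source ∧ Φ.param u = y}

/-- The chart lies in `N` and its plaques are tangent to the distribution `D`: the charts with
this property define the foliation of `N` with the tangent distribution `D`. -/
def FoliatedChart.IsAdapted {k c : ℕ} (Φ : FoliatedChart n M k c) (N : Set M)
    (D : ∀ u : M, Submodule ℝ (TangentSpace (𝓡 (n - 1)) u)) : Prop :=
  Φ.toHomeo.source ⊆ N ∧ ∀ u ∈ Φ.toHomeo.source,
    D u = LinearMap.ker
      (mfderiv (𝓡 (n - 1)) 𝓘(ℝ, EuclideanSpace ℝ (Fin c)) Φ.param u).toLinearMap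

/-! ### Torses, cones, canal hypersurfaces -/

/-- Near `t`, the one-parameter family of lines `ℓ` is a torse with the edge of regression `q`:
`q` is a smooth curve, regular and without inflections, and `ℓ` is the family of its tangent
lines. -/
def IsTorseAt (ℓ : ℝ → Submodule ℝ (LSpace n)) (q : ℝ → ℙ ℝ (LSpace n)) (t : ℝ) : Prop :=
  ∃ v : ℝ → LSpace n, ∀ᶠ r in 𝓝 t, ContDiffAt ℝ ∞ v r ∧
    v r ∈ (q r).submodule ∧ LinearIndependent ℝ ![v r, deriv v r, deriv (deriv v) r] ∧
    ℓ r = Submodule.span ℝ {v r, deriv v r}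

/-- The ruled hypersurface is foliated over `N` into an `(n-2)`-parameter family of torses, whose
edges of regression are described by the foci `B`. -/
def IsFoliatedByTorses (gen : M → Submodule ℝ (LSpace n)) (N : Set M)
    (B : M → ℙ ℝ (LSpace n)) : Prop :=
  ∀ u ∈ N, ∃ Φ : FoliatedChart n M 1 (n - 2), u ∈ Φ.toHomeo.source ∧
    Φ.IsAdapted N (fun w => singularDirections gen w (B w)) ∧
    ∀ y ∈ Φ.paramDom, ∀ t : ℝ, (!₂[t] : EuclideanSpace ℝ (Fin 1)) ∈ Φ.leafDom →
      IsTorseAt (fun r => gen (Φ.toHomeo.symm (!₂[r], y)))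
        (fun r => B (Φ.toHomeo.symm (!₂[r], y))) t

/-- The lines `gen u`, `u ∈ P`, sweep out an open part of the set of generators of a `d`-dimensional
second-order cone with the vertex `b`. The cone is given, in a projective subspace `E` of dimension
`d + 1` through `b`, by the equation `ψ = 0` with a quadratic form `ψ` whose radical on `E` is
spanned by `b`. -/
def SweepsQuadraticCone (gen : M → Submodule ℝ (LSpace n)) (P : Set M) (b : LSpace n)
    (d : ℕ) : Prop :=
  ∃ (E : Submodule ℝ (LSpace n)) (ψ : QuadraticForm ℝ (LSpace n)),
    finrank ℝ E = d + 2 ∧ b ≠ 0 ∧ b ∈ E ∧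
    (∀ x ∈ E, (∀ z ∈ E, QuadraticMap.polar ψ x z = 0) ↔ x ∈ ℝ ∙ b) ∧
    (∀ u ∈ P, b ∈ gen u ∧ ∀ x ∈ gen u, x ∈ E ∧ ψ x = 0) ∧
    ∀ u ∈ P, ∀ x ∈ gen u, x ∉ ℝ ∙ b → ∀ᶠ z in 𝓝 x, z ∈ E → ψ z = 0 → ∃ w ∈ P, z ∈ gen w

/-- The points of contact `A₀` of the lines `gen u`, `u ∈ P`, with the absolute quadric form an
open part of an `m`-dimensional sphere, which lies on the hypersphere with the pole `b`. The sphere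
is the section of the quadric by a projective subspace `S` of dimension `m + 1` that meets its
interior. -/
def IsSphericalGenerator (gen : M → Submodule ℝ (LSpace n)) (P : Set M) (b : LSpace n)
    (m : ℕ) : Prop :=
  ∃ S : Submodule ℝ (LSpace n), finrank ℝ S = m + 2 ∧ (∃ z ∈ S, lorentz n z z < 0) ∧
    (∀ z ∈ S, lorentz n z b = 0) ∧
    ∀ u ∈ P, ∀ x ∈ gen u, x ≠ 0 → lorentz n x x = 0 →
      x ∈ S ∧ ∀ᶠ z in 𝓝 x, z ∈ S → lorentz n z z = 0 → ∃ w ∈ P, z ∈ gen w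

/-- The hypersphere with the pole `b` is tangent at the point `A₀(u)` to the hypersurface described
by the points of contact `A₀` of the lines `gen u` with the absolute quadric. -/
def HypersphereTangentAt (gen : M → Submodule ℝ (LSpace n)) (b : LSpace n) (u : M) : Prop :=
  ∀ σ : M → LSpace n, IsNullSectionAt gen u σ →
    lorentz n (σ u) b = 0 ∧ ∀ X, lorentz n (diff σ u X) b = 0

/-- `β` parametrizes, injectively and with an injective differential, a `c`-dimensional spacelike
submanifold of the de Sitter space: its points are normalized by `(β, β) = 1`, and its tangent
subspaces do not meet the absolute quadric. -/
structure IsSpacelikeSubmanifold {c : ℕ} (β : EuclideanSpace ℝ (Fin c) → LSpace n)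
    (Y : Set (EuclideanSpace ℝ (Fin c))) : Prop where
  smooth : ContDiffOn ℝ ∞ β Y
  unit : ∀ y ∈ Y, lorentz n (β y) (β y) = 1
  injective : ∀ y ∈ Y, ∀ y' ∈ Y, β y' ∈ ℝ ∙ β y → y' = y
  spacelike : ∀ y ∈ Y, ∀ (a : ℝ) (z : EuclideanSpace ℝ (Fin c)), (a ≠ 0 ∨ z ≠ 0) →
    0 < lorentz n (a • β y + fderiv ℝ β y z) (a • β y + fderiv ℝ β y z)

/-- Over `N` the ruled hypersurface is foliated into an `(n-m-1)`-parameter family of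
`(m+1)`-dimensional second-order cones, whose vertices are the foci `B` and describe an
`(n-m-1)`-dimensional spacelike submanifold. The hypersurface described by the points of contact
`A₀` with the absolute quadric is an `m`-canal hypersurface: it envelops the `(n-m-1)`-parameter
family of hyperspheres with the poles `β`, and each of them touches it along an `m`-dimensional
spherical generator. -/
def IsFoliatedByCones (gen : M → Submodule ℝ (LSpace n)) (N : Set M)
    (B : M → ℙ ℝ (LSpace n)) (m : ℕ) : Prop :=
  ∀ u ∈ N, ∃ (Φ : FoliatedChart n M m (n - 1 - m))
      (β : EuclideanSpace ℝ (Fin (n - 1 - m)) → LSpace n),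
    u ∈ Φ.toHomeo.source ∧
    Φ.IsAdapted N (fun w => singularDirections gen w (B w)) ∧
    IsSpacelikeSubmanifold β Φ.paramDom ∧
    (∀ w ∈ Φ.toHomeo.source, (B w).submodule = ℝ ∙ β (Φ.param w)) ∧
    (∀ y ∈ Φ.paramDom, SweepsQuadraticCone gen (Φ.plaque y) (β y) (m + 1)) ∧
    (∀ w ∈ Φ.toHomeo.source, HypersphereTangentAt gen (β (Φ.param w)) w) ∧
    ∀ y ∈ Φ.paramDom, IsSphericalGenerator gen (Φ.plaque y) (β y) m

end Ruled

/-! ### Lightlike hypersurfaces -/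

/-- A lightlike hypersurface of the de Sitter space, as the image of `M × l` (`M` a manifold of
dimension `n - 1`, `l` a projective line): a smooth family of lightlike lines, its rectilinear
generators, each of which carries a regular point in the de Sitter space, such that the tangent
hyperplanes at all these regular points are lightlike. -/
structure LightlikeHypersurface (n : ℕ) (M : Type*) [TopologicalSpace M]
    [ChartedSpace (EuclideanSpace ℝ (Fin (n - 1))) M] where
  /-- the rectilinear generators -/
  gen : M → Submodule ℝ (LSpace n)
  exists_frame : ∀ u, ∃ A₀ Aₙ : M → LSpace n, IsFrameAt gen u A₀ Aₙ
  exists_regular : ∀ u, ∃ p, InDeSitter p ∧ IsRegularPoint gen u p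
  lightlike : ∀ u p, InDeSitter p → IsRegularPoint gen u p →
    IsLightlikeHyperplane (tangentSubspace gen u p)

/-- The hypersurface has the maximal rank `n - 1`: its tangent hyperplane, which is polar to the
point of contact `A₀` of the generator with the absolute quadric, depends on `n - 1` parameters,
that is, the map `u ↦ [A₀(u)]` has an injective differential. -/
def LightlikeHypersurface.HasMaximalRank {n : ℕ} {M : Type*} [TopologicalSpace M]
    [ChartedSpace (EuclideanSpace ℝ (Fin (n - 1))) M] (U : LightlikeHypersurface n M) : Prop :=
  ∀ (u : M) (σ : M → LSpace n), IsNullSectionAt U.gen u σ →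
    ∀ X, diff σ u X ∈ ℝ ∙ σ u → X = 0

end

end DeSitter

/-!
Let `(A₀, Aₙ)` be an adapted frame. The tangent hyperplane along a generator is polar to `A₀`, so
`(dAₙ, A₀) = 0`, and a vector orthogonal to `A₀` is spacelike or a multiple of `A₀`. Therefore `g`
is positive definite, the tangent subspace at `Aₙ + s A₀` degenerates exactly if some `X ≠ 0`
satisfies `dAₙ(X) + s dA₀(X) ∈ ℝ A₀`, and these `X` are the kernel of a form of the pencil
`λ - s g`. This form is symmetric, since `(∂ᵢA₀, Aₙ) = 0` implies `λᵢⱼ = (∂ᵢ∂ⱼA₀, Aₙ)`, so the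
pencil has `n - 1` real roots with kernels of the full multiplicity (`FrameJet.pencil`). A root
whose kernel has a constant dimension depends smoothly on the parameters, because the derivative
of the pencil with respect to `s` is definite; simple roots extend to smooth fields by the
implicit function theorem (`exists_smooth_eigenvalue`, `exists_smooth_root`).

Let `B = Aₙ + s A₀` be such a field of foci, so that `dB(X) = θ(X) A₀` for `X` in the kernel `K`
of the form `(dB, dA₀)`. Differentiating this form along its kernel gives `(∂_Z ∂_X B, dA₀(Y)) =
θ(X) g(Z, Y)` for `X, Y ∈ K`, and the symmetry of the second derivative gives `θ(X) Z = θ(Z) X` on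
`K`. If `dim K ≥ 2`, then `θ = 0`, that is, `B` is conic (`FocalCoord.fderiv_focus_eq_zero`). If
`dim K = 1`, then `θ` vanishes or is injective on `K`.

Where `θ = 0`, the kernel of `dB` is `K`, so `B` has constant rank and is constant on the leaves
of the foliation by `K` (`exists_constantRank_chart`). It describes a spacelike submanifold, since
`dB` is orthogonal to `A₀` and to `B`. Along a leaf `A₀` stays polar to `B` and to `dB`, so it
moves in an `m`-dimensional sphere, and since `A₀` is an immersion, it fills an open part of this
sphere (`eventually_mem_span_of_null`); the generators fill an open part of the cone over it.

Where `θ ≠ 0` and `m = 1`, the line field `K` is spanned by a smooth vector field, whose flow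
gives the foliation (`exists_flowBox`). Along an integral curve `B' = θ A₀` and `B'' ≡ θ A₀'`
modulo `A₀`, so the generators are the tangents of the curve `B` and it has no inflections
(`FocalCoord.exists_foldChart`).

The smoothness of the flow of a smooth vector field is proved here from the inverse function
theorem in a space of curves.
-/

namespace DeSitter

noncomputable section

/-! ### The Lorentzian scalar product -/

theorem lorentz_comm {n : ℕ} (x y : LSpace n) : lorentz n x y = lorentz n y x := by
  simp [lorentz_apply, mul_comm]

theorem eq_zero_of_lorentz_eq_zero {n : ℕ} {x : LSpace n} (h : ∀ y, lorentz n x y = 0) :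
    x = 0 := by
  have h0 : x 0 = 0 := by
    have := h (Pi.single 0 1)
    simpa [lorentz_apply] using this
  funext i
  refine Fin.cases h0 (fun j => ?_) i
  have := h (Pi.single j.succ 1)
  rw [lorentz_apply] at this
  simpa [Pi.single_apply, h0] using this

/-- A vector orthogonal to a null vector `a` differs from a multiple of `a` by a vector whose
time coordinate vanishes; hence the scalar product is positive semidefinite on `a^⊥`. -/
theorem lorentz_self_of_orthogonal_null {n : ℕ} {a x : LSpace n} (ha : a ≠ 0)
    (haa : lorentz n a a = 0) (hx : lorentz n a x = 0) :
    0 ≤ lorentz n x x ∧ (lorentz n x x = 0 → x ∈ ℝ ∙ a) := by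
  have h0 : a 0 ≠ 0 := by
    intro h0
    rw [lorentz_apply, h0] at haa
    simp only [mul_zero, neg_zero, zero_add] at haa
    rw [Finset.sum_eq_zero_iff_of_nonneg (fun i _ => mul_self_nonneg _)] at haa
    exact ha (funext fun i => Fin.cases h0 (fun j => by simpa using haa j (Finset.mem_univ _)) i)
  set c : ℝ := x 0 / a 0 with hc
  have hz : (x - c • a) 0 = 0 := by simp [hc, h0]
  have e : lorentz n (x - c • a) (x - c • a) = lorentz n x x := by
    have hx' : lorentz n x a = 0 := by rw [lorentz_comm]; exact hx
    simp [hx, haa, hx']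
  have e2 : lorentz n x x = ∑ i : Fin (n + 1), (x - c • a) i.succ * (x - c • a) i.succ := by
    rw [← e, lorentz_apply, hz]; simp
  rw [e2]
  refine ⟨Finset.sum_nonneg fun i _ => mul_self_nonneg _, fun h => ?_⟩
  rw [Finset.sum_eq_zero_iff_of_nonneg (fun i _ => mul_self_nonneg _)] at h
  have hx0 : x - c • a = 0 :=
    funext fun i => Fin.cases hz (fun j => by simpa using h j (Finset.mem_univ _)) i
  rw [sub_eq_zero.1 hx0]
  exact Submodule.smul_mem _ _ (Submodule.mem_span_singleton_self a)

/-- The scalar product is continuous bilinear; this is its bundled form. -/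
def lorentzL (n : ℕ) : LSpace n →L[ℝ] LSpace n →L[ℝ] ℝ :=
  LinearMap.toContinuousLinearMap
    ((LinearMap.toContinuousLinearMap (𝕜 := ℝ) (E := LSpace n) (F' := ℝ)).toLinearMap ∘ₗ lorentz n)

@[simp] theorem lorentzL_apply {n : ℕ} (x y : LSpace n) : lorentzL n x y = lorentz n x y := rfl

/-! ### The first-order data of a lightlike hypersurface along a generator -/

/-- The first-order data of an adapted frame `(A₀, Aₙ)` of a lightlike hypersurface of maximal rank
at a point of the parameter manifold with the tangent space `T`: the values `a₀`, `aₙ` of the frame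
vectors and their differentials `α = dA₀`, `ν = dAₙ`. -/
structure FrameJet (n : ℕ) {T : Type*} [AddCommGroup T] [Module ℝ T] (a₀ aₙ : LSpace n)
    (α ν : T →ₗ[ℝ] LSpace n) : Prop where
  ne_zero : a₀ ≠ 0
  null : lorentz n a₀ a₀ = 0
  orth : lorentz n a₀ aₙ = 0
  unit : lorentz n aₙ aₙ = 1
  α_zero : ∀ X, lorentz n (α X) a₀ = 0
  α_last : ∀ X, lorentz n (α X) aₙ = 0
  ν_zero : ∀ X, lorentz n (ν X) a₀ = 0
  ν_last : ∀ X, lorentz n (ν X) aₙ = 0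
  symm : ∀ X Y, lorentz n (α X) (ν Y) = lorentz n (α Y) (ν X)
  inj : ∀ X, α X ∈ ℝ ∙ a₀ → X = 0
  finrank_eq : finrank ℝ T + 1 = n

namespace FrameJet

variable {n : ℕ} {T : Type*} [AddCommGroup T] [Module ℝ T] {a₀ aₙ : LSpace n}
  {α ν : T →ₗ[ℝ] LSpace n}

/-- The directions in which the point `aₙ + s a₀` is displaced only along the generator. -/
def focalKer (a₀ aₙ : LSpace n) (α ν : T →ₗ[ℝ] LSpace n) (s : ℝ) : Submodule ℝ T :=
  (Submodule.span ℝ {a₀, aₙ}).comap (ν + s • α)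

theorem comp_equiv (h : FrameJet n a₀ aₙ α ν) {T' : Type*} [AddCommGroup T'] [Module ℝ T']
    (e : T' ≃ₗ[ℝ] T) : FrameJet n a₀ aₙ (α ∘ₗ e.toLinearMap) (ν ∘ₗ e.toLinearMap) where
  ne_zero := h.ne_zero
  null := h.null
  orth := h.orth
  unit := h.unit
  α_zero X := h.α_zero _
  α_last X := h.α_last _
  ν_zero X := h.ν_zero _
  ν_last X := h.ν_last _
  symm X Y := h.symm _ _
  inj X hX := by simpa using h.inj _ hX
  finrank_eq := by rw [e.finrank_eq]; exact h.finrank_eq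

theorem g_nonneg (h : FrameJet n a₀ aₙ α ν) (X : T) : 0 ≤ lorentz n (α X) (α X) :=
  (lorentz_self_of_orthogonal_null h.ne_zero h.null
    (by rw [lorentz_comm]; exact h.α_zero X)).1

theorem g_pos (h : FrameJet n a₀ aₙ α ν) {X : T} (hX : X ≠ 0) : 0 < lorentz n (α X) (α X) :=
  lt_of_le_of_ne (h.g_nonneg X) fun e => hX (h.inj X
    ((lorentz_self_of_orthogonal_null h.ne_zero h.null
      (by rw [lorentz_comm]; exact h.α_zero X)).2 e.symm))

theorem g_eq_zero (h : FrameJet n a₀ aₙ α ν) {X : T} (hX : lorentz n (α X) (α X) = 0) : X = 0 := by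
  by_contra hne
  exact (h.g_pos hne).ne' hX

/-- The three parts `a₀`, `aₙ`, `α T` are independent. -/
theorem combination_eq_zero (h : FrameJet n a₀ aₙ α ν) {c d : ℝ} {X : T}
    (hz : c • a₀ + d • aₙ + α X = 0) : c = 0 ∧ d = 0 ∧ X = 0 := by
  have hd : d = 0 := by
    have : lorentz n (c • a₀ + d • aₙ + α X) aₙ = 0 := by rw [hz]; simp
    simpa [h.orth, h.unit, h.α_last] using this
  have hX : X = 0 := by
    apply h.g_eq_zero
    have : lorentz n (c • a₀ + d • aₙ + α X) (α X) = 0 := by rw [hz]; simp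
    have e0 := h.α_zero X
    have e1 := h.α_last X
    rw [lorentz_comm] at e0 e1
    simpa [e0, e1] using this
  subst hd hX
  simpa [h.ne_zero] using hz

/-- `a₀^⊥` is spanned by `a₀`, `aₙ` and `α T`. -/
theorem exists_decomposition (h : FrameJet n a₀ aₙ α ν) [FiniteDimensional ℝ T] {x : LSpace n}
    (hx : lorentz n x a₀ = 0) : ∃ (c d : ℝ) (X : T), x = c • a₀ + d • aₙ + α X := by
  let f : (ℝ × ℝ) × T →ₗ[ℝ] LSpace n :=
    LinearMap.coprod (LinearMap.coprod (LinearMap.toSpanSingleton ℝ _ a₀)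
      (LinearMap.toSpanSingleton ℝ _ aₙ)) α
  have hf : Function.Injective f := by
    rw [← LinearMap.ker_eq_bot, LinearMap.ker_eq_bot']
    rintro ⟨⟨c, d⟩, X⟩ hz
    obtain ⟨rfl, rfl, rfl⟩ :=
      h.combination_eq_zero (c := c) (d := d) (X := X) (by simpa [f] using hz)
    rfl
  have hle : LinearMap.range f ≤ LinearMap.ker ((lorentz n).flip a₀) := by
    rintro _ ⟨⟨⟨c, d⟩, X⟩, rfl⟩
    have e := h.orth
    rw [lorentz_comm] at e
    simp [f, h.null, e, h.α_zero]
  have hne : (lorentz n).flip a₀ ≠ 0 := fun e => h.ne_zero (eq_zero_of_lorentz_eq_zero fun y => by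
    rw [lorentz_comm]; exact LinearMap.congr_fun e y)
  have hk : finrank ℝ (LinearMap.ker ((lorentz n).flip a₀)) + 1 = n + 2 := by
    have := Module.Dual.finrank_ker_add_one_of_ne_zero (K := ℝ) hne
    simpa using this
  have he : LinearMap.range f = LinearMap.ker ((lorentz n).flip a₀) := by
    apply Submodule.eq_of_le_of_finrank_eq hle
    rw [LinearMap.finrank_range_of_inj hf]
    have := h.finrank_eq
    simp
    omega
  have : x ∈ LinearMap.range f := by rw [he]; exact hx
  obtain ⟨⟨⟨c, d⟩, X⟩, rfl⟩ := this
  exact ⟨c, d, X, by simp [f]⟩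

/-- The polar of the tangent hyperplane `⟨a₀, aₙ, α T⟩` is the point `a₀`. -/
theorem mem_span_zero (h : FrameJet n a₀ aₙ α ν) [FiniteDimensional ℝ T] {x : LSpace n}
    (hx : lorentz n x a₀ = 0) (hx' : lorentz n x aₙ = 0)
    (hα : ∀ X, lorentz n x (α X) = 0) : x ∈ ℝ ∙ a₀ := by
  obtain ⟨c, d, X, rfl⟩ := h.exists_decomposition hx
  have hX : X = 0 := by
    apply h.g_eq_zero
    have := hα X
    have e0 := h.α_zero X
    have e1 := h.α_last X
    rw [lorentz_comm] at e0 e1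
    simpa [e0, e1] using this
  subst hX
  have hd : d = 0 := by simpa [h.orth, h.unit] using hx'
  subst hd
  exact Submodule.mem_span_singleton.2 ⟨c, by simp⟩

/-- The displacement of the focus lies in the generator only as a multiple of `a₀`: it is orthogonal
to `aₙ`, since `(dAₙ, Aₙ) = (dA₀, Aₙ) = 0`. -/
theorem mem_focalKer_iff_mem_span_zero (h : FrameJet n a₀ aₙ α ν) {s : ℝ} {X : T} :
    X ∈ focalKer a₀ aₙ α ν s ↔ ν X + s • α X ∈ ℝ ∙ a₀ := by
  simp only [focalKer, Submodule.mem_comap, LinearMap.add_apply, LinearMap.smul_apply]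
  refine ⟨fun hX => ?_, fun hX => Submodule.span_mono (by simp) hX⟩
  obtain ⟨c, d, e⟩ := Submodule.mem_span_pair.1 hX
  have hd : d = 0 := by
    have : lorentz n (c • a₀ + d • aₙ) aₙ = 0 := by rw [e]; simp [h.α_last, h.ν_last]
    simpa [h.orth, h.unit] using this
  rw [← e, hd]
  exact Submodule.mem_span_singleton.2 ⟨c, by simp⟩

/-- The singular directions form the kernel of the form `((ν + s α) X, α Y)`, which is `-(λ - s g)`
in the notation of the pencil. -/
theorem mem_focalKer_iff (h : FrameJet n a₀ aₙ α ν) [FiniteDimensional ℝ T] {s : ℝ} {X : T} :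
    X ∈ focalKer a₀ aₙ α ν s ↔ ∀ Y, lorentz n (ν X + s • α X) (α Y) = 0 := by
  rw [h.mem_focalKer_iff_mem_span_zero]
  constructor
  · intro hX Y
    obtain ⟨c, e⟩ := Submodule.mem_span_singleton.1 hX
    rw [← e, map_smul, LinearMap.smul_apply, lorentz_comm, h.α_zero, smul_zero]
  · intro hX
    exact h.mem_span_zero (by simp [h.α_zero, h.ν_zero]) (by simp [h.α_last, h.ν_last]) hX

/-- The dimension of the tangent subspace at a point of a generator. -/
theorem finrank_sup_range (h : FrameJet n a₀ aₙ α ν) [FiniteDimensional ℝ T]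
    (f : T →ₗ[ℝ] LSpace n) :
    finrank ℝ ↥(Submodule.span ℝ {a₀, aₙ} ⊔ LinearMap.range f) +
      finrank ℝ ((Submodule.span ℝ {a₀, aₙ}).comap f) = n + 1 := by
  set L := Submodule.span ℝ {a₀, aₙ} with hL
  have hL2 : finrank ℝ L = 2 := by
    have hli : LinearIndependent ℝ ![a₀, aₙ] := by
      rw [LinearIndependent.pair_iff]
      intro c d hcd
      have := h.combination_eq_zero (c := c) (d := d) (X := 0) (by simpa using hcd)
      exact ⟨this.1, this.2.1⟩
    have := finrank_span_eq_card hli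
    rw [hL, ← Matrix.range_cons_cons_empty a₀ aₙ ![]]
    simpa using this
  have h1 := Submodule.finrank_sup_add_finrank_inf_eq L (LinearMap.range f)
  have h2 := LinearMap.finrank_range_add_finrank_ker f
  have h3 : finrank ℝ (L.comap f) =
      finrank ℝ ↥(L ⊓ LinearMap.range f) + finrank ℝ (LinearMap.ker f) := by
    have h4 := LinearMap.finrank_range_add_finrank_ker (f.domRestrict (L.comap f))
    rw [LinearMap.range_domRestrict, Submodule.map_comap_eq, inf_comm] at h4
    rw [← h4]
    congr 1
    have : LinearMap.ker (f.domRestrict (L.comap f)) =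
        (LinearMap.ker f).comap (L.comap f).subtype := by
      ext x; simp
    rw [this]
    refine (Submodule.comapSubtypeEquivOfLe ?_).finrank_eq
    intro x hx
    simp [LinearMap.mem_ker.1 hx]
  have := h.finrank_eq
  omega

/-- The tangent subspace at a regular point is the hyperplane `⟨a₀, aₙ, α T⟩`. -/
theorem finrank_sup_range_zero (h : FrameJet n a₀ aₙ α ν) [FiniteDimensional ℝ T] :
    finrank ℝ ↥(Submodule.span ℝ {a₀, aₙ} ⊔ LinearMap.range α) = n + 1 := by
  have h1 := h.finrank_sup_range α
  have h2 : (Submodule.span ℝ {a₀, aₙ}).comap α = ⊥ := by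
    rw [eq_bot_iff]
    intro X hX
    obtain ⟨c, d, e⟩ := Submodule.mem_span_pair.1 (Submodule.mem_comap.1 hX)
    have := h.combination_eq_zero (c := -c) (d := -d) (X := X) (by rw [← e]; module)
    exact this.2.2
  rw [h2] at h1
  simpa using h1

/-- The shape operator: the endomorphism `A` of the tangent space with
`(dA₀(A X), dA₀(Y)) = -(dAₙ(X), dA₀(Y))`. -/
theorem exists_shape (h : FrameJet n a₀ aₙ α ν) [FiniteDimensional ℝ T] :
    ∃ A : T →ₗ[ℝ] T, ∀ X Y, lorentz n (α (A X)) (α Y) = -lorentz n (ν X) (α Y) := by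
  let g : LinearMap.BilinForm ℝ T := (lorentz n).compl₁₂ α α
  have hg : g.Nondegenerate := by
    constructor
    · intro X hX
      exact h.g_eq_zero (hX X)
    · intro X hX
      exact h.g_eq_zero (hX X)
  let e := LinearMap.BilinForm.toDual g hg
  refine ⟨e.symm.toLinearMap ∘ₗ (-(lorentz n).compl₁₂ ν α), fun X Y => ?_⟩
  have := LinearMap.congr_fun (e.apply_symm_apply ((-(lorentz n).compl₁₂ ν α) X)) Y
  rw [LinearMap.BilinForm.toDual_def] at this
  simpa [g] using this

end FrameJet

/-- The pencil `λ - s g` of two symmetric forms, the second positive definite: if `A` is the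
`g`-symmetric operator with the form `λ`, the polynomial `det (λ - s g)` is, up to a nonzero factor,
the characteristic polynomial of `A`. Hence all its roots are real, and algebraic and geometric
multiplicities agree. -/
theorem pencil_det {T : Type*} [AddCommGroup T] [Module ℝ T] [FiniteDimensional ℝ T]
    {ι : Type*} [Fintype ι] [DecidableEq ι] (b : Basis ι ℝ T) (g : LinearMap.BilinForm ℝ T)
    (hs : ∀ X Y, g X Y = g Y X) (hp : ∀ X, X ≠ 0 → 0 < g X X) (A : T →ₗ[ℝ] T)
    (hA : ∀ X Y, g (A X) Y = g X (A Y)) (L G : Matrix ι ι ℝ)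
    (hL : ∀ i j, L i j = g (b i) (A (b j))) (hG : ∀ i j, G i j = g (b i) (b j)) :
    ((L.map Polynomial.C - (Polynomial.X : ℝ[X]) • G.map Polynomial.C).det).natDegree
        = finrank ℝ T ∧
      Multiset.card ((L.map Polynomial.C - (Polynomial.X : ℝ[X]) • G.map Polynomial.C).det).roots
        = finrank ℝ T ∧
      ((L.map Polynomial.C - (Polynomial.X : ℝ[X]) • G.map Polynomial.C).det) ≠ 0 ∧
      ∀ s, ((L.map Polynomial.C -
            (Polynomial.X : ℝ[X]) • G.map Polynomial.C).det).rootMultiplicity s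
        = finrank ℝ (Module.End.eigenspace A s) := by
  let M := LinearMap.toMatrix b b A
  have hLG : L = G * M := by
    ext i j
    rw [hL, Matrix.mul_apply]
    conv_lhs => rw [← b.sum_repr (A (b j)), map_sum]
    exact Finset.sum_congr rfl fun k _ => by
      have hM : M k j = b.repr (A (b j)) k := LinearMap.toMatrix_apply b b A k j
      rw [hM, hG, map_smul, smul_eq_mul, mul_comm]
  have hGdet : G.det ≠ 0 := by
    intro h0
    obtain ⟨v, hv, hv0⟩ := Matrix.exists_mulVec_eq_zero_iff.2 h0
    set X := ∑ i, v i • b i with hX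
    have hX0 : X ≠ 0 := by
      intro h0
      apply hv
      funext i
      exact Fintype.linearIndependent_iff.1 b.linearIndependent v h0 i
    have h1 : ∀ i, g (b i) X = 0 := by
      intro i
      have := congrFun hv0 i
      simp only [Matrix.mulVec, dotProduct, Pi.zero_apply] at this
      rw [hX, map_sum, ← this]
      exact Finset.sum_congr rfl fun j _ => by rw [hG]; simp [mul_comm]
    have h2 : g X X = 0 := by
      conv_lhs => arg 1; rw [hX]
      simp [h1]
    exact (hp X hX0).ne' h2
  have hdet : (L.map Polynomial.C - (Polynomial.X : ℝ[X]) • G.map Polynomial.C).det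
      = Polynomial.C (G.det * (-1) ^ Fintype.card ι) * A.charpoly := by
    have h1 : L.map Polynomial.C - (Polynomial.X : ℝ[X]) • G.map Polynomial.C
        = (Polynomial.C : ℝ →+* ℝ[X]).mapMatrix G * (-(Matrix.charmatrix M)) := by
      rw [hLG]
      change ((Polynomial.C : ℝ →+* ℝ[X]).mapMatrix (G * M) -
          _ • (Polynomial.C : ℝ →+* ℝ[X]).mapMatrix G)
        = _
      rw [map_mul, Matrix.charmatrix, neg_sub, mul_sub, Matrix.scalar_apply,
        ← Matrix.smul_one_eq_diagonal, Matrix.mul_smul, Matrix.mul_one]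
    rw [h1, Matrix.det_mul, Matrix.det_neg, ← RingHom.map_det, ← LinearMap.charpoly_toMatrix A b]
    rw [Matrix.charpoly, map_mul, map_pow, map_neg, map_one]
    ring
  have hc : G.det * (-1) ^ Fintype.card ι ≠ 0 := mul_ne_zero hGdet (pow_ne_zero _ (by norm_num))
  let core : InnerProductSpace.Core ℝ T :=
    { inner := fun X Y => g X Y
      conj_inner_symm := fun X Y => by simp [hs Y X]
      re_inner_nonneg := fun X => by
        by_cases h : X = 0
        · simp [h]
        · exact (hp X h).le
      add_left := fun X Y Z => by simp
      smul_left := fun X Y r => by simp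
      definite := fun X h => by
        by_contra hX
        exact (hp X hX).ne' h }
  let _ : NormedAddCommGroup T := core.toNormedAddCommGroup
  let _ : InnerProductSpace ℝ T := InnerProductSpace.ofCore core.toCore
  have hsym : A.IsSymmetric := fun X Y => hA X Y
  have hsplit : A.charpoly.Splits := by
    let e := stdOrthonormalBasis ℝ T
    have := ((LinearMap.isHermitian_toMatrix_iff e).2 hsym).splits_charpoly
    rwa [LinearMap.charpoly_toMatrix] at this
  rw [hdet]
  have hne : A.charpoly ≠ 0 := A.charpoly_monic.ne_zero
  refine ⟨?_, ?_, ?_, ?_⟩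
  · rw [Polynomial.natDegree_C_mul hc, LinearMap.charpoly_natDegree]
  · rw [Polynomial.roots_C_mul _ hc, Polynomial.splits_iff_card_roots.1 hsplit,
      LinearMap.charpoly_natDegree]
  · exact mul_ne_zero (by simpa using hc) hne
  · intro s
    rw [← hsym.isFinitelySemisimple.maxGenEigenspace_eq_eigenspace,
      LinearMap.finrank_maxGenEigenspace_eq, ← Polynomial.count_roots, ← Polynomial.count_roots,
      Polynomial.roots_C_mul _ hc]

/-- The characteristic equation of a generator. -/
theorem FrameJet.pencil {n : ℕ} {T : Type*} [AddCommGroup T] [Module ℝ T] [FiniteDimensional ℝ T]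
    {a₀ aₙ : LSpace n} {α ν : T →ₗ[ℝ] LSpace n} (h : FrameJet n a₀ aₙ α ν)
    {ι : Type*} [Fintype ι] [DecidableEq ι] (b : Basis ι ℝ T) (P : ℝ[X])
    (hP : P = ((Matrix.of fun i j => -lorentz n (α (b i)) (ν (b j))).map Polynomial.C
      - (Polynomial.X : ℝ[X]) •
        (Matrix.of fun i j => lorentz n (α (b i)) (α (b j))).map Polynomial.C).det) :
    P.natDegree = n - 1 ∧ Multiset.card P.roots = n - 1 ∧ P ≠ 0 ∧
      ∀ s, P.rootMultiplicity s = finrank ℝ (focalKer a₀ aₙ α ν s) := by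
  obtain ⟨A, hA⟩ := h.exists_shape
  have hd : finrank ℝ T = n - 1 := by have := h.finrank_eq; omega
  have hA' : ∀ X Y, lorentz n (α X) (α (A Y)) = -lorentz n (α X) (ν Y) := fun X Y => by
    rw [lorentz_comm, hA, lorentz_comm]
  have key := pencil_det b ((lorentz n).compl₁₂ α α) (fun X Y => lorentz_comm _ _)
    (fun X hX => h.g_pos hX) A
    (fun X Y => by
      simp only [LinearMap.compl₁₂_apply]
      rw [hA, hA', h.symm X Y, lorentz_comm])
    (Matrix.of fun i j => -lorentz n (α (b i)) (ν (b j)))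
    (Matrix.of fun i j => lorentz n (α (b i)) (α (b j)))
    (fun i j => by simp [hA']) (fun i j => by simp)
  rw [← hP, hd] at key
  refine ⟨key.1, key.2.1, key.2.2.1, fun s => ?_⟩
  have : Module.End.eigenspace A s = focalKer a₀ aₙ α ν s := by
    ext X
    rw [Module.End.mem_eigenspace_iff, h.mem_focalKer_iff]
    have e : ∀ Y, lorentz n (ν X + s • α X) (α Y) = lorentz n (α (s • X - A X)) (α Y) := by
      intro Y
      simp [hA]
      ring
    simp only [e]
    constructor
    · intro hX Y; simp [hX]
    · intro hX
      exact (sub_eq_zero.1 (h.g_eq_zero (hX (s • X - A X)))).symm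
  rw [key.2.2.2 s, this]

/-! ### Local diffeomorphisms and implicit functions of class `C^∞` -/

/-- The inverse function theorem for a map that is smooth near a point: the local inverse is smooth
on the whole of a neighbourhood, which may be taken as small as needed. -/
theorem exists_localDiffeo {E F : Type*} [NormedAddCommGroup E] [NormedSpace ℝ E] [CompleteSpace E]
    [NormedAddCommGroup F] [NormedSpace ℝ F] {f : E → F} {a : E} {O : Set E} (hO : O ∈ 𝓝 a)
    (hf : ∀ᶠ x in 𝓝 a, ContDiffAt ℝ ∞ f x) (f' : E ≃L[ℝ] F)
    (hf' : HasFDerivAt f (f' : E →L[ℝ] F) a) :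
    ∃ e : OpenPartialHomeomorph E F, (∀ x, e x = f x) ∧ a ∈ e.source ∧ e.source ⊆ O ∧
      (∀ x ∈ e.source, ContDiffAt ℝ ∞ f x) ∧ ∀ y ∈ e.target, ContDiffAt ℝ ∞ e.symm y := by
  have hfa : ContDiffAt ℝ ∞ f a := hf.self_of_nhds
  let e₀ := hfa.toOpenPartialHomeomorph f hf' (by simp)
  have he₀ : (e₀ : E → F) = f := hfa.toOpenPartialHomeomorph_coe hf' (by simp)
  have hinv : ∀ᶠ x in 𝓝 a, fderiv ℝ f x ∈ range ((↑) : (E ≃L[ℝ] F) → E →L[ℝ] F) := by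
    have hc : ContinuousAt (fderiv ℝ f) a :=
      (hfa.fderiv_right (m := 0) (by simp)).continuousAt
    apply hc.eventually
    rw [hf'.fderiv]
    exact ContinuousLinearEquiv.nhds f'
  obtain ⟨V, hV, hVo, haV⟩ := eventually_nhds_iff.1 ((hf.and hinv).and hO)
  refine ⟨e₀.restrOpen V hVo, fun x => ?_, ?_, fun x hx => ?_, fun x hx => ?_, fun y hy => ?_⟩
  · change e₀ x = f x
    rw [he₀]
  · exact ⟨hfa.mem_toOpenPartialHomeomorph_source hf' (by simp), haV⟩
  · exact (hV x hx.2).2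
  · exact (hV x hx.2).1.1
  · set x := (e₀.restrOpen V hVo).symm y with hx
    have hxs : x ∈ (e₀.restrOpen V hVo).source := (e₀.restrOpen V hVo).map_target hy
    obtain ⟨⟨hsm, f'x, hf'x⟩, -⟩ := hV x hxs.2
    refine (e₀.restrOpen V hVo).contDiffAt_symm (f₀' := f'x) hy ?_ ?_
    · change HasFDerivAt e₀ _ x
      rw [he₀, hf'x]
      exact (hsm.differentiableAt (by simp)).hasFDerivAt
    · change ContDiffAt ℝ ∞ e₀ x
      rw [he₀]
      exact hsm

/-- A finite-dimensional form of the inverse function theorem, with an injective derivative. -/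
theorem exists_localDiffeo_of_injective {E F : Type*} [NormedAddCommGroup E] [NormedSpace ℝ E]
    [FiniteDimensional ℝ E] [NormedAddCommGroup F] [NormedSpace ℝ F] [FiniteDimensional ℝ F]
    {f : E → F} {a : E} {O : Set E} (hO : O ∈ 𝓝 a) (hf : ∀ᶠ x in 𝓝 a, ContDiffAt ℝ ∞ f x)
    (hdim : finrank ℝ E = finrank ℝ F) (hinj : ∀ X, fderiv ℝ f a X = 0 → X = 0) :
    ∃ e : OpenPartialHomeomorph E F, (∀ x, e x = f x) ∧ a ∈ e.source ∧ e.source ⊆ O ∧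
      (∀ x ∈ e.source, ContDiffAt ℝ ∞ f x) ∧ ∀ y ∈ e.target, ContDiffAt ℝ ∞ e.symm y := by
  have : CompleteSpace E := FiniteDimensional.complete ℝ E
  have hi : Function.Injective (fderiv ℝ f a).toLinearMap := by
    rw [← LinearMap.ker_eq_bot, LinearMap.ker_eq_bot']
    exact hinj
  let f' : E ≃L[ℝ] F :=
    (LinearEquiv.ofInjectiveOfFinrankEq (fderiv ℝ f a).toLinearMap hi hdim).toContinuousLinearEquiv
  refine exists_localDiffeo hO hf f' ?_
  have : (f' : E →L[ℝ] F) = fderiv ℝ f a := by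
    ext x
    rfl
  rw [this]
  exact (hf.self_of_nhds.differentiableAt (by simp)).hasFDerivAt

/-- The implicit function theorem for a scalar equation `G (x, s) = 0`. -/
theorem exists_implicit {E : Type*} [NormedAddCommGroup E] [NormedSpace ℝ E]
    [FiniteDimensional ℝ E] {G : E × ℝ → ℝ} {u : E} {s₀ : ℝ}
    (hG : ∀ᶠ p in 𝓝 (u, s₀), ContDiffAt ℝ ∞ G p) (h0 : G (u, s₀) = 0)
    (hs : fderiv ℝ G (u, s₀) (0, 1) ≠ 0) :
    ∃ σ : E → ℝ, σ u = s₀ ∧ (∀ᶠ x in 𝓝 u, ContDiffAt ℝ ∞ σ x ∧ G (x, σ x) = 0) ∧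
      ∀ᶠ p in 𝓝 (u, s₀), G p = 0 → p.2 = σ p.1 := by
  have hd : ∀ᶠ p in 𝓝 (u, s₀), ContDiffAt ℝ ∞ (fun p : E × ℝ => (p.1, G p)) p := by
    filter_upwards [hG] with p hp
    exact contDiffAt_fst.prodMk hp
  obtain ⟨e, he, hmem, -, -, hsymm⟩ := exists_localDiffeo_of_injective univ_mem hd rfl (by
    rintro ⟨X, t⟩ hX
    have hGd := (hG.self_of_nhds.differentiableAt (by simp)).hasFDerivAt
    have : HasFDerivAt (fun p : E × ℝ => (p.1, G p)) _ (u, s₀) := hasFDerivAt_fst.prodMk hGd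
    rw [this.fderiv] at hX
    simp only [ContinuousLinearMap.prod_apply, ContinuousLinearMap.coe_fst', Prod.mk_eq_zero] at hX
    obtain ⟨rfl, h2⟩ := hX
    have : ((0 : E), t) = t • ((0 : E), (1 : ℝ)) := by simp
    rw [this, map_smul, smul_eq_mul] at h2
    simp [(mul_eq_zero.1 h2).resolve_right hs])
  have ht : (u, (0 : ℝ)) ∈ e.target := by
    have := e.map_source hmem
    rwa [he, h0] at this
  have hu : e.symm (u, 0) = (u, s₀) := by
    have := e.left_inv hmem
    rwa [he, h0] at this
  have hc : ContinuousAt (fun x : E => (x, (0 : ℝ))) u := by fun_prop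
  have hev : ∀ᶠ x in 𝓝 u, (x, (0 : ℝ)) ∈ e.target := hc.eventually (e.open_target.mem_nhds ht)
  refine ⟨fun x => (e.symm (x, 0)).2, by simp [hu], ?_, ?_⟩
  · filter_upwards [hev] with x hx
    have hr := e.right_inv hx
    rw [he] at hr
    simp only [Prod.mk.injEq] at hr
    refine ⟨?_, ?_⟩
    · have h1 : ContDiffAt ℝ ∞ (fun x : E => e.symm (x, 0)) x :=
        (hsymm _ hx).comp x (contDiffAt_id.prodMk contDiffAt_const)
      exact contDiffAt_snd.comp x h1
    · have : ((x, (e.symm (x, 0)).2) : E × ℝ) = e.symm (x, 0) := Prod.ext hr.1.symm rfl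
      rw [this]
      exact hr.2
  · filter_upwards [e.open_source.mem_nhds hmem] with p hp hGp
    have := e.left_inv hp
    rw [he, hGp] at this
    rw [this]

/-! ### Kernels of families of symmetric operators -/

section Kernel

variable {E : Type*} [NormedAddCommGroup E] [InnerProductSpace ℝ E] [FiniteDimensional ℝ E]

/-- A symmetric operator plus the orthogonal projection onto its kernel is invertible. -/
theorem isUnit_add_kerProj {K : E →L[ℝ] E} (hK : ∀ X Y, inner ℝ (K X) Y = inner ℝ X (K Y)) :
    IsUnit (K + (LinearMap.ker K.toLinearMap).starProjection) := by
  set D := LinearMap.ker K.toLinearMap with hD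
  have hinj : Function.Injective (K + D.starProjection) := by
    refine (injective_iff_map_eq_zero (K + D.starProjection)).2 fun X hX => ?_
    simp only [add_apply] at hX
    have hPD : D.starProjection X ∈ D := Submodule.starProjection_apply_mem D X
    have hP0 : D.starProjection X = 0 := by
      have h1 : inner ℝ (K X) (D.starProjection X) = 0 := by
        rw [hK]
        have : K (D.starProjection X) = 0 := hPD
        rw [this, inner_zero_right]
      have h2 : inner ℝ (K X + D.starProjection X) (D.starProjection X) = 0 := by
        rw [hX, inner_zero_left]
      rw [inner_add_left, h1, zero_add] at h2
      exact inner_self_eq_zero.1 h2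
    rw [hP0, add_zero] at hX
    have : X ∈ D := hX
    rw [← Submodule.starProjection_eq_self_iff.2 this]
    exact hP0
  let e := (LinearEquiv.ofInjectiveEndo (K + D.starProjection).toLinearMap
    hinj).toContinuousLinearEquiv
  have : (e : E →L[ℝ] E) = K + D.starProjection := by ext x; rfl
  rw [← this]
  exact (ContinuousLinearEquiv.toUnit e).isUnit

/-- The inverse of `K + P`, where `P` is the orthogonal projection onto the kernel of `K₀`. For `K`
close to `K₀` it carries the kernel of `K₀` onto a subspace that contains the kernel of `K`. -/
def kerInv (K₀ K : E →L[ℝ] E) : E →L[ℝ] E :=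
  Ring.inverse (K + (LinearMap.ker K₀.toLinearMap).starProjection)

variable {K₀ K : E →L[ℝ] E}

theorem kerInv_right (hK : IsUnit (K + (LinearMap.ker K₀.toLinearMap).starProjection)) (X : E) :
    K (kerInv K₀ K X) + (LinearMap.ker K₀.toLinearMap).starProjection (kerInv K₀ K X) = X := by
  have := Ring.mul_inverse_cancel _ hK
  exact DFunLike.congr_fun this X

theorem kerInv_left (hK : IsUnit (K + (LinearMap.ker K₀.toLinearMap).starProjection)) (X : E) :
    kerInv K₀ K (K X + (LinearMap.ker K₀.toLinearMap).starProjection X) = X := by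
  have := Ring.inverse_mul_cancel _ hK
  exact DFunLike.congr_fun this X

theorem kerInv_injective (hK : IsUnit (K + (LinearMap.ker K₀.toLinearMap).starProjection)) :
    Function.Injective (kerInv K₀ K) := by
  intro X Y h
  rw [← kerInv_right hK X, h, kerInv_right hK Y]

theorem kerInv_self (hK₀ : ∀ X Y, inner ℝ (K₀ X) Y = inner ℝ X (K₀ Y)) {X : E} (hX : K₀ X = 0) :
    kerInv K₀ K₀ X = X := by
  have := kerInv_left (K₀ := K₀) (isUnit_add_kerProj hK₀) X
  rwa [hX, zero_add,
    Submodule.starProjection_eq_self_iff.2 (show X ∈ LinearMap.ker K₀.toLinearMap from hX)]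
    at this

theorem ker_le_map_kerInv (hK : IsUnit (K + (LinearMap.ker K₀.toLinearMap).starProjection)) :
    LinearMap.ker K.toLinearMap ≤
      (LinearMap.ker K₀.toLinearMap).map (kerInv K₀ K).toLinearMap := by
  intro X hX
  refine ⟨(LinearMap.ker K₀.toLinearMap).starProjection X,
    Submodule.starProjection_apply_mem _ X, ?_⟩
  have h := kerInv_left (K₀ := K₀) hK X
  have h0 : K X = 0 := hX
  rw [h0, zero_add] at h
  exact h

theorem finrank_map_kerInv (hK : IsUnit (K + (LinearMap.ker K₀.toLinearMap).starProjection)) :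
    finrank ℝ ((LinearMap.ker K₀.toLinearMap).map (kerInv K₀ K).toLinearMap)
      = finrank ℝ (LinearMap.ker K₀.toLinearMap) :=
  ((LinearMap.ker K₀.toLinearMap).equivMapOfInjective _ (kerInv_injective hK)).symm.finrank_eq

/-- If the kernels of `K` and `K₀` have the same dimension, `kerInv` carries one to the other. -/
theorem apply_kerInv_eq_zero (hK : IsUnit (K + (LinearMap.ker K₀.toLinearMap).starProjection))
    (hd : finrank ℝ (LinearMap.ker K.toLinearMap) = finrank ℝ (LinearMap.ker K₀.toLinearMap))
    {X : E} (hX : K₀ X = 0) : K (kerInv K₀ K X) = 0 := by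
  have he := Submodule.eq_of_le_of_finrank_eq (ker_le_map_kerInv hK)
    (hd.trans (finrank_map_kerInv hK).symm)
  have : kerInv K₀ K X ∈ LinearMap.ker K.toLinearMap := by
    rw [he]
    exact ⟨X, hX, rfl⟩
  exact this

/-- On the kernel of `K₀`, the operator `K ∘ (K + P)⁻¹ = 1 - P ∘ (K + P)⁻¹` takes values in this
kernel, so that the equation `K ∘ (K + P)⁻¹ = 0` there has as many components as unknowns. -/
theorem apply_kerInv_mem (hK : IsUnit (K + (LinearMap.ker K₀.toLinearMap).starProjection))
    {X : E} (hX : K₀ X = 0) : K₀ (K (kerInv K₀ K X)) = 0 := by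
  have h := kerInv_right hK X
  have : K (kerInv K₀ K X) = X - (LinearMap.ker K₀.toLinearMap).starProjection (kerInv K₀ K X) :=
    eq_sub_of_add_eq h
  rw [this]
  have h2 : (LinearMap.ker K₀.toLinearMap).starProjection (kerInv K₀ K X)
    ∈ LinearMap.ker K₀.toLinearMap := Submodule.starProjection_apply_mem _ _
  have h3 : K₀ ((LinearMap.ker K₀.toLinearMap).starProjection (kerInv K₀ K X)) = 0 := h2
  rw [map_sub, hX, h3, sub_zero]

theorem contDiffAt_kerInv {W : Type*} [NormedAddCommGroup W] [NormedSpace ℝ W] {κ : W → E →L[ℝ] E}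
    {w : W} (hκ : ContDiffAt ℝ ∞ κ w)
    (hu : IsUnit (κ w + (LinearMap.ker K₀.toLinearMap).starProjection)) :
    ContDiffAt ℝ ∞ (fun w => kerInv K₀ (κ w)) w := by
  have : CompleteSpace E := FiniteDimensional.complete ℝ E
  obtain ⟨x, hx⟩ := hu
  have h1 : ContDiffAt ℝ ∞ Ring.inverse (κ w + (LinearMap.ker K₀.toLinearMap).starProjection) := by
    rw [← hx]
    exact contDiffAt_ringInverse ℝ x
  have h2 : ContDiffAt ℝ ∞ (fun w => κ w + (LinearMap.ker K₀.toLinearMap).starProjection) w :=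
    hκ.add contDiffAt_const
  exact ContDiffAt.comp w h1 h2

theorem eventually_isUnit {W : Type*} [TopologicalSpace W] {κ : W → E →L[ℝ] E} {w : W}
    (hκ : ContinuousAt κ w) (hs : ∀ X Y, inner ℝ (κ w X) Y = inner ℝ X (κ w Y)) :
    ∀ᶠ w' in 𝓝 w, IsUnit (κ w' + (LinearMap.ker (κ w).toLinearMap).starProjection) := by
  have : CompleteSpace E := FiniteDimensional.complete ℝ E
  have hc : ContinuousAt (fun w' => κ w' + (LinearMap.ker (κ w).toLinearMap).starProjection) w :=
    hκ.add continuousAt_const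
  exact hc.eventually ((Units.isOpen (R := E →L[ℝ] E)).mem_nhds (isUnit_add_kerProj hs))

/-- If the symmetric operators `κ x` have kernels of a constant dimension near `u`, the derivative
of `κ` vanishes as a form on the kernel of `κ u`. -/
theorem inner_fderiv_ker_eq_zero {W : Type*} [NormedAddCommGroup W] [NormedSpace ℝ W]
    {κ : W → E →L[ℝ] E} {u : W} (hκ : ContDiffAt ℝ ∞ κ u)
    (hs : ∀ X Y, inner ℝ (κ u X) Y = inner ℝ X (κ u Y))
    (hd : ∀ᶠ x in 𝓝 u, finrank ℝ (LinearMap.ker (κ x).toLinearMap)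
      = finrank ℝ (LinearMap.ker (κ u).toLinearMap))
    (Z : W) {X Y : E} (hX : κ u X = 0) (hY : κ u Y = 0) : inner ℝ (fderiv ℝ κ u Z X) Y = 0 := by
  set ρ : W → E := fun x => kerInv (κ u) (κ x) X with hρ
  have hR : ContDiffAt ℝ ∞ ρ u :=
    (contDiffAt_kerInv hκ (isUnit_add_kerProj hs)).clm_apply contDiffAt_const
  have hz : (fun x => κ x (ρ x)) =ᶠ[𝓝 u] fun _ => 0 := by
    filter_upwards [hd, eventually_isUnit hκ.continuousAt hs] with x hx hxu
    exact apply_kerInv_eq_zero hxu hx hX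
  have hder := ((hκ.differentiableAt (by simp)).hasFDerivAt).clm_apply
    ((hR.differentiableAt (by simp)).hasFDerivAt)
  have h0 := hz.hasFDerivAt_iff.1 hder
  have h1 := h0.unique (hasFDerivAt_const (0 : E) u)
  have h2 := DFunLike.congr_fun h1 Z
  have hρu : ρ u = X := kerInv_self hs hX
  simp only [add_apply, ContinuousLinearMap.comp_apply,
    ContinuousLinearMap.flip_apply, zero_apply, hρu] at h2
  have h3 : inner ℝ (κ u (fderiv ℝ ρ u Z) + fderiv ℝ κ u Z X) Y = 0 := by
    rw [h2, inner_zero_left]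
  rwa [inner_add_left, hs, hY, inner_zero_right, zero_add] at h3

/-- A kernel vector extends to a smooth field of kernel vectors if the dimension of the kernel is
locally constant. -/
theorem exists_kernel_field {W : Type*} [NormedAddCommGroup W] [NormedSpace ℝ W]
    {κ : W → E →L[ℝ] E} {u : W} (hκ : ∀ᶠ x in 𝓝 u, ContDiffAt ℝ ∞ κ x)
    (hs : ∀ X Y, inner ℝ (κ u X) Y = inner ℝ X (κ u Y))
    (hd : ∀ᶠ x in 𝓝 u, finrank ℝ (LinearMap.ker (κ x).toLinearMap)
      = finrank ℝ (LinearMap.ker (κ u).toLinearMap)) {X : E} (hX : κ u X = 0) :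
    ∃ V : W → E, V u = X ∧ ∀ᶠ x in 𝓝 u, ContDiffAt ℝ ∞ V x ∧ κ x (V x) = 0 := by
  refine ⟨fun x => kerInv (κ u) (κ x) X, kerInv_self hs hX, ?_⟩
  filter_upwards [hκ, hd, eventually_isUnit hκ.self_of_nhds.continuousAt hs] with x h1 h2 h3
  exact ⟨(contDiffAt_kerInv h1 h3).clm_apply contDiffAt_const, apply_kerInv_eq_zero h3 h2 hX⟩

/-- An eigenvalue parameter `s` at which the kernel of the symmetric operators `κ (x, s)` has a
constant dimension depends smoothly on `x`, provided the derivative of `κ` with respect to `s` is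
positive; a parameter with a one-dimensional kernel always extends to a smooth field of such
parameters. -/
theorem exists_smooth_eigenvalue {W : Type*} [NormedAddCommGroup W] [NormedSpace ℝ W]
    [FiniteDimensional ℝ W] {κ : W × ℝ → E →L[ℝ] E} {u : W} {s₀ : ℝ}
    (hκs : ∀ᶠ p in 𝓝 (u, s₀), ContDiffAt ℝ ∞ κ p)
    (hs : ∀ X Y, inner ℝ (κ (u, s₀) X) Y = inner ℝ X (κ (u, s₀) Y))
    (hpos : ∀ X, X ≠ 0 → 0 < inner ℝ (fderiv ℝ κ (u, s₀) (0, 1) X) X)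
    (hD : LinearMap.ker (κ (u, s₀)).toLinearMap ≠ ⊥) :
    ∃ σ : W → ℝ, σ u = s₀ ∧ (∀ᶠ x in 𝓝 u, ContDiffAt ℝ ∞ σ x) ∧
      (∀ᶠ p in 𝓝 (u, s₀), finrank ℝ (LinearMap.ker (κ p).toLinearMap)
        = finrank ℝ (LinearMap.ker (κ (u, s₀)).toLinearMap) → p.2 = σ p.1) ∧
      (finrank ℝ (LinearMap.ker (κ (u, s₀)).toLinearMap) = 1 →
        ∀ᶠ x in 𝓝 u, finrank ℝ (LinearMap.ker (κ (x, σ x)).toLinearMap) = 1) := by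
  obtain ⟨X, hXD, hX0⟩ := Submodule.exists_mem_ne_zero_of_ne_bot hD
  have hX : κ (u, s₀) X = 0 := hXD
  have hu := eventually_isUnit hκs.self_of_nhds.continuousAt hs
  obtain ⟨ρ, hρ⟩ : ∃ ρ : W × ℝ → E, ∀ p, ρ p = kerInv (κ (u, s₀)) (κ p) X := ⟨_, fun _ => rfl⟩
  have hρs : ∀ᶠ p in 𝓝 (u, s₀), ContDiffAt ℝ ∞ ρ p := by
    filter_upwards [hκs, hu] with p h1 h2
    have := (contDiffAt_kerInv h1 h2).clm_apply (contDiffAt_const (c := X))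
    rwa [← show ρ = _ from funext hρ] at this
  have hρ₀ : ρ (u, s₀) = X := by rw [hρ]; exact kerInv_self hs hX
  obtain ⟨F, hFdef⟩ : ∃ F : W × ℝ → ℝ, F = fun p => inner ℝ (κ p (ρ p)) X := ⟨_, rfl⟩
  have hF : ∀ᶠ p in 𝓝 (u, s₀), ContDiffAt ℝ ∞ F p := by
    rw [hFdef]
    filter_upwards [hκs, hρs] with p h1 h2
    exact (h1.clm_apply h2).inner ℝ contDiffAt_const
  have hF0 : F (u, s₀) = 0 := by
    simp only [hFdef]
    rw [hρ₀, hX, inner_zero_left]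
  have hFd : fderiv ℝ F (u, s₀) (0, 1) = inner ℝ (fderiv ℝ κ (u, s₀) (0, 1) X) X := by
    have hκd := (hκs.self_of_nhds.differentiableAt (by simp)).hasFDerivAt
    have hρd := (hρs.self_of_nhds.differentiableAt (by simp)).hasFDerivAt
    have h1 := (hκd.clm_apply hρd).inner ℝ (hasFDerivAt_const X (u, s₀))
    rw [hFdef, h1.fderiv]
    simp only [ContinuousLinearMap.comp_apply, ContinuousLinearMap.prod_apply,
      fderivInnerCLM_apply, zero_apply, inner_zero_right, zero_add,
      add_apply, ContinuousLinearMap.flip_apply, hρ₀, inner_add_left]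
    rw [hs, hX, inner_zero_right, zero_add]
  obtain ⟨σ, hσ0, hσ1, hσ2⟩ := exists_implicit hF hF0 (by rw [hFd]; exact (hpos X hX0).ne')
  refine ⟨σ, hσ0, hσ1.mono fun x hx => hx.1, ?_, fun h1 => ?_⟩
  · filter_upwards [hσ2, hu] with p hp hpu hdim
    apply hp
    have : κ p (ρ p) = 0 := by rw [hρ]; exact apply_kerInv_eq_zero hpu hdim hX
    simp only [hFdef]
    rw [this, inner_zero_left]
  · have hσc : Tendsto (fun x => (x, σ x)) (𝓝 u) (𝓝 (u, s₀)) := by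
      have : ContinuousAt (fun x => (x, σ x)) u :=
        continuousAt_id.prodMk hσ1.self_of_nhds.1.continuousAt
      rw [ContinuousAt, hσ0] at this
      exact this
    filter_upwards [hσ1, hσc.eventually hu] with x hx hxu
    have hmem : κ (x, σ x) (ρ (x, σ x)) ∈ LinearMap.ker (κ (u, s₀)).toLinearMap := by
      rw [hρ]
      exact apply_kerInv_mem hxu hX
    -- a vector of a line that is orthogonal to a nonzero vector of this line vanishes
    obtain ⟨c, hc⟩ := (finrank_eq_one_iff_of_nonzero'
      (⟨X, hXD⟩ : LinearMap.ker (κ (u, s₀)).toLinearMap)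
      (fun h => hX0 (congrArg Subtype.val h))).1 h1 ⟨_, hmem⟩
    have hc' : c • X = κ (x, σ x) (ρ (x, σ x)) := congrArg Subtype.val hc
    have hF' : inner ℝ (κ (x, σ x) (ρ (x, σ x))) X = 0 := by
      have := hx.2
      simpa only [hFdef] using this
    have hz : κ (x, σ x) (ρ (x, σ x)) = 0 := by
      rw [← hc', real_inner_smul_left, mul_eq_zero] at hF'
      rcases hF' with h | h
      · rw [← hc', h, zero_smul]
      · exact absurd (inner_self_eq_zero.1 h) hX0
    have hne : ρ (x, σ x) ≠ 0 := fun h =>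
      hX0 (kerInv_injective hxu (by rw [map_zero, ← hρ]; exact h))
    apply le_antisymm
    · have := Submodule.finrank_mono (ker_le_map_kerInv hxu)
      rwa [finrank_map_kerInv hxu, h1] at this
    · refine Nat.one_le_iff_ne_zero.2 fun h => hne ?_
      rw [Submodule.finrank_eq_zero] at h
      have : ρ (x, σ x) ∈ LinearMap.ker (κ (x, σ x)).toLinearMap := hz
      rwa [h, Submodule.mem_bot] at this

/-- The case of a pencil `N + s G` with a positive definite `G`. -/
theorem exists_smooth_root {W : Type*} [NormedAddCommGroup W] [NormedSpace ℝ W]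
    [FiniteDimensional ℝ W] {N G : W → E →L[ℝ] E} {u : W}
    (hN : ∀ᶠ x in 𝓝 u, ContDiffAt ℝ ∞ N x) (hG : ∀ᶠ x in 𝓝 u, ContDiffAt ℝ ∞ G x) {s₀ : ℝ}
    (hs : ∀ X Y, inner ℝ ((N u + s₀ • G u) X) Y = inner ℝ X ((N u + s₀ • G u) Y))
    (hpos : ∀ X, X ≠ 0 → 0 < inner ℝ (G u X) X)
    (hD : LinearMap.ker (N u + s₀ • G u).toLinearMap ≠ ⊥) :
    ∃ σ : W → ℝ, σ u = s₀ ∧ (∀ᶠ x in 𝓝 u, ContDiffAt ℝ ∞ σ x) ∧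
      (∀ᶠ p : W × ℝ in 𝓝 (u, s₀), finrank ℝ (LinearMap.ker (N p.1 + p.2 • G p.1).toLinearMap)
        = finrank ℝ (LinearMap.ker (N u + s₀ • G u).toLinearMap) → p.2 = σ p.1) ∧
      (finrank ℝ (LinearMap.ker (N u + s₀ • G u).toLinearMap) = 1 →
        ∀ᶠ x in 𝓝 u, finrank ℝ (LinearMap.ker (N x + σ x • G x).toLinearMap) = 1) := by
  have hfst : Tendsto (Prod.fst : W × ℝ → W) (𝓝 (u, s₀)) (𝓝 u) := continuous_fst.tendsto _
  have hκs : ∀ᶠ p in 𝓝 (u, s₀), ContDiffAt ℝ ∞ (fun p : W × ℝ => N p.1 + p.2 • G p.1) p := by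
    filter_upwards [hfst.eventually hN, hfst.eventually hG] with p h1 h2
    exact (h1.comp p contDiffAt_fst).add (contDiffAt_snd.smul (h2.comp p contDiffAt_fst))
  refine exists_smooth_eigenvalue hκs hs (fun X hX => ?_) hD
  have hκ1 : fderiv ℝ (fun p : W × ℝ => N p.1 + p.2 • G p.1) (u, s₀) (0, 1) = G u := by
    have hl : HasDerivAt (fun t : ℝ => N u + t • G u) (G u) s₀ := by
      have := ((hasDerivAt_id s₀).smul_const (G u)).const_add (N u)
      simpa using this
    have hline : HasDerivAt (fun t : ℝ => (u, t)) ((0 : W), (1 : ℝ)) s₀ :=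
      (hasDerivAt_const s₀ u).prodMk (hasDerivAt_id s₀)
    exact (HasFDerivAt.comp_hasDerivAt s₀
      ((hκs.self_of_nhds.differentiableAt (by simp)).hasFDerivAt) hline).unique hl
  rw [hκ1]
  exact hpos X hX

end Kernel

/-! ### Smooth dependence of solutions of differential equations on the initial point -/

section Flow

open MeasureTheory

universe u

/-- The pointwise application of a family of operators to a family of vectors. -/
def pointwiseApply (K : Type*) [TopologicalSpace K] [CompactSpace K] (E F : Type*)
    [NormedAddCommGroup E] [NormedSpace ℝ E] [NormedAddCommGroup F] [NormedSpace ℝ F] :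
    C(K, E →L[ℝ] F) →L[ℝ] C(K, E) →L[ℝ] C(K, F) :=
  LinearMap.mkContinuous₂
    (LinearMap.mk₂ ℝ
      (fun (A : C(K, E →L[ℝ] F)) (γ : C(K, E)) => (⟨fun τ => A τ (γ τ), by fun_prop⟩ : C(K, F)))
      (fun A B γ => by ext; simp) (fun c A γ => by ext; simp)
      (fun A γ η => by ext; simp) (fun c A γ => by ext; simp)) 1 (fun A γ => by
      rw [ContinuousMap.norm_le _ (by positivity)]
      intro τ
      rw [one_mul]
      exact (ContinuousLinearMap.le_opNorm _ _).trans
        (mul_le_mul (A.norm_coe_le_norm τ) (γ.norm_coe_le_norm τ) (norm_nonneg (γ τ))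
          (norm_nonneg A)))

variable {E : Type u} [NormedAddCommGroup E] [NormedSpace ℝ E]

theorem hasFDerivAt_postcomp {K : Type*} [TopologicalSpace K] [CompactSpace K] {F : Type*}
    [NormedAddCommGroup F] [NormedSpace ℝ F] {f : E → F} (hf : ContDiff ℝ 1 f) (γ : C(K, E)) :
    HasFDerivAt (fun γ : C(K, E) => (⟨f, hf.continuous⟩ : C(E, F)).comp γ)
      (pointwiseApply K E F
        ((⟨fderiv ℝ f, hf.continuous_fderiv (by simp)⟩ : C(E, E →L[ℝ] F)).comp γ)) γ := by
  set D : C(E, E →L[ℝ] F) := ⟨fderiv ℝ f, hf.continuous_fderiv (by simp)⟩ with hD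
  refine HasFDerivAt.of_isLittleO (Asymptotics.isLittleO_iff.2 fun c hc => ?_)
  have hDc : Continuous fun γ : C(K, E) => D.comp γ := ContinuousMap.continuous_postcomp D
  obtain ⟨δ, hδ, hball⟩ := (Metric.continuousAt_iff (f := fun γ : C(K, E) => D.comp γ)
    (a := γ)).1 hDc.continuousAt c hc
  filter_upwards [Metric.ball_mem_nhds γ hδ] with η hη
  rw [ContinuousMap.norm_le _ (by positivity)]
  intro τ
  have hητ : ‖η τ - γ τ‖ ≤ ‖η - γ‖ := (η - γ).norm_coe_le_norm τ
  have hητ' : η τ ∈ Metric.ball (γ τ) δ := by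
    rw [mem_ball_iff_norm] at hη ⊢
    exact hητ.trans_lt hη
  have key := Convex.norm_image_sub_le_of_norm_fderiv_le' (𝕜 := ℝ) (f := f) (C := c)
    (s := Metric.ball (γ τ) δ) (x := γ τ) (y := η τ) (φ := fderiv ℝ f (γ τ))
    (fun z _ => hf.differentiable (by simp) z) (fun z hz => by
      have h1 : dist (γ + ContinuousMap.const K (z - γ τ)) γ < δ := by
        refine lt_of_le_of_lt ?_ hz
        rw [ContinuousMap.dist_le dist_nonneg]
        intro σ
        simp [dist_eq_norm]
      have h2 := hball h1
      have h3 := (ContinuousMap.dist_le hc.le).1 h2.le τ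
      simpa [dist_eq_norm, hD] using h3) (convex_ball _ _) (Metric.mem_ball_self hδ) hητ'
  refine le_trans ?_ (mul_le_mul_of_nonneg_left hητ hc.le)
  exact key

/-- Composition with a smooth map is a smooth operator on a space of continuous maps. -/
theorem contDiff_postcomp_nat {K : Type*} [TopologicalSpace K] [CompactSpace K] (k : ℕ) :
    ∀ {F : Type u} [NormedAddCommGroup F] [NormedSpace ℝ F] {f : E → F} (hf : ContDiff ℝ k f),
      ContDiff ℝ k (fun γ : C(K, E) => (⟨f, hf.continuous⟩ : C(E, F)).comp γ) := by
  induction k with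
  | zero =>
    intro F _ _ f hf
    exact contDiff_zero.2 (ContinuousMap.continuous_postcomp _)
  | succ k ih =>
    intro F _ _ f hf
    have hf1 : ContDiff ℝ 1 f := hf.of_le (by norm_cast; omega)
    have hD : ContDiff ℝ k (fderiv ℝ f) := hf.fderiv_right (by norm_cast)
    have := ih hD
    push_cast
    rw [contDiff_succ_iff_hasFDerivAt]
    have hA : ContDiff ℝ k (fun A => pointwiseApply K E F A) :=
      ContinuousLinearMap.contDiff (𝕜 := ℝ) (E := C(K, E →L[ℝ] F)) (F := C(K, E) →L[ℝ] C(K, F))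
        (pointwiseApply K E F)
    exact ⟨fun γ => pointwiseApply K E F
      ((⟨fderiv ℝ f, hD.continuous⟩ : C(E, E →L[ℝ] F)).comp γ),
      hA.comp this, fun γ => hasFDerivAt_postcomp hf1 γ⟩

theorem contDiff_postcomp {K : Type*} [TopologicalSpace K] [CompactSpace K] {F : Type u}
    [NormedAddCommGroup F] [NormedSpace ℝ F] {f : E → F} (hf : ContDiff ℝ ∞ f) :
    ContDiff ℝ ∞ (fun γ : C(K, E) => (⟨f, hf.continuous⟩ : C(E, F)).comp γ) :=
  contDiff_infty.2 fun k => contDiff_postcomp_nat k (hf.of_le (by exact_mod_cast le_top))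

/-- The curves parametrized by `[-1, 1]`. -/
abbrev Curve (E : Type*) [TopologicalSpace E] := C(Icc (-1 : ℝ) 1, E)

/-- The extension of a curve to the real line by constants. -/
def Curve.extend {E : Type*} [TopologicalSpace E] (γ : Curve E) : ℝ → E :=
  IccExtend (by norm_num : (-1 : ℝ) ≤ 1) γ

theorem Curve.extend_continuous {E : Type*} [NormedAddCommGroup E] (γ : Curve E) :
    Continuous γ.extend := γ.continuous.Icc_extend'

theorem Curve.extend_apply {E : Type*} [NormedAddCommGroup E] (γ : Curve E) {τ : ℝ}
    (h : τ ∈ Icc (-1 : ℝ) 1) :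
    γ.extend τ = γ ⟨τ, h⟩ := IccExtend_of_mem _ _ h

theorem Curve.norm_extend_le {E : Type*} [NormedAddCommGroup E] (γ : Curve E) (τ : ℝ) :
    ‖γ.extend τ‖ ≤ ‖γ‖ := γ.norm_coe_le_norm _

/-- The integration operator `γ ↦ ∫₀ γ` on curves. -/
def curveIntegral (E : Type*) [NormedAddCommGroup E] [NormedSpace ℝ E] : Curve E →L[ℝ] Curve E :=
  LinearMap.mkContinuous
    { toFun := fun γ => ⟨fun τ => ∫ σ in (0 : ℝ)..τ, γ.extend σ,
        (intervalIntegral.continuous_primitive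
          (fun a b => γ.extend_continuous.intervalIntegrable a b) 0).comp continuous_subtype_val⟩
      map_add' := fun γ η => by
        ext τ
        exact intervalIntegral.integral_add (γ.extend_continuous.intervalIntegrable _ _)
          (η.extend_continuous.intervalIntegrable _ _)
      map_smul' := fun c γ => by
        ext τ
        exact intervalIntegral.integral_smul c _ } 1 (fun γ => by
    rw [ContinuousMap.norm_le _ (by positivity)]
    intro τ
    have h1 : |(τ : ℝ) - 0| ≤ 1 := by rw [sub_zero]; exact abs_le.2 τ.2
    have h2 := intervalIntegral.norm_integral_le_of_norm_le_const (a := 0) (b := (τ : ℝ))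
      (f := γ.extend) (C := ‖γ‖) (fun σ _ => γ.norm_extend_le σ)
    refine h2.trans ?_
    rw [one_mul]
    exact mul_le_of_le_one_right (norm_nonneg _) h1)

/-- The reparametrized curve `τ ↦ γ (r τ)`. -/
def Curve.scale (γ : Curve E) (r : ℝ) : Curve E :=
  ⟨fun τ => γ.extend (r * τ), γ.extend_continuous.comp (by fun_prop)⟩

/-- The equation of the integral curves `τ ↦ γ(τ)`, with `γ' = t V(γ)` and `γ(0) = y`. -/
def flowEq (V : C(E, E)) (q : (ℝ × E) × Curve E) : Curve E :=
  q.2 - ContinuousMap.const _ q.1.2 - q.1.1 • curveIntegral E (V.comp q.2)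

theorem flowEq_eq_zero_iff (V : C(E, E)) (t : ℝ) (y : E) (γ : Curve E) :
    flowEq V ((t, y), γ) = 0 ↔
      ∀ τ ∈ Icc (-1 : ℝ) 1, γ.extend τ = y + t • ∫ σ in (0 : ℝ)..τ, V (γ.extend σ) := by
  constructor
  · intro h τ hτ
    have := DFunLike.congr_fun h ⟨τ, hτ⟩
    rw [γ.extend_apply hτ, ← sub_eq_zero, ← sub_sub]
    exact this
  · intro h
    ext τ
    have := h τ τ.2
    rw [γ.extend_apply τ.2, ← sub_eq_zero, ← sub_sub] at this
    exact this

/-- If `γ` is the integral curve at the speed `t`, then `τ ↦ γ (r τ)` is the one at the speed `r t`.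
Thus the solutions on `[-1, 1]` for small speeds give the flow at small times. -/
theorem flowEq_scale {V : C(E, E)} {t : ℝ} {y : E} {γ : Curve E}
    (h : flowEq V ((t, y), γ) = 0) {r : ℝ} (hr : r ∈ Icc (-1 : ℝ) 1) :
    flowEq V ((r * t, y), γ.scale r) = 0 := by
  have hmul : ∀ τ ∈ Icc (-1 : ℝ) 1, r * τ ∈ Icc (-1 : ℝ) 1 := fun τ hτ => by
    rw [mem_Icc, ← abs_le] at *
    rw [abs_mul]
    exact mul_le_one₀ hr (abs_nonneg _) hτ
  rw [flowEq_eq_zero_iff] at h ⊢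
  intro τ hτ
  have e1 : ∀ σ ∈ Icc (-1 : ℝ) 1, (γ.scale r).extend σ = γ.extend (r * σ) := fun σ hσ =>
    (γ.scale r).extend_apply hσ
  rw [e1 τ hτ, h _ (hmul τ hτ)]
  have e2 : ∫ σ in (0 : ℝ)..τ, V ((γ.scale r).extend σ) =
      ∫ σ in (0 : ℝ)..τ, V (γ.extend (r * σ)) := by
    refine intervalIntegral.integral_congr fun σ hσ => ?_
    have hσ' : σ ∈ Icc (-1 : ℝ) 1 := by
      refine (uIcc_subset_Icc (by norm_num) hτ) hσ
    change V _ = V _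
    rw [e1 σ hσ']
  rw [e2, mul_comm r t, mul_smul]
  have e3 := intervalIntegral.smul_integral_comp_mul_left (a := 0) (b := τ)
    (fun σ => V (γ.extend σ)) r
  rw [e3, mul_zero]

theorem contDiff_flowEq {V : E → E} (hV : ContDiff ℝ ∞ V) :
    ContDiff ℝ ∞ (flowEq ⟨V, hV.continuous⟩) := by
  have h1 : ContDiff ℝ ∞ (fun q : (ℝ × E) × Curve E =>
      (ContinuousMap.const (Icc (-1 : ℝ) 1) q.1.2 : Curve E)) := by
    have : ContDiff ℝ ∞ (fun y : E => (ContinuousMap.const (Icc (-1 : ℝ) 1) y : Curve E)) :=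
      (ContinuousLinearMap.contDiff
        (ContinuousLinearMap.mk (IsLinearMap.mk'
          (fun y : E => (ContinuousMap.const (Icc (-1 : ℝ) 1) y : Curve E))
          ⟨fun x y => by ext; simp, fun c x => by ext; simp⟩)
          (ContinuousMap.continuous_const')))
    exact this.comp (contDiff_snd.comp contDiff_fst)
  have h2 : ContDiff ℝ ∞ (fun q : (ℝ × E) × Curve E =>
      curveIntegral E ((⟨V, hV.continuous⟩ : C(E, E)).comp q.2)) :=
    (curveIntegral E).contDiff.comp ((contDiff_postcomp hV).comp contDiff_snd)
  exact (contDiff_snd.sub h1).sub ((contDiff_fst.comp contDiff_fst).smul h2)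

/-- A smooth vector field has a local flow that is jointly smooth in the time and the initial point.
The integral curves are the solutions of an equation in a space of curves, to which the inverse
function theorem applies. -/
theorem exists_smooth_flow [CompleteSpace E] {V : E → E} (hV : ContDiff ℝ ∞ V) (x₀ : E) :
    ∃ φ : ℝ × E → E, (∀ᶠ p in 𝓝 ((0 : ℝ), x₀), ContDiffAt ℝ ∞ φ p) ∧
      (∀ᶠ y in 𝓝 x₀, φ (0, y) = y) ∧
      ∀ᶠ p in 𝓝 ((0 : ℝ), x₀), HasDerivAt (fun t => φ (t, p.2)) (V (φ p)) p.1 := by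
  set Vc : C(E, E) := ⟨V, hV.continuous⟩ with hVc
  let c₀ : Curve E := ContinuousMap.const _ x₀
  let Ψ : (ℝ × E) × Curve E → (ℝ × E) × Curve E := fun q => (q.1, flowEq Vc q)
  have hFs : ContDiff ℝ ∞ (flowEq Vc) := contDiff_flowEq hV
  have hΨ : ContDiff ℝ ∞ Ψ := contDiff_fst.prodMk hFs
  set F' := fderiv ℝ (flowEq Vc) ((0, x₀), c₀) with hF'
  have hF'2 : ∀ h : Curve E, F' (0, h) = h := by
    intro h
    have h1 : HasFDerivAt (fun γ : Curve E => flowEq Vc ((0, x₀), γ))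
        (F'.comp (ContinuousLinearMap.inr ℝ (ℝ × E) (Curve E))) c₀ :=
      ((hFs.differentiable (by simp)).differentiableAt.hasFDerivAt (x := ((0, x₀), c₀))).comp c₀
        (hasFDerivAt_prodMk_right (0, x₀) c₀)
    have h2 : HasFDerivAt (fun γ : Curve E => flowEq Vc ((0, x₀), γ))
        (ContinuousLinearMap.id ℝ (Curve E)) c₀ := by
      have : (fun γ : Curve E => flowEq Vc ((0, x₀), γ)) = fun γ => γ - c₀ := by
        funext γ
        simp [flowEq, c₀]
      rw [this]
      exact (hasFDerivAt_id c₀).sub_const c₀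
    simpa using DFunLike.congr_fun (h1.unique h2) h
  have hsplit : ∀ (p : ℝ × E) (h : Curve E), F' (p, h) = F' (p, 0) + h := by
    intro p h
    conv_rhs => rw [← hF'2 h]
    rw [← map_add]
    simp
  let Ψ' : ((ℝ × E) × Curve E) ≃L[ℝ] ((ℝ × E) × Curve E) :=
    ContinuousLinearEquiv.equivOfInverse
      ((ContinuousLinearMap.fst ℝ (ℝ × E) (Curve E)).prod F')
      ((ContinuousLinearMap.fst ℝ (ℝ × E) (Curve E)).prod
        (ContinuousLinearMap.snd ℝ (ℝ × E) (Curve E) -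
          (F'.comp (ContinuousLinearMap.inl ℝ (ℝ × E) (Curve E))).comp
            (ContinuousLinearMap.fst ℝ (ℝ × E) (Curve E))))
      (fun q => by
        obtain ⟨p, h⟩ := q
        simp [hsplit p h]) (fun q => by
        obtain ⟨p, h⟩ := q
        simp [hsplit p (h - _)])
  have hΨ' : HasFDerivAt Ψ (Ψ' : ((ℝ × E) × Curve E) →L[ℝ] ((ℝ × E) × Curve E)) ((0, x₀), c₀) :=
    hasFDerivAt_fst.prodMk
      ((hFs.differentiable (by simp)).differentiableAt.hasFDerivAt (x := ((0, x₀), c₀)))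
  obtain ⟨e, he, hmem, -, -, hsymm⟩ := exists_localDiffeo univ_mem
    (Eventually.of_forall fun q => hΨ.contDiffAt) Ψ' hΨ'
  have hzero : flowEq Vc ((0, x₀), c₀) = 0 := by simp [flowEq, c₀]
  have hΨ0 : e ((0, x₀), c₀) = ((0, x₀), 0) := by rw [he]; exact Prod.ext rfl hzero
  have ht0 : ((0, x₀), (0 : Curve E)) ∈ e.target := by
    rw [← hΨ0]
    exact e.map_source hmem
  have hs0 : e.symm ((0, x₀), (0 : Curve E)) = ((0, x₀), c₀) := by
    rw [← hΨ0]
    exact e.left_inv hmem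
  let Γ : ℝ × E → Curve E := fun p => (e.symm (p, 0)).2
  have hιc : ContinuousAt (fun p : ℝ × E => (p, (0 : Curve E))) (0, x₀) := by fun_prop
  have hev : ∀ᶠ p in 𝓝 ((0 : ℝ), x₀), (p, (0 : Curve E)) ∈ e.target :=
    hιc.eventually (e.open_target.mem_nhds ht0)
  have hΓs : ∀ᶠ p in 𝓝 ((0 : ℝ), x₀), ContDiffAt ℝ ∞ Γ p := by
    filter_upwards [hev] with p hp
    exact contDiffAt_snd.comp p ((hsymm _ hp).comp p (contDiffAt_id.prodMk contDiffAt_const))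
  have hΓ0 : Γ (0, x₀) = c₀ := by simp only [Γ]; rw [hs0]
  have hΓeq : ∀ᶠ p in 𝓝 ((0 : ℝ), x₀), flowEq Vc (p, Γ p) = 0 := by
    filter_upwards [hev] with p hp
    have h := e.right_inv hp
    rw [he] at h
    have h1 : (e.symm (p, 0)).1 = p := congrArg Prod.fst h
    have h2 : flowEq Vc (e.symm (p, 0)) = 0 := congrArg Prod.snd h
    have h3 : (p, Γ p) = e.symm (p, 0) := Prod.ext h1.symm rfl
    rw [h3]
    exact h2
  -- a product neighbourhood on which the solution is unique
  obtain ⟨P, hP, Q, hQ, hPQ⟩ := mem_nhds_prod_iff.1 (e.open_source.mem_nhds hmem)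
  obtain ⟨ε, hε, hεQ⟩ := Metric.nhds_basis_closedBall.mem_iff.1 hQ
  have hΓball : ∀ᶠ p in 𝓝 ((0 : ℝ), x₀), Γ p ∈ Metric.closedBall c₀ ε := by
    have := hΓs.self_of_nhds.continuousAt
    rw [ContinuousAt, hΓ0] at this
    exact this (Metric.closedBall_mem_nhds c₀ hε)
  obtain ⟨δ, hδ, hδ'⟩ :=
    Metric.nhds_basis_ball.mem_iff.1 ((hΓeq.and hΓball).and (hP : ∀ᶠ p in _, p ∈ P))
  have hball : ∀ {t : ℝ} {y : E}, |t| < δ → dist y x₀ < δ →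
      (t, y) ∈ Metric.ball ((0 : ℝ), x₀) δ := by
    intro t y h1 h2
    rw [Metric.mem_ball, Prod.dist_eq, max_lt_iff]
    exact ⟨by simpa using h1, h2⟩
  set T : ℝ := δ / 2 with hT
  have hT0 : 0 < T := by positivity
  have hTδ : |T| < δ := by rw [abs_of_pos hT0]; linarith
  have huniq : ∀ {y : E}, dist y x₀ < δ → ∀ {r : ℝ}, r ∈ Icc (-1 : ℝ) 1 →
      Γ (r * T, y) = (Γ (T, y)).scale r := by
    intro y hy r hr
    obtain ⟨⟨h1, h2⟩, -⟩ := hδ' (hball hTδ hy)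
    have h3 := flowEq_scale h1 hr
    have hrT : |r * T| < δ := by
      rw [abs_mul]
      refine lt_of_le_of_lt ?_ hTδ
      exact mul_le_of_le_one_left (abs_nonneg _) (abs_le.2 hr)
    have hmemP : (r * T, y) ∈ P := (hδ' (hball hrT hy)).2
    have hmemQ : (Γ (T, y)).scale r ∈ Q := by
      apply hεQ
      rw [Metric.mem_closedBall, ContinuousMap.dist_le hε.le] at h2 ⊢
      intro τ
      exact h2 _
    have h4 : ((r * T, y), (Γ (T, y)).scale r) ∈ e.source := hPQ ⟨hmemP, hmemQ⟩
    have h5 := e.left_inv h4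
    have h6 : e ((r * T, y), (Γ (T, y)).scale r) = ((r * T, y), 0) := by
      rw [he]
      exact Prod.ext rfl h3
    rw [h6] at h5
    exact congrArg Prod.snd h5
  have hone : (1 : ℝ) ∈ Icc (-1 : ℝ) 1 := by norm_num
  have hφ : ∀ {y : E}, dist y x₀ < δ → ∀ {s : ℝ}, |s| < T →
      Γ (s, y) ⟨1, hone⟩ = y + T • ∫ σ in (0 : ℝ)..(s / T), V ((Γ (T, y)).extend σ) := by
    intro y hy s hs
    have hr : s / T ∈ Icc (-1 : ℝ) 1 := by
      rw [mem_Icc, ← abs_le, abs_div, abs_of_pos hT0, div_le_one hT0]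
      exact hs.le
    have h1 := huniq hy hr
    rw [div_mul_cancel₀ _ hT0.ne'] at h1
    rw [h1]
    have h2 : (Γ (T, y)).scale (s / T) ⟨1, hone⟩ = (Γ (T, y)).extend (s / T) := by
      simp [Curve.scale]
    rw [h2]
    exact (flowEq_eq_zero_iff Vc T y _).1 (hδ' (hball hTδ hy)).1.1 _ hr
  refine ⟨fun p => Γ p ⟨1, hone⟩, ?_, ?_, ?_⟩
  · filter_upwards [hΓs] with p hp
    exact (ContinuousMap.evalCLM ℝ (⟨1, hone⟩ : Icc (-1 : ℝ) 1)).contDiff.contDiffAt.comp p hp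
  · filter_upwards [Metric.ball_mem_nhds x₀ hδ] with y hy
    rw [hφ hy (by simpa using hT0)]
    simp
  · filter_upwards [Metric.ball_mem_nhds ((0 : ℝ), x₀) hT0] with p hp
    rw [Metric.mem_ball, Prod.dist_eq, max_lt_iff] at hp
    obtain ⟨hp1, hp2⟩ := hp
    have hp1 : |p.1| < T := by simpa using hp1
    have hp2 : dist p.2 x₀ < δ := hp2.trans (by linarith)
    have hcont : Continuous (fun σ => V ((Γ (T, p.2)).extend σ)) :=
      hV.continuous.comp (Γ (T, p.2)).extend_continuous
    have h1 : HasDerivAt (fun r : ℝ => ∫ σ in (0 : ℝ)..r, V ((Γ (T, p.2)).extend σ))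
        (V ((Γ (T, p.2)).extend (p.1 / T))) (p.1 / T) :=
      intervalIntegral.integral_hasDerivAt_right (hcont.intervalIntegrable _ _)
        (hcont.stronglyMeasurableAtFilter _ _) hcont.continuousAt
    have h2 : HasDerivAt (fun t : ℝ => t / T) (1 / T) p.1 := (hasDerivAt_id p.1).div_const T
    have h3 := (((h1.scomp p.1 h2).const_smul T).const_add p.2)
    have hval : V ((Γ (T, p.2)).extend (p.1 / T)) = V (Γ p ⟨1, hone⟩) := by
      have hr : p.1 / T ∈ Icc (-1 : ℝ) 1 := by
        rw [mem_Icc, ← abs_le, abs_div, abs_of_pos hT0, div_le_one hT0]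
        exact hp1.le
      have h4 := huniq hp2 hr
      rw [div_mul_cancel₀ _ hT0.ne'] at h4
      have h5 : Γ p = (Γ (T, p.2)).scale (p.1 / T) := h4
      rw [h5]
      simp [Curve.scale]
    rw [smul_smul, mul_one_div_cancel hT0.ne', one_smul, hval] at h3
    refine h3.congr_of_eventuallyEq ?_
    have : ∀ᶠ t in 𝓝 p.1, |t| < T := (continuous_abs.tendsto _).eventually (gt_mem_nhds hp1)
    filter_upwards [this] with t ht
    exact hφ hp2 ht

/-- A vector field that is smooth near a point agrees near it with one that is smooth everywhere. -/
theorem exists_contDiff_eventuallyEq [FiniteDimensional ℝ E] {V : E → E} {u : E}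
    (hV : ∀ᶠ x in 𝓝 u, ContDiffAt ℝ ∞ V x) :
    ∃ V' : E → E, ContDiff ℝ ∞ V' ∧ V' =ᶠ[𝓝 u] V := by
  obtain ⟨ε, hε, hball⟩ := Metric.nhds_basis_ball.mem_iff.1 hV
  let χ : ContDiffBump u := ⟨ε / 4, ε / 2, by positivity, by linarith⟩
  refine ⟨fun x => χ x • V x, ?_, ?_⟩
  · rw [contDiff_iff_contDiffAt]
    intro x
    by_cases hx : x ∈ Metric.ball u ε
    · exact χ.contDiffAt.smul (hball hx)
    · have hx' : x ∉ tsupport χ := by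
        rw [χ.tsupport_eq]
        intro h
        apply hx
        have h : dist x u ≤ ε / 2 := h
        rw [Metric.mem_ball]
        linarith
      have : (fun x => χ x • V x) =ᶠ[𝓝 x] fun _ => 0 := by
        filter_upwards [notMem_tsupport_iff_eventuallyEq.1 hx'] with y hy
        rw [hy, Pi.zero_apply, zero_smul]
      exact contDiffAt_const.congr_of_eventuallyEq this
  · filter_upwards [χ.eventuallyEq_one] with x hx
    rw [hx, Pi.one_apply, one_smul]

/-- The straightening of a smooth vector field near a point at which it does not vanish. -/
theorem exists_flowBox [FiniteDimensional ℝ E] {F : Type*} [NormedAddCommGroup F] [NormedSpace ℝ F]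
    [FiniteDimensional ℝ F] {V : E → E} {u : E} {O : Set E} (hO : O ∈ 𝓝 u)
    (hV : ∀ᶠ x in 𝓝 u, ContDiffAt ℝ ∞ V x) (hne : V u ≠ 0)
    (hdim : finrank ℝ F + 1 = finrank ℝ E) :
    ∃ e : OpenPartialHomeomorph (ℝ × F) E, 0 ∈ e.source ∧ e 0 = u ∧ e.target ⊆ O ∧
      (∀ p ∈ e.source, ContDiffAt ℝ ∞ e p) ∧ (∀ x ∈ e.target, ContDiffAt ℝ ∞ e.symm x) ∧
      ∀ p ∈ e.source, HasDerivAt (fun t => e (t, p.2)) (V (e p)) p.1 := by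
  have : CompleteSpace E := FiniteDimensional.complete ℝ E
  obtain ⟨V', hV', hVV'⟩ := exists_contDiff_eventuallyEq hV
  obtain ⟨φ, hφs, hφ0, hφd⟩ := exists_smooth_flow hV' u
  obtain ⟨C, hC⟩ := Submodule.exists_isCompl (ℝ ∙ V u)
  have hCdim : finrank ℝ F = finrank ℝ C := by
    have h1 := Submodule.finrank_add_eq_of_isCompl hC
    rw [finrank_span_singleton hne] at h1
    omega
  let ι : F →L[ℝ] E := LinearMap.toContinuousLinearMap
    (C.subtype ∘ₗ (LinearEquiv.ofFinrankEq F C hCdim).toLinearMap)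
  have hιmem : ∀ z, ι z ∈ C := fun z => Subtype.property _
  have hιinj : ∀ z, ι z = 0 → z = 0 := fun z hz =>
    (LinearEquiv.ofFinrankEq F C hCdim).map_eq_zero_iff.1 (Subtype.ext hz)
  let κ : ℝ × F → ℝ × E := fun p => (p.1, u + ι p.2)
  have hκs : ContDiff ℝ ∞ κ := by fun_prop
  have hκ0 : κ 0 = (0, u) := by simp [κ]
  have hκt : Tendsto κ (𝓝 0) (𝓝 (0, u)) := by
    rw [← hκ0]
    exact hκs.continuous.tendsto 0
  let f : ℝ × F → E := fun p => φ (κ p)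
  have hfs : ∀ᶠ p in 𝓝 (0 : ℝ × F), ContDiffAt ℝ ∞ f p := by
    filter_upwards [hκt.eventually hφs] with p hp
    exact hp.comp p hκs.contDiffAt
  have hf0 : f 0 = u := by
    change φ (κ 0) = u
    rw [hκ0]
    exact hφ0.self_of_nhds
  have hfc : Tendsto f (𝓝 0) (𝓝 u) := by
    have := hfs.self_of_nhds.continuousAt
    rwa [ContinuousAt, hf0] at this
  have hfd := (hfs.self_of_nhds.differentiableAt (by simp)).hasFDerivAt
  have hd1 : fderiv ℝ f 0 (1, 0) = V u := by
    have hl : HasDerivAt (fun t : ℝ => (t, (0 : F))) ((1 : ℝ), (0 : F)) 0 :=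
      (hasDerivAt_id (0 : ℝ)).prodMk (hasDerivAt_const _ _)
    have h1 := HasFDerivAt.comp_hasDerivAt (0 : ℝ) hfd hl
    have h2 : HasDerivAt (fun t => φ (t, u)) (V' u) 0 := by
      have := hφd.self_of_nhds
      rwa [show φ (0, u) = u from hφ0.self_of_nhds] at this
    have h3 : (f ∘ fun t : ℝ => (t, (0 : F))) = fun t => φ (t, u) := by
      funext t
      simp [f, κ]
    rw [h3] at h1
    rw [h1.unique h2, hVV'.self_of_nhds]
  have hd2 : ∀ z, fderiv ℝ f 0 (0, z) = ι z := by
    intro z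
    have h1 : HasFDerivAt (fun z : F => f (0, z))
        ((fderiv ℝ f 0).comp (ContinuousLinearMap.inr ℝ ℝ F)) 0 :=
      HasFDerivAt.comp (0 : F) hfd (hasFDerivAt_prodMk_right (0 : ℝ) (0 : F))
    have h2 : HasFDerivAt (fun z : F => f (0, z)) ι 0 := by
      have hc : Tendsto (fun z : F => u + ι z) (𝓝 0) (𝓝 u) := by
        have : ContinuousAt (fun z : F => u + ι z) 0 := by fun_prop
        simpa [ContinuousAt] using this
      refine (ι.hasFDerivAt.const_add u).congr_of_eventuallyEq ?_
      filter_upwards [hc.eventually hφ0] with z hz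
      exact hz
    simpa using DFunLike.congr_fun (h1.unique h2) z
  have hO' : {p | V' (f p) = V (f p) ∧ f p ∈ O ∧
      HasDerivAt (fun t => φ (t, (κ p).2)) (V' (φ (κ p))) (κ p).1} ∈ 𝓝 (0 : ℝ × F) := by
    filter_upwards [hfc.eventually hVV', hfc hO, hκt.eventually hφd] with p h1 h2 h3
    exact ⟨h1, h2, h3⟩
  obtain ⟨e, he, hmem, hsub, hsm, hsymm⟩ := exists_localDiffeo_of_injective hO' hfs
    (by simp; omega) (by
      rintro ⟨a, z⟩ hz
      have hsum : ((a, z) : ℝ × F) = a • ((1 : ℝ), (0 : F)) + (0, z) := by simp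
      rw [hsum, map_add, map_smul, hd1, hd2] at hz
      have h1 : a • V u ∈ (ℝ ∙ V u) ⊓ C := by
        refine ⟨Submodule.smul_mem _ _ (Submodule.mem_span_singleton_self _), ?_⟩
        rw [eq_neg_of_add_eq_zero_left hz]
        exact C.neg_mem (hιmem z)
      rw [hC.inf_eq_bot, Submodule.mem_bot] at h1
      rw [h1, zero_add] at hz
      rw [hιinj z hz, (smul_eq_zero.1 h1).resolve_right hne]
      rfl)
  have hef : (e : ℝ × F → E) = f := funext he
  refine ⟨e, hmem, by rw [he, hf0], fun x hx => ?_, fun p hp => ?_, hsymm, fun p hp => ?_⟩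
  · have := (hsub (e.map_target hx)).2.1
    rwa [← he, e.right_inv hx] at this
  · rw [hef]
    exact hsm p hp
  · obtain ⟨h1, -, h3⟩ := hsub hp
    rw [hef, ← h1]
    exact h3

end Flow

/-! ### Coordinates on the parameter manifold -/

theorem eventually_lorentz_ne_zero {n : ℕ} {X : Type*} [TopologicalSpace X] {f : X → LSpace n}
    {x : X} (hf : ContinuousAt f x) {e : LSpace n} (he : lorentz n (f x) e ≠ 0) :
    ∀ᶠ y in 𝓝 x, lorentz n (f y) e ≠ 0 := by
  have hc : ContinuousAt (fun y => lorentzL n (f y) e) x :=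
    ((lorentzL n).flip e).continuous.continuousAt.comp hf
  exact hc.eventually_ne he

theorem hasFDerivAt_lorentz {n : ℕ} {E : Type*} [NormedAddCommGroup E] [NormedSpace ℝ E]
    {f g : E → LSpace n} {x : E} (hf : DifferentiableAt ℝ f x) (hg : DifferentiableAt ℝ g x) :
    ∃ L : E →L[ℝ] ℝ, HasFDerivAt (fun y => lorentz n (f y) (g y)) L x ∧
      ∀ X, L X = lorentz n (fderiv ℝ f x X) (g x) + lorentz n (f x) (fderiv ℝ g x X) := by
  refine ⟨_, (lorentzL n).hasFDerivAt_of_bilinear hf.hasFDerivAt hg.hasFDerivAt, fun X => ?_⟩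
  simp [ContinuousLinearMap.precompR, ContinuousLinearMap.precompL, add_comm]

/-- The differentiated form of a relation `(f, g) = const`. -/
theorem lorentz_fderiv_of_const {n : ℕ} {E : Type*} [NormedAddCommGroup E] [NormedSpace ℝ E]
    {f g : E → LSpace n} {x : E} {c : ℝ} (hf : DifferentiableAt ℝ f x)
    (hg : DifferentiableAt ℝ g x) (h : ∀ᶠ y in 𝓝 x, lorentz n (f y) (g y) = c) (X : E) :
    lorentz n (fderiv ℝ f x X) (g x) + lorentz n (f x) (fderiv ℝ g x X) = 0 := by
  obtain ⟨L, hL, hLX⟩ := hasFDerivAt_lorentz hf hg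
  rw [← hLX]
  have : (fun y => lorentz n (f y) (g y)) =ᶠ[𝓝 x] fun _ => c := h
  rw [(this.hasFDerivAt_iff.1 hL).unique (hasFDerivAt_const c x)]
  rfl

section Coordinates

variable {n : ℕ} {M : Type*} [TopologicalSpace M] [ChartedSpace (EuclideanSpace ℝ (Fin (n - 1))) M]

theorem tendsto_chart_symm (w : M) :
    Tendsto (chartAt (EuclideanSpace ℝ (Fin (n - 1))) w).symm
      (𝓝 (chartAt (EuclideanSpace ℝ (Fin (n - 1))) w w)) (𝓝 w) := by
  have h := (chartAt (EuclideanSpace ℝ (Fin (n - 1))) w).continuousAt_symm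
    ((chartAt (EuclideanSpace ℝ (Fin (n - 1))) w).map_source (mem_chart_source _ w))
  rwa [ContinuousAt, (chartAt (EuclideanSpace ℝ (Fin (n - 1))) w).left_inv (mem_chart_source _ w)]
    at h

theorem IsFrameAt.eventually_isFrameAt {gen : M → Submodule ℝ (LSpace n)} {u : M}
    {A₀ Aₙ : M → LSpace n} (h : IsFrameAt gen u A₀ Aₙ) : ∀ᶠ w in 𝓝 u, IsFrameAt gen w A₀ Aₙ := by
  filter_upwards [h.smooth_zero.eventually_nhds, h.smooth_last.eventually_nhds,
    h.adapted.eventually_nhds] with w h1 h2 h3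
  exact ⟨h1, h2, h3⟩

theorem IsFrameAt.independent {gen : M → Submodule ℝ (LSpace n)} {u : M}
    {A₀ Aₙ : M → LSpace n} (h : IsFrameAt gen u A₀ Aₙ) {a b : ℝ}
    (hz : a • A₀ u + b • Aₙ u = 0) : a = 0 ∧ b = 0 := by
  obtain ⟨h0, -, h2, h3, -⟩ := h.adapted.self_of_nhds
  have hb : b = 0 := by
    have : lorentz n (a • A₀ u + b • Aₙ u) (Aₙ u) = 0 := by rw [hz]; simp
    simpa [h2, h3] using this
  subst hb
  simpa [h0] using hz

theorem contMDiffAt_combination {σ τ : M → LSpace n} {w : M} (a b : ℝ)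
    (hσ : ContMDiffAt (𝓡 (n - 1)) 𝓘(ℝ, LSpace n) ∞ σ w)
    (hτ : ContMDiffAt (𝓡 (n - 1)) 𝓘(ℝ, LSpace n) ∞ τ w) :
    ContMDiffAt (𝓡 (n - 1)) 𝓘(ℝ, LSpace n) ∞ (fun y => a • σ y + b • τ y) w :=
  have h1 : ContDiff ℝ ∞ (fun p : LSpace n × LSpace n => a • p.1 + b • p.2) := by fun_prop
  ContMDiffAt.comp w (I' := 𝓘(ℝ, LSpace n × LSpace n)) h1.contMDiff.contMDiffAt
    (hσ.prodMk_space hτ)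

theorem isSectionAt_combination {gen : M → Submodule ℝ (LSpace n)} {w : M} {A₀ Aₙ : M → LSpace n}
    (hF : IsFrameAt gen w A₀ Aₙ) {a b : ℝ} (hab : a • A₀ w + b • Aₙ w ≠ 0) :
    IsSectionAt gen w (fun y => a • A₀ y + b • Aₙ y) := by
  have hab' : ¬(a = 0 ∧ b = 0) := by
    rintro ⟨rfl, rfl⟩
    simp at hab
  refine ⟨?_, ?_⟩
  · filter_upwards [hF.smooth_zero, hF.smooth_last] with y h1 h2
    exact contMDiffAt_combination a b h1 h2
  · filter_upwards [hF.eventually_isFrameAt] with y hy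
    refine ⟨?_, fun h => hab' (hy.independent h)⟩
    rw [hy.adapted.self_of_nhds.2.2.2.2]
    exact Submodule.mem_span_pair.2 ⟨a, b, rfl⟩

variable [IsManifold (𝓡 (n - 1)) ∞ M]

/-- The differential at `w` of the chart of `M` centred at `u`. -/
def chartDeriv (u : M) {w : M} (hw : w ∈ (chartAt (EuclideanSpace ℝ (Fin (n - 1))) u).source) :
    TangentSpace (𝓡 (n - 1)) w ≃ₗ[ℝ] EuclideanSpace ℝ (Fin (n - 1)) :=
  ((mdifferentiable_chart (I := 𝓡 (n - 1)) u).mfderiv hw).toLinearEquiv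

theorem contDiffAt_comp_chart_symm {F : Type*} [NormedAddCommGroup F] [NormedSpace ℝ F]
    {f : M → F} (u : M) {w : M} (hw : w ∈ (chartAt (EuclideanSpace ℝ (Fin (n - 1))) u).source)
    (hf : ContMDiffAt (𝓡 (n - 1)) 𝓘(ℝ, F) ∞ f w) :
    ContDiffAt ℝ ∞ (fun x => f ((chartAt (EuclideanSpace ℝ (Fin (n - 1))) u).symm x))
      (chartAt (EuclideanSpace ℝ (Fin (n - 1))) u w) := by
  set φ := chartAt (EuclideanSpace ℝ (Fin (n - 1))) u
  rw [← contMDiffAt_iff_contDiffAt]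
  have h1 : ContMDiffAt (𝓡 (n - 1)) (𝓡 (n - 1)) ∞ φ.symm (φ w) :=
    (contMDiffOn_chart_symm (I := 𝓡 (n - 1)) (n := ∞) (x := u)).contMDiffAt
      (φ.open_target.mem_nhds (φ.map_source hw))
  refine ContMDiffAt.comp (φ w) (I' := 𝓡 (n - 1)) ?_ h1
  rw [φ.left_inv hw]
  exact hf

theorem contMDiffAt_comp_chart {F : Type*} [NormedAddCommGroup F] [NormedSpace ℝ F]
    {f : EuclideanSpace ℝ (Fin (n - 1)) → F} (u : M) {w : M}
    (hw : w ∈ (chartAt (EuclideanSpace ℝ (Fin (n - 1))) u).source)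
    (hf : ContDiffAt ℝ ∞ f (chartAt (EuclideanSpace ℝ (Fin (n - 1))) u w)) :
    ContMDiffAt (𝓡 (n - 1)) 𝓘(ℝ, F) ∞
      (fun w => f (chartAt (EuclideanSpace ℝ (Fin (n - 1))) u w)) w := by
  set φ := chartAt (EuclideanSpace ℝ (Fin (n - 1))) u
  have h1 : ContMDiffAt (𝓡 (n - 1)) (𝓡 (n - 1)) ∞ φ w :=
    (contMDiffOn_chart (I := 𝓡 (n - 1)) (n := ∞) (x := u)).contMDiffAt
      (φ.open_source.mem_nhds hw)
  exact ContMDiffAt.comp w (I' := 𝓡 (n - 1)) (contMDiffAt_iff_contDiffAt.2 hf) h1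

/-- The differential of a map on `M` in terms of its coordinate expression. -/
theorem mfderiv_eq_fderiv_chart {F : Type*} [NormedAddCommGroup F] [NormedSpace ℝ F]
    {f : M → F} (u : M) {w : M} (hw : w ∈ (chartAt (EuclideanSpace ℝ (Fin (n - 1))) u).source)
    (hf : ContMDiffAt (𝓡 (n - 1)) 𝓘(ℝ, F) ∞ f w) (X : TangentSpace (𝓡 (n - 1)) w) :
    mfderiv (𝓡 (n - 1)) 𝓘(ℝ, F) f w X
      = fderiv ℝ (fun x => f ((chartAt (EuclideanSpace ℝ (Fin (n - 1))) u).symm x))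
          (chartAt (EuclideanSpace ℝ (Fin (n - 1))) u w) (chartDeriv u hw X) := by
  set φ := chartAt (EuclideanSpace ℝ (Fin (n - 1))) u with hφ
  have h1 : (fun w => (fun x => f (φ.symm x)) (φ w)) =ᶠ[𝓝 w] f := by
    filter_upwards [φ.open_source.mem_nhds hw] with y hy
    exact congrArg f (φ.left_inv hy)
  have h2 := (contDiffAt_comp_chart_symm u hw hf).differentiableAt (by simp)
  have h3 : MDifferentiableAt (𝓡 (n - 1)) (𝓡 (n - 1)) φ w :=
    (mdifferentiable_chart (I := 𝓡 (n - 1)) u).mdifferentiableAt hw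
  have h4 := mfderiv_comp (I' := 𝓡 (n - 1)) w h2.mdifferentiableAt h3
  have h5 : mfderiv (𝓡 (n - 1)) 𝓘(ℝ, F) f w
      = mfderiv (𝓡 (n - 1)) 𝓘(ℝ, F) ((fun x => f (φ.symm x)) ∘ φ) w := (h1.mfderiv_eq).symm
  rw [h5, h4, mfderiv_eq_fderiv]
  rfl

theorem diff_apply (u : M) {w : M} (hw : w ∈ (chartAt (EuclideanSpace ℝ (Fin (n - 1))) u).source)
    {σ : M → LSpace n} (hσ : ContMDiffAt (𝓡 (n - 1)) 𝓘(ℝ, LSpace n) ∞ σ w)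
    (X : TangentSpace (𝓡 (n - 1)) w) :
    diff σ w X = fderiv ℝ (fun x => σ ((chartAt (EuclideanSpace ℝ (Fin (n - 1))) u).symm x))
          (chartAt (EuclideanSpace ℝ (Fin (n - 1))) u w) (chartDeriv u hw X) :=
  mfderiv_eq_fderiv_chart u hw hσ X

/-- The differentiated form of a relation `(σ, τ) = const` on `M`. -/
theorem lorentz_diff_of_const {σ τ : M → LSpace n} {w : M} {c : ℝ}
    (hσ : ContMDiffAt (𝓡 (n - 1)) 𝓘(ℝ, LSpace n) ∞ σ w)
    (hτ : ContMDiffAt (𝓡 (n - 1)) 𝓘(ℝ, LSpace n) ∞ τ w)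
    (h : ∀ᶠ y in 𝓝 w, lorentz n (σ y) (τ y) = c) (X : TangentSpace (𝓡 (n - 1)) w) :
    lorentz n (diff σ w X) (τ w) + lorentz n (σ w) (diff τ w X) = 0 := by
  have hw := mem_chart_source (EuclideanSpace ℝ (Fin (n - 1))) w
  rw [diff_apply w hw hσ, diff_apply w hw hτ]
  have := lorentz_fderiv_of_const
    ((contDiffAt_comp_chart_symm w hw hσ).differentiableAt (by simp))
    ((contDiffAt_comp_chart_symm w hw hτ).differentiableAt (by simp))
    ((tendsto_chart_symm w).eventually h) (chartDeriv w hw X)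
  simpa only [(chartAt (EuclideanSpace ℝ (Fin (n - 1))) w).left_inv hw] using this

theorem diff_combination {σ τ : M → LSpace n} {w : M} (a b : ℝ)
    (hσ : ContMDiffAt (𝓡 (n - 1)) 𝓘(ℝ, LSpace n) ∞ σ w)
    (hτ : ContMDiffAt (𝓡 (n - 1)) 𝓘(ℝ, LSpace n) ∞ τ w) (X : TangentSpace (𝓡 (n - 1)) w) :
    diff (fun y => a • σ y + b • τ y) w X = a • diff σ w X + b • diff τ w X := by
  have hw := mem_chart_source (EuclideanSpace ℝ (Fin (n - 1))) w
  have hs : ContMDiffAt (𝓡 (n - 1)) 𝓘(ℝ, LSpace n) ∞ (fun y => a • σ y + b • τ y) w :=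
    contMDiffAt_combination a b hσ hτ
  rw [diff_apply w hw hσ, diff_apply w hw hτ, diff_apply w hw hs]
  have h1 :=
    (((contDiffAt_comp_chart_symm w hw hσ).differentiableAt (by simp)).hasFDerivAt).const_smul a
  have h2 :=
    (((contDiffAt_comp_chart_symm w hw hτ).differentiableAt (by simp)).hasFDerivAt).const_smul b
  exact DFunLike.congr_fun (h1.add h2).fderiv _

/-! ### Sections of a family of lightlike lines -/

theorem exists_lorentz_ne_zero {n : ℕ} {x : LSpace n} (hx : x ≠ 0) : ∃ e, lorentz n x e ≠ 0 := by
  by_contra! h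
  exact hx (eq_zero_of_lorentz_eq_zero h)

/-- The differential of a section of the family of lines, modulo the line. -/
theorem section_diff {gen : M → Submodule ℝ (LSpace n)} {w : M} {A₀ Aₙ σ : M → LSpace n}
    (hF : IsFrameAt gen w A₀ Aₙ) (hσ : IsSectionAt gen w σ) :
    ∃ a b : ℝ, σ w = a • A₀ w + b • Aₙ w ∧
      ∀ X, diff σ w X - (a • diff A₀ w X + b • diff Aₙ w X) ∈ gen w := by
  have hw := mem_chart_source (EuclideanSpace ℝ (Fin (n - 1))) w
  set φ := chartAt (EuclideanSpace ℝ (Fin (n - 1))) w with hφ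
  have ht : Tendsto φ.symm (𝓝 (φ w)) (𝓝 w) := tendsto_chart_symm w
  have h0 := hF.smooth_zero.self_of_nhds
  have hn := hF.smooth_last.self_of_nhds
  have hs := hσ.1.self_of_nhds
  set a₀ : EuclideanSpace ℝ (Fin (n - 1)) → LSpace n := fun x => A₀ (φ.symm x) with ha₀
  set aₙ : EuclideanSpace ℝ (Fin (n - 1)) → LSpace n := fun x => Aₙ (φ.symm x) with haₙ
  set f : EuclideanSpace ℝ (Fin (n - 1)) → LSpace n := fun x => σ (φ.symm x) with hf
  have d0 : DifferentiableAt ℝ a₀ (φ w) :=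
    (contDiffAt_comp_chart_symm w hw h0).differentiableAt (by simp)
  have dn : DifferentiableAt ℝ aₙ (φ w) :=
    (contDiffAt_comp_chart_symm w hw hn).differentiableAt (by simp)
  have ds : DifferentiableAt ℝ f (φ w) :=
    (contDiffAt_comp_chart_symm w hw hs).differentiableAt (by simp)
  have e0 : a₀ (φ w) = A₀ w := by simp only [ha₀, φ.left_inv hw]
  have en : aₙ (φ w) = Aₙ w := by simp only [haₙ, φ.left_inv hw]
  have es : f (φ w) = σ w := by simp only [hf, φ.left_inv hw]
  obtain ⟨e, he⟩ := exists_lorentz_ne_zero hF.adapted.self_of_nhds.1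
  -- the coefficients of the section in the frame
  let b : EuclideanSpace ℝ (Fin (n - 1)) → ℝ := fun x => lorentz n (f x) (aₙ x)
  have hb : DifferentiableAt ℝ b (φ w) := by
    obtain ⟨L, hL, -⟩ := hasFDerivAt_lorentz ds dn
    exact hL.differentiableAt
  let g : EuclideanSpace ℝ (Fin (n - 1)) → LSpace n := fun x => f x - b x • aₙ x
  have hg : DifferentiableAt ℝ g (φ w) := ds.sub (hb.smul dn)
  let a : EuclideanSpace ℝ (Fin (n - 1)) → ℝ := fun x => lorentz n (g x) e / lorentz n (a₀ x) e
  have ha : DifferentiableAt ℝ a (φ w) := by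
    obtain ⟨L, hL, -⟩ := hasFDerivAt_lorentz hg (differentiableAt_const e)
    obtain ⟨L', hL', -⟩ := hasFDerivAt_lorentz d0 (differentiableAt_const e)
    exact hL.differentiableAt.fun_mul (hL'.differentiableAt.inv (by rw [e0]; exact he))
  have hne : ∀ᶠ x in 𝓝 (φ w), lorentz n (a₀ x) e ≠ 0 :=
    eventually_lorentz_ne_zero d0.continuousAt (by rw [e0]; exact he)
  have hfe : f =ᶠ[𝓝 (φ w)] fun x => a x • a₀ x + b x • aₙ x := by
    filter_upwards [ht.eventually hF.adapted, ht.eventually hσ.2, hne] with x hx hx2 hx3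
    obtain ⟨-, k2, k3, k4, k5⟩ := hx
    have hmem : f x ∈ gen (φ.symm x) := hx2.1
    rw [k5] at hmem
    obtain ⟨c, d, hcd⟩ := Submodule.mem_span_pair.1 hmem
    have hbx : b x = d := by
      change lorentz n (f x) (aₙ x) = d
      rw [← hcd]
      simp [haₙ, k3, k4]
    have hgx : g x = c • a₀ x := by
      change f x - b x • aₙ x = _
      rw [hbx, ← hcd]
      simp [ha₀, haₙ]
    have hax : a x = c := by
      change lorentz n (g x) e / lorentz n (a₀ x) e = c
      rw [hgx]
      simp [hx3]
    rw [hax, hbx]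
    exact hcd.symm
  refine ⟨a (φ w), b (φ w), ?_, fun X => ?_⟩
  · rw [← es, ← e0, ← en]
    exact hfe.self_of_nhds
  · rw [diff_apply w hw h0, diff_apply w hw hn, diff_apply w hw hs]
    have hder := (ha.hasFDerivAt.smul d0.hasFDerivAt).add (hb.hasFDerivAt.smul dn.hasFDerivAt)
    have hfd : fderiv ℝ f (φ w) = _ := (hfe.hasFDerivAt_iff.2 hder).fderiv
    change fderiv ℝ f (φ w) _ - (a (φ w) • fderiv ℝ a₀ (φ w) _ + b (φ w) • fderiv ℝ aₙ (φ w) _) ∈ _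
    rw [hfd, hF.adapted.self_of_nhds.2.2.2.2, Submodule.mem_span_pair, ← e0, ← en]
    refine ⟨fderiv ℝ a (φ w) (chartDeriv w hw X), fderiv ℝ b (φ w) (chartDeriv w hw X), ?_⟩
    simp only [add_apply, ContinuousLinearMap.smulRight_apply, smul_apply]
    module

/-- Two sections through the same point of a generator have proportional displacements modulo the
generator, so that the tangent subspace can be computed from the sections `a A₀ + b Aₙ`. -/
theorem section_multiple {gen : M → Submodule ℝ (LSpace n)} {w : M} {A₀ Aₙ σ : M → LSpace n}
    (hF : IsFrameAt gen w A₀ Aₙ) (hσ : IsSectionAt gen w σ) {a b : ℝ}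
    (hm : σ w ∈ ℝ ∙ (a • A₀ w + b • Aₙ w)) :
    ∃ c : ℝ, ∀ X, diff σ w X - c • (a • diff A₀ w X + b • diff Aₙ w X) ∈ gen w := by
  obtain ⟨a', b', h1, h2⟩ := section_diff hF hσ
  obtain ⟨c, hc⟩ := Submodule.mem_span_singleton.1 hm
  have hz : (a' - c * a) • A₀ w + (b' - c * b) • Aₙ w = 0 := by
    have : a' • A₀ w + b' • Aₙ w - c • (a • A₀ w + b • Aₙ w) = 0 := by rw [hc, h1, sub_self]
    rw [← this]
    module
  obtain ⟨ha, hb⟩ := hF.independent hz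
  refine ⟨c, fun X => ?_⟩
  have := h2 X
  rw [sub_eq_zero.1 ha, sub_eq_zero.1 hb] at this
  rw [smul_add, smul_smul, smul_smul]
  exact this

theorem tangentSubspace_eq {gen : M → Submodule ℝ (LSpace n)} {w : M} {A₀ Aₙ : M → LSpace n}
    (hF : IsFrameAt gen w A₀ Aₙ) {p : ℙ ℝ (LSpace n)} {a b : ℝ} (hab : a • A₀ w + b • Aₙ w ≠ 0)
    (hp : p.submodule = ℝ ∙ (a • A₀ w + b • Aₙ w)) :
    tangentSubspace gen w p = gen w ⊔ LinearMap.range (a • diff A₀ w + b • diff Aₙ w) := by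
  apply le_antisymm
  · refine sup_le le_sup_left (iSup_le fun ⟨σ, hσ, hσp⟩ => ?_)
    rintro _ ⟨X, rfl⟩
    rw [hp] at hσp
    obtain ⟨c, hc⟩ := section_multiple hF hσ hσp
    have := Submodule.add_mem_sup (hc X) (Submodule.smul_mem _ c
      (LinearMap.mem_range_self (a • diff A₀ w + b • diff Aₙ w) X))
    rwa [show (a • diff A₀ w + b • diff Aₙ w) X = a • diff A₀ w X + b • diff Aₙ w X from rfl,
      sub_add_cancel] at this
  · refine sup_le_sup_left ?_ _
    refine le_trans ?_
      (le_iSup _ ⟨fun y => a • A₀ y + b • Aₙ y, isSectionAt_combination hF hab, ?_⟩)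
    · rintro _ ⟨X, rfl⟩
      exact ⟨X, diff_combination a b hF.smooth_zero.self_of_nhds hF.smooth_last.self_of_nhds X⟩
    · rw [hp]
      exact Submodule.mem_span_singleton_self _

theorem singularDirections_eq {gen : M → Submodule ℝ (LSpace n)} {w : M} {A₀ Aₙ : M → LSpace n}
    (hF : IsFrameAt gen w A₀ Aₙ) {p : ℙ ℝ (LSpace n)} {a b : ℝ} (hab : a • A₀ w + b • Aₙ w ≠ 0)
    (hp : p.submodule = ℝ ∙ (a • A₀ w + b • Aₙ w)) :
    singularDirections gen w p = (gen w).comap (a • diff A₀ w + b • diff Aₙ w) := by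
  apply le_antisymm
  · have hmem : (fun y => a • A₀ y + b • Aₙ y) w ∈ p.submodule := by
      rw [hp]
      exact Submodule.mem_span_singleton_self _
    refine le_trans (iInf_le _
      ⟨fun y => a • A₀ y + b • Aₙ y, isSectionAt_combination hF hab, hmem⟩) ?_
    · intro X hX
      have := diff_combination a b hF.smooth_zero.self_of_nhds hF.smooth_last.self_of_nhds X
      rw [Submodule.mem_comap] at hX ⊢
      change diff (fun y => a • A₀ y + b • Aₙ y) w X ∈ _ at hX
      rwa [this] at hX
  · refine le_iInf fun ⟨σ, hσ, hσp⟩ => ?_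
    intro X hX
    rw [hp] at hσp
    obtain ⟨c, hc⟩ := section_multiple hF hσ hσp
    have := Submodule.add_mem _ (hc X) (Submodule.smul_mem _ c hX)
    rwa [show (a • diff A₀ w + b • diff Aₙ w) X = a • diff A₀ w X + b • diff Aₙ w X from rfl,
      sub_add_cancel] at this

/-! ### The frame of a lightlike hypersurface of maximal rank -/

/-- A null vector orthogonal to a null vector is a multiple of it. -/
theorem mem_span_of_null_of_orthogonal {x y : LSpace n} (hy : y ≠ 0) (hyy : lorentz n y y = 0)
    (hxx : lorentz n x x = 0) (hxy : lorentz n y x = 0) : x ∈ ℝ ∙ y :=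
  (lorentz_self_of_orthogonal_null hy hyy hxy).2 hxx

/-- The tangent hyperplane along a generator is polar to its point of contact with the absolute
quadric, so that `(dAₙ, A₀) = 0`. -/
theorem LightlikeHypersurface.lorentz_diff_last (U : LightlikeHypersurface n M) {u : M}
    {A₀ Aₙ : M → LSpace n} (hF : IsFrameAt U.gen u A₀ Aₙ) (X : TangentSpace (𝓡 (n - 1)) u) :
    lorentz n (diff Aₙ u X) (A₀ u) = 0 := by
  obtain ⟨p, hp, hreg⟩ := U.exists_regular u
  obtain ⟨y, hy0, hyy, hT⟩ := U.lightlike u p hp hreg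
  obtain ⟨k1, k2, k3, k4, k5⟩ := hF.adapted.self_of_nhds
  have hmem : p.rep ∈ U.gen u := hreg.1 (by
    rw [Projectivization.submodule_eq]
    exact Submodule.mem_span_singleton_self _)
  rw [k5] at hmem
  obtain ⟨a, b, hab⟩ := Submodule.mem_span_pair.1 hmem
  have hne : a • A₀ u + b • Aₙ u ≠ 0 := by
    rw [hab]
    exact p.rep_nonzero
  have hb : b ≠ 0 := by
    rintro rfl
    have : lorentz n p.rep p.rep = 0 := by rw [← hab]; simp [k2]
    exact (hp.ne' : lorentz n p.rep p.rep ≠ 0) this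
  have hte := tangentSubspace_eq hF hne (p := p) (by rw [hab, Projectivization.submodule_eq])
  rw [hT, k5] at hte
  have horth : ∀ z ∈
      Submodule.span ℝ {A₀ u, Aₙ u} ⊔ LinearMap.range (a • diff A₀ u + b • diff Aₙ u),
      lorentz n y z = 0 := by
    intro z hz
    rw [← hte] at hz
    exact hz y (Submodule.mem_span_singleton_self y)
  have h0 : lorentz n y (A₀ u) = 0 :=
    horth _ (Submodule.mem_sup_left (Submodule.subset_span (by simp)))
  have hyA : y ∈ ℝ ∙ A₀ u :=
    mem_span_of_null_of_orthogonal k1 k2 hyy (by rw [lorentz_comm]; exact h0)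
  obtain ⟨c, hc⟩ := Submodule.mem_span_singleton.1 hyA
  have hc0 : c ≠ 0 := by
    rintro rfl
    exact hy0 (by rw [← hc, zero_smul])
  have h1 := horth _ (Submodule.mem_sup_right
    (LinearMap.mem_range_self (a • diff A₀ u + b • diff Aₙ u) X))
  have h2 : lorentz n (diff A₀ u X) (A₀ u) = 0 := by
    have := lorentz_diff_of_const hF.smooth_zero.self_of_nhds hF.smooth_zero.self_of_nhds
      (c := 0) (hF.adapted.mono fun w hw => hw.2.1) X
    rw [lorentz_comm (A₀ u)] at this
    linarith
  rw [lorentz_comm] at h2 ⊢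
  rw [← hc] at h1
  simp only [map_smul, LinearMap.smul_apply, LinearMap.add_apply, map_add, smul_eq_mul, h2,
    mul_zero, zero_add] at h1
  simpa [hc0, hb] using h1

end Coordinates

/-- An adapted frame of a lightlike hypersurface of maximal rank in coordinates. -/
structure CoordFrame (n : ℕ) {E : Type*} [NormedAddCommGroup E] [NormedSpace ℝ E]
    (a₀ aₙ : E → LSpace n) (Ω : Set E) : Prop where
  isOpen : IsOpen Ω
  smooth_zero : ∀ x ∈ Ω, ContDiffAt ℝ ∞ a₀ x
  smooth_last : ∀ x ∈ Ω, ContDiffAt ℝ ∞ aₙ x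
  jet : ∀ x ∈ Ω, FrameJet n (a₀ x) (aₙ x) (fderiv ℝ a₀ x).toLinearMap (fderiv ℝ aₙ x).toLinearMap

section Coordinates

variable {n : ℕ} {M : Type*} [TopologicalSpace M] [ChartedSpace (EuclideanSpace ℝ (Fin (n - 1))) M]
  [IsManifold (𝓡 (n - 1)) ∞ M]

/-- The symmetry `(∂ᵢA₀, ∂ⱼAₙ) = (∂ⱼA₀, ∂ᵢAₙ)`, obtained by differentiating `(∂ᵢA₀, Aₙ) = 0`. -/
theorem lorentz_fderiv_symm {E : Type*} [NormedAddCommGroup E] [NormedSpace ℝ E]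
    {a₀ aₙ : E → LSpace n} {x : E} (h0 : ContDiffAt ℝ ∞ a₀ x) (hn : ContDiffAt ℝ ∞ aₙ x)
    (h : ∀ X, ∀ᶠ y in 𝓝 x, lorentz n (fderiv ℝ a₀ y X) (aₙ y) = 0) (X Y : E) :
    lorentz n (fderiv ℝ a₀ x X) (fderiv ℝ aₙ x Y) =
      lorentz n (fderiv ℝ a₀ x Y) (fderiv ℝ aₙ x X) := by
  have hd : DifferentiableAt ℝ (fderiv ℝ a₀) x :=
    (h0.fderiv_right (m := 1) (WithTop.coe_le_coe.2 le_top)).differentiableAt (by simp)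
  have hdX : ∀ X, HasFDerivAt (fun y => fderiv ℝ a₀ y X)
      ((ContinuousLinearMap.apply ℝ (LSpace n) X).comp (fderiv ℝ (fderiv ℝ a₀) x)) x := fun X =>
    (ContinuousLinearMap.apply ℝ (LSpace n) X).hasFDerivAt.comp x hd.hasFDerivAt
  have key : ∀ X Y, lorentz n (fderiv ℝ (fderiv ℝ a₀) x Y X) (aₙ x)
      + lorentz n (fderiv ℝ a₀ x X) (fderiv ℝ aₙ x Y) = 0 := fun X Y => by
    have := lorentz_fderiv_of_const (hdX X).differentiableAt (hn.differentiableAt (by simp)) (h X) Y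
    rwa [(hdX X).fderiv] at this
  have hsymm : fderiv ℝ (fderiv ℝ a₀) x X Y = fderiv ℝ (fderiv ℝ a₀) x Y X :=
    (h0.isSymmSndFDerivAt (by simpa using (ENat.LEInfty.out : (2 : WithTop ℕ∞) ≤ ∞))) X Y
  have e1 := key X Y
  have e2 := key Y X
  rw [hsymm] at e2
  linarith

/-- Near `u` an adapted frame of a lightlike hypersurface of maximal rank, written in the chart at
`u`, is a coordinate frame: `A₀` is an immersion and is polar to the tangent hyperplane. -/
theorem LightlikeHypersurface.exists_coordFrame (U : LightlikeHypersurface n M)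
    (hn : 1 ≤ n) (hU : U.HasMaximalRank) {u : M} {A₀ Aₙ : M → LSpace n}
    (hF : IsFrameAt U.gen u A₀ Aₙ) {O : Set M} (hO : O ∈ 𝓝 u) :
    ∃ Ω : Set (EuclideanSpace ℝ (Fin (n - 1))),
      chartAt (EuclideanSpace ℝ (Fin (n - 1))) u u ∈ Ω ∧
      Ω ⊆ (chartAt (EuclideanSpace ℝ (Fin (n - 1))) u).target ∧
      CoordFrame n (fun x => A₀ ((chartAt (EuclideanSpace ℝ (Fin (n - 1))) u).symm x))
        (fun x => Aₙ ((chartAt (EuclideanSpace ℝ (Fin (n - 1))) u).symm x)) Ω ∧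
      ∀ x ∈ Ω, (chartAt (EuclideanSpace ℝ (Fin (n - 1))) u).symm x ∈ O ∧
        IsFrameAt U.gen ((chartAt (EuclideanSpace ℝ (Fin (n - 1))) u).symm x) A₀ Aₙ := by
  have hu := mem_chart_source (EuclideanSpace ℝ (Fin (n - 1))) u
  set φ := chartAt (EuclideanSpace ℝ (Fin (n - 1))) u with hφ
  obtain ⟨Ω, hΩ, hΩo, huΩ⟩ := eventually_nhds_iff.1
    (((tendsto_chart_symm u).eventually (hF.eventually_isFrameAt.and hO)).and
      (φ.open_target.mem_nhds (φ.map_source hu)))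
  have hs0 : ∀ x ∈ Ω, ContDiffAt ℝ ∞ (fun x => A₀ (φ.symm x)) x := fun x hx => by
    have := contDiffAt_comp_chart_symm u (φ.map_target (hΩ x hx).2)
      (hΩ x hx).1.1.smooth_zero.self_of_nhds
    rwa [φ.right_inv (hΩ x hx).2] at this
  have hsn : ∀ x ∈ Ω, ContDiffAt ℝ ∞ (fun x => Aₙ (φ.symm x)) x := fun x hx => by
    have := contDiffAt_comp_chart_symm u (φ.map_target (hΩ x hx).2)
      (hΩ x hx).1.1.smooth_last.self_of_nhds
    rwa [φ.right_inv (hΩ x hx).2] at this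
  have hd0 : ∀ x (hx : x ∈ Ω), ∀ X, fderiv ℝ (fun x => A₀ (φ.symm x)) x X
      = diff A₀ (φ.symm x) ((chartDeriv u (φ.map_target (hΩ x hx).2)).symm X) := fun x hx X => by
    rw [diff_apply u (φ.map_target (hΩ x hx).2) (hΩ x hx).1.1.smooth_zero.self_of_nhds,
      LinearEquiv.apply_symm_apply, φ.right_inv (hΩ x hx).2]
  have hdn : ∀ x (hx : x ∈ Ω), ∀ X, fderiv ℝ (fun x => Aₙ (φ.symm x)) x X
      = diff Aₙ (φ.symm x) ((chartDeriv u (φ.map_target (hΩ x hx).2)).symm X) := fun x hx X => by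
    rw [diff_apply u (φ.map_target (hΩ x hx).2) (hΩ x hx).1.1.smooth_last.self_of_nhds,
      LinearEquiv.apply_symm_apply, φ.right_inv (hΩ x hx).2]
  have hnz : ∀ x ∈ Ω, ∀ X, lorentz n (fderiv ℝ (fun x => Aₙ (φ.symm x)) x X) (A₀ (φ.symm x)) = 0 :=
    fun x hx X => by
      rw [hdn x hx]
      exact U.lorentz_diff_last (hΩ x hx).1.1 _
  have hzn : ∀ x ∈ Ω, ∀ X, lorentz n (fderiv ℝ (fun x => A₀ (φ.symm x)) x X) (Aₙ (φ.symm x)) = 0 :=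
    fun x hx X => by
      have := lorentz_fderiv_of_const ((hs0 x hx).differentiableAt (by simp))
        ((hsn x hx).differentiableAt (by simp)) (c := 0) (by
          filter_upwards [hΩo.mem_nhds hx] with y hy
          exact (hΩ y hy).1.1.adapted.self_of_nhds.2.2.1) X
      rw [lorentz_comm (A₀ (φ.symm x)), hnz x hx, add_zero] at this
      exact this
  refine ⟨Ω, huΩ, fun x hx => (hΩ x hx).2, ⟨hΩo, hs0, hsn, fun x hx => ?_⟩,
    fun x hx => ⟨(hΩ x hx).1.2, (hΩ x hx).1.1⟩⟩
  have hfr := (hΩ x hx).1.1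
  obtain ⟨k1, k2, k3, k4, k5⟩ := hfr.adapted.self_of_nhds
  refine ⟨k1, k2, k3, k4, fun X => ?_, hzn x hx, hnz x hx, fun X => ?_, fun X Y => ?_,
    fun X hX => ?_, ?_⟩
  · have := lorentz_fderiv_of_const ((hs0 x hx).differentiableAt (by simp))
        ((hs0 x hx).differentiableAt (by simp)) (c := 0) (by
          filter_upwards [hΩo.mem_nhds hx] with y hy
          exact (hΩ y hy).1.1.adapted.self_of_nhds.2.1) X
    rw [lorentz_comm (A₀ (φ.symm x))] at this
    change lorentz n (fderiv ℝ (fun x => A₀ (φ.symm x)) x X) _ = 0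
    linarith
  · have := lorentz_fderiv_of_const ((hsn x hx).differentiableAt (by simp))
        ((hsn x hx).differentiableAt (by simp)) (c := 1) (by
          filter_upwards [hΩo.mem_nhds hx] with y hy
          exact (hΩ y hy).1.1.adapted.self_of_nhds.2.2.2.1) X
    rw [lorentz_comm (Aₙ (φ.symm x))] at this
    change lorentz n (fderiv ℝ (fun x => Aₙ (φ.symm x)) x X) _ = 0
    linarith
  · exact lorentz_fderiv_symm (hs0 x hx) (hsn x hx) (fun X => by
      filter_upwards [hΩo.mem_nhds hx] with y hy
      exact hzn y hy X) X Y
  · have hX' : fderiv ℝ (fun x => A₀ (φ.symm x)) x X ∈ ℝ ∙ A₀ (φ.symm x) := hX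
    rw [hd0 x hx] at hX'
    have hnull : IsNullSectionAt U.gen (φ.symm x) A₀ := by
      refine ⟨⟨hfr.smooth_zero, ?_⟩, hfr.adapted.mono fun w hw => hw.2.1⟩
      filter_upwards [hfr.adapted] with w hw
      refine ⟨?_, hw.1⟩
      rw [hw.2.2.2.2]
      exact Submodule.subset_span (by simp)
    simpa using hU _ _ hnull _ hX'
  · rw [finrank_euclideanSpace, Fintype.card_fin]
    omega

theorem LightlikeHypersurface.frameJet (U : LightlikeHypersurface n M)
    (hn : 1 ≤ n) (hU : U.HasMaximalRank) {u : M} {A₀ Aₙ : M → LSpace n}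
    (hF : IsFrameAt U.gen u A₀ Aₙ) : FrameJet n (A₀ u) (Aₙ u) (diff A₀ u) (diff Aₙ u) := by
  obtain ⟨Ω, huΩ, -, hΩ, -⟩ := U.exists_coordFrame hn hU hF univ_mem
  have hu := mem_chart_source (EuclideanSpace ℝ (Fin (n - 1))) u
  have h := (hΩ.jet _ huΩ).comp_equiv (chartDeriv u hu)
  simp only [(chartAt (EuclideanSpace ℝ (Fin (n - 1))) u).left_inv hu] at h
  have e0 : (fderiv ℝ (fun x => A₀ ((chartAt (EuclideanSpace ℝ (Fin (n - 1))) u).symm x))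
      (chartAt (EuclideanSpace ℝ (Fin (n - 1))) u u)).toLinearMap ∘ₗ (chartDeriv u hu).toLinearMap
      = diff A₀ u := by
    ext1 X
    exact (diff_apply u hu hF.smooth_zero.self_of_nhds X).symm
  have en : (fderiv ℝ (fun x => Aₙ ((chartAt (EuclideanSpace ℝ (Fin (n - 1))) u).symm x))
      (chartAt (EuclideanSpace ℝ (Fin (n - 1))) u u)).toLinearMap ∘ₗ (chartDeriv u hu).toLinearMap
      = diff Aₙ u := by
    ext1 X
    exact (diff_apply u hu hF.smooth_last.self_of_nhds X).symm
  rwa [e0, en] at h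

end Coordinates

/-! ### Foci -/

section Foci

variable {n : ℕ} {M : Type*} [TopologicalSpace M] [ChartedSpace (EuclideanSpace ℝ (Fin (n - 1))) M]

/-- The standard basis of a tangent space of `M`. -/
def tangentBasis (u : M) : Basis (Fin (n - 1)) ℝ (TangentSpace (𝓡 (n - 1)) u) :=
  (EuclideanSpace.basisFun (Fin (n - 1)) ℝ).toBasis

theorem tangentBasis_apply (u : M) (i : Fin (n - 1)) : tangentBasis u i = basisVec u i := by
  change (EuclideanSpace.basisFun (Fin (n - 1)) ℝ).toBasis i = EuclideanSpace.single i 1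
  simp

theorem finiteDimensional_tangentSpace (u : M) :
    FiniteDimensional ℝ (TangentSpace (𝓡 (n - 1)) u) :=
  inferInstanceAs (FiniteDimensional ℝ (EuclideanSpace ℝ (Fin (n - 1))))

/-- A point of a generator outside the absolute quadric is of the form `Aₙ + s A₀`. -/
theorem IsFrameAt.exists_eq_smul {gen : M → Submodule ℝ (LSpace n)} {u : M} {A₀ Aₙ : M → LSpace n}
    (hF : IsFrameAt gen u A₀ Aₙ) {x : LSpace n} (hx : x ∈ gen u) (hxx : lorentz n x x ≠ 0) :
    ∃ c s : ℝ, c ≠ 0 ∧ x = c • (Aₙ u + s • A₀ u) := by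
  obtain ⟨-, h1, h2, h3, h4⟩ := hF.adapted.self_of_nhds
  rw [h4] at hx
  obtain ⟨a, b, rfl⟩ := Submodule.mem_span_pair.1 hx
  have hb : b ≠ 0 := by
    rintro rfl
    simp [h1] at hxx
  refine ⟨b, a / b, hb, ?_⟩
  rw [smul_add, smul_smul, mul_div_cancel₀ _ hb, add_comm]

theorem IsFrameAt.lorentz_self {gen : M → Submodule ℝ (LSpace n)} {u : M} {A₀ Aₙ : M → LSpace n}
    (hF : IsFrameAt gen u A₀ Aₙ) (s : ℝ) :
    lorentz n (Aₙ u + s • A₀ u) (Aₙ u + s • A₀ u) = 1 := by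
  obtain ⟨-, h1, h2, h3, -⟩ := hF.adapted.self_of_nhds
  have h2' := h2
  rw [lorentz_comm] at h2'
  simp [h1, h2, h2', h3]

theorem IsFrameAt.focus_ne_zero {gen : M → Submodule ℝ (LSpace n)} {u : M} {A₀ Aₙ : M → LSpace n}
    (hF : IsFrameAt gen u A₀ Aₙ) (s : ℝ) : Aₙ u + s • A₀ u ≠ 0 := by
  intro h
  have := hF.lorentz_self s
  simp [h] at this

theorem IsFrameAt.focus_mem {gen : M → Submodule ℝ (LSpace n)} {u : M} {A₀ Aₙ : M → LSpace n}
    (hF : IsFrameAt gen u A₀ Aₙ) (s : ℝ) : Aₙ u + s • A₀ u ∈ gen u := by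
  rw [hF.adapted.self_of_nhds.2.2.2.2]
  exact Submodule.mem_span_pair.2 ⟨s, 1, by module⟩

variable [IsManifold (𝓡 (n - 1)) ∞ M]

/-- The singular directions of `Aₙ + s A₀`, expressed by the differentials of the frame. -/
theorem IsFrameAt.singularDirections_eq_focalKer {gen : M → Submodule ℝ (LSpace n)} {u : M}
    {A₀ Aₙ : M → LSpace n} (hF : IsFrameAt gen u A₀ Aₙ) {p : ℙ ℝ (LSpace n)} {s : ℝ}
    (hp : p.submodule = ℝ ∙ (Aₙ u + s • A₀ u)) :
    singularDirections gen u p = FrameJet.focalKer (A₀ u) (Aₙ u) (diff A₀ u) (diff Aₙ u) s := by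
  have e : Aₙ u + s • A₀ u = s • A₀ u + (1 : ℝ) • Aₙ u := by module
  rw [singularDirections_eq hF (a := s) (b := 1) (by rw [← e]; exact hF.focus_ne_zero s)
    (by rw [← e]; exact hp), FrameJet.focalKer, hF.adapted.self_of_nhds.2.2.2.2, one_smul,
    add_comm (s • diff A₀ u)]

/-- The polynomial `det (λ - s g)` has `n - 1` real roots, and the multiplicity of a root is the
dimension of the space of singular directions. -/
theorem LightlikeHypersurface.charPoly_spec (U : LightlikeHypersurface n M)
    (hn : 1 ≤ n) (hU : U.HasMaximalRank) {u : M} {A₀ Aₙ : M → LSpace n}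
    (hF : IsFrameAt U.gen u A₀ Aₙ) :
    (charPoly A₀ Aₙ u).natDegree = n - 1 ∧ Multiset.card (charPoly A₀ Aₙ u).roots = n - 1 ∧
      charPoly A₀ Aₙ u ≠ 0 ∧ ∀ s, (charPoly A₀ Aₙ u).rootMultiplicity s
        = finrank ℝ (FrameJet.focalKer (A₀ u) (Aₙ u) (diff A₀ u) (diff Aₙ u) s) := by
  have := finiteDimensional_tangentSpace (n := n) u
  refine (U.frameJet hn hU hF).pencil (tangentBasis u) _ ?_
  simp only [tangentBasis_apply]
  rfl

/-- The multiplicity of a focus is the dimension of its space of singular directions, in any adapted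
frame. -/
theorem LightlikeHypersurface.isFocus_iff (U : LightlikeHypersurface n M)
    (hn : 1 ≤ n) (hU : U.HasMaximalRank) {u : M} {A₀ Aₙ : M → LSpace n}
    (hF : IsFrameAt U.gen u A₀ Aₙ) {p : ℙ ℝ (LSpace n)} {m : ℕ} :
    IsFocus U.gen u p m ↔ 1 ≤ m ∧ ∃ s : ℝ, p.submodule = ℝ ∙ (Aₙ u + s • A₀ u) ∧
      finrank ℝ (FrameJet.focalKer (A₀ u) (Aₙ u) (diff A₀ u) (diff Aₙ u) s) = m := by
  constructor
  · rintro ⟨hm, B₀, Bₙ, t, hG, hp, -, hmul⟩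
    refine ⟨hm, ?_⟩
    obtain ⟨c, s, hc, hs⟩ := hF.exists_eq_smul (hG.focus_mem t) (by
      rw [hG.lorentz_self]
      exact one_ne_zero)
    have hp' : p.submodule = ℝ ∙ (Aₙ u + s • A₀ u) := by
      rw [hp, hs]
      exact Submodule.span_singleton_smul_eq (IsUnit.mk0 c hc) _
    refine ⟨s, hp', ?_⟩
    rw [← hF.singularDirections_eq_focalKer hp', hG.singularDirections_eq_focalKer hp,
      ← (U.charPoly_spec hn hU hG).2.2.2, hmul]
  · rintro ⟨hm, s, hp, hd⟩
    have := U.charPoly_spec hn hU hF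
    exact ⟨hm, A₀, Aₙ, s, hF, hp, this.2.2.1, by rw [this.2.2.2, hd]⟩

/-- The singular points of a generator correspond to the roots of the characteristic equation. -/
theorem LightlikeHypersurface.isSingularPoint_iff (U : LightlikeHypersurface n M)
    (hn : 1 ≤ n) (hU : U.HasMaximalRank) {u : M} {A₀ Aₙ : M → LSpace n}
    (hF : IsFrameAt U.gen u A₀ Aₙ) (p : ℙ ℝ (LSpace n)) :
    IsSingularPoint U.gen u p ↔
      ∃ s ∈ (charPoly A₀ Aₙ u).roots, p.submodule = ℝ ∙ (Aₙ u + s • A₀ u) := by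
  have := finiteDimensional_tangentSpace (n := n) u
  have hjet := U.frameJet hn hU hF
  have hspec := U.charPoly_spec hn hU hF
  have hgen := hF.adapted.self_of_nhds.2.2.2.2
  have hT : ∀ s : ℝ, p.submodule = ℝ ∙ (Aₙ u + s • A₀ u) →
      (finrank ℝ (tangentSubspace U.gen u p) < n + 1 ↔ s ∈ (charPoly A₀ Aₙ u).roots) := by
    intro s hp
    have e : Aₙ u + s • A₀ u = s • A₀ u + (1 : ℝ) • Aₙ u := by module
    have h1 := hjet.finrank_sup_range (s • diff A₀ u + (1 : ℝ) • diff Aₙ u)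
    rw [← hgen] at h1
    rw [tangentSubspace_eq hF (a := s) (b := 1) (by rw [← e]; exact hF.focus_ne_zero s)
      (by rw [← e]; exact hp)]
    have h2 : (U.gen u).comap (s • diff A₀ u + (1 : ℝ) • diff Aₙ u)
        = FrameJet.focalKer (A₀ u) (Aₙ u) (diff A₀ u) (diff Aₙ u) s := by
      rw [FrameJet.focalKer, hgen, one_smul, add_comm (s • diff A₀ u)]
    rw [h2, ← hspec.2.2.2] at h1
    rw [← Multiset.count_pos, Polynomial.count_roots]
    omega
  constructor
  · rintro ⟨hle, hlt⟩
    have hmem : p.rep ∈ U.gen u := hle (by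
      rw [Projectivization.submodule_eq]
      exact Submodule.mem_span_singleton_self _)
    by_cases hnull : lorentz n p.rep p.rep = 0
    · exfalso
      -- the point of contact with the quadric is regular
      rw [hgen] at hmem
      obtain ⟨a, b, hab⟩ := Submodule.mem_span_pair.1 hmem
      obtain ⟨-, k1, k2, k3, -⟩ := hF.adapted.self_of_nhds
      have k2' := k2
      rw [lorentz_comm] at k2'
      have hb : b = 0 := by
        rw [← hab] at hnull
        simpa [k1, k2, k2', k3] using hnull
      subst hb
      have hne : a • A₀ u + (0 : ℝ) • Aₙ u ≠ 0 := by rw [hab]; exact p.rep_nonzero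
      have ha : a ≠ 0 := by
        rintro rfl
        simp at hne
      rw [tangentSubspace_eq hF hne (by rw [hab, Projectivization.submodule_eq]), zero_smul,
        add_zero, LinearMap.range_smul _ _ ha, hgen, hjet.finrank_sup_range_zero] at hlt
      exact lt_irrefl _ hlt
    · obtain ⟨c, s, hc, hs⟩ := hF.exists_eq_smul hmem hnull
      have hp : p.submodule = ℝ ∙ (Aₙ u + s • A₀ u) := by
        rw [Projectivization.submodule_eq, hs]
        exact Submodule.span_singleton_smul_eq (IsUnit.mk0 c hc) _
      exact ⟨s, (hT s hp).1 hlt, hp⟩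
  · rintro ⟨s, hs, hp⟩
    refine ⟨?_, (hT s hp).2 hs⟩
    rw [hp, Submodule.span_singleton_le_iff_mem]
    exact hF.focus_mem s

end Foci

/-! ### Smooth fields of foci in coordinates -/

section CoordinateFrames

variable {n : ℕ} {E : Type*} [NormedAddCommGroup E] [NormedSpace ℝ E]
  {a₀ aₙ : E → LSpace n} {Ω : Set E}

theorem CoordFrame.contDiffAt_fderiv_zero (h : CoordFrame n a₀ aₙ Ω) {x : E} (hx : x ∈ Ω) :
    ContDiffAt ℝ ∞ (fderiv ℝ a₀) x := (h.smooth_zero x hx).fderiv_right (by simp)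

theorem CoordFrame.contDiffAt_fderiv_last (h : CoordFrame n a₀ aₙ Ω) {x : E} (hx : x ∈ Ω) :
    ContDiffAt ℝ ∞ (fderiv ℝ aₙ) x := (h.smooth_last x hx).fderiv_right (by simp)

theorem CoordFrame.mem_nhds (h : CoordFrame n a₀ aₙ Ω) {x : E} (hx : x ∈ Ω) : Ω ∈ 𝓝 x :=
  h.isOpen.mem_nhds hx

theorem CoordFrame.mono (h : CoordFrame n a₀ aₙ Ω) {Ω' : Set E} (ho : IsOpen Ω') (hs : Ω' ⊆ Ω) :
    CoordFrame n a₀ aₙ Ω' :=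
  ⟨ho, fun x hx => h.smooth_zero x (hs hx), fun x hx => h.smooth_last x (hs hx),
    fun x hx => h.jet x (hs hx)⟩

end CoordinateFrames

section CoordinateFoci

variable {n : ℕ} {E : Type*} [NormedAddCommGroup E] [InnerProductSpace ℝ E] [FiniteDimensional ℝ E]

/-- The operator on `E` with the form `(X, Y) ↦ (f X, g Y)`. -/
def formOp (f g : E →L[ℝ] LSpace n) : E →L[ℝ] E :=
  ∑ i, (ContinuousLinearMap.toSpanSingleton ℝ (stdOrthonormalBasis ℝ E i)).comp
    (((lorentzL n).flip (g (stdOrthonormalBasis ℝ E i))).comp f)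

theorem inner_formOp (f g : E →L[ℝ] LSpace n) (X Y : E) :
    inner ℝ (formOp f g X) Y = lorentz n (f X) (g Y) := by
  conv_rhs => rw [← (stdOrthonormalBasis ℝ E).sum_repr' Y]
  simp [formOp, sum_inner, real_inner_smul_left, mul_comm]

theorem contDiffAt_formOp {W : Type*} [NormedAddCommGroup W] [NormedSpace ℝ W]
    {f g : W → E →L[ℝ] LSpace n} {x : W} (hf : ContDiffAt ℝ ∞ f x) (hg : ContDiffAt ℝ ∞ g x) :
    ContDiffAt ℝ ∞ (fun x => formOp (f x) (g x)) x := by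
  refine ContDiffAt.sum fun i _ => ?_
  refine contDiffAt_const.clm_comp (ContDiffAt.clm_comp ?_ hf)
  exact (lorentzL n).flip.contDiff.contDiffAt.comp x (hg.clm_apply contDiffAt_const)

/-- The kernel on `E` of the operator with the form `(νX + s αX, αY)`. -/
theorem FrameJet.ker_formOp {a₀ aₙ : LSpace n} {α ν : E →L[ℝ] LSpace n}
    (h : FrameJet n a₀ aₙ α.toLinearMap ν.toLinearMap) (s : ℝ) :
    LinearMap.ker (formOp ν α + s • formOp α α).toLinearMap
      = focalKer a₀ aₙ α.toLinearMap ν.toLinearMap s := by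
  ext X
  rw [h.mem_focalKer_iff]
  have e : ∀ Y, inner ℝ ((formOp ν α + s • formOp α α) X) Y = lorentz n (ν X + s • α X) (α Y) := by
    intro Y
    simp [inner_add_left, real_inner_smul_left, inner_formOp]
  change (formOp ν α + s • formOp α α) X = 0 ↔ ∀ Y, lorentz n (ν X + s • α X) (α Y) = 0
  simp only [← e]
  constructor
  · intro h0 Y
    rw [h0, inner_zero_left]
  · intro h0
    exact inner_self_eq_zero.1 (h0 _)

theorem FrameJet.inner_formOp_symm {a₀ aₙ : LSpace n} {α ν : E →L[ℝ] LSpace n}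
    (h : FrameJet n a₀ aₙ α.toLinearMap ν.toLinearMap) (s : ℝ) (X Y : E) :
    inner ℝ ((formOp ν α + s • formOp α α) X) Y = inner ℝ X ((formOp ν α + s • formOp α α) Y) := by
  rw [real_inner_comm ((formOp ν α + s • formOp α α) Y) X]
  simp only [add_apply, smul_apply, inner_add_left, real_inner_smul_left, inner_formOp]
  rw [lorentz_comm (α X) (α Y), lorentz_comm (ν X), lorentz_comm (ν Y)]
  have := h.symm X Y
  simp only [ContinuousLinearMap.coe_coe] at this
  rw [this]

variable {a₀ aₙ : E → LSpace n} {Ω : Set E}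

/-- Foci of a constant multiplicity depend smoothly on the generator, and a simple focus extends to
a smooth field of simple foci. -/
theorem CoordFrame.exists_root (h : CoordFrame n a₀ aₙ Ω) {x₀ : E} (hx₀ : x₀ ∈ Ω) {s₀ : ℝ}
    (hD : FrameJet.focalKer (a₀ x₀) (aₙ x₀) (fderiv ℝ a₀ x₀).toLinearMap
      (fderiv ℝ aₙ x₀).toLinearMap s₀ ≠ ⊥) :
    ∃ σ : E → ℝ, σ x₀ = s₀ ∧ (∀ᶠ x in 𝓝 x₀, ContDiffAt ℝ ∞ σ x) ∧
      (∀ᶠ p : E × ℝ in 𝓝 (x₀, s₀),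
        finrank ℝ (FrameJet.focalKer (a₀ p.1) (aₙ p.1) (fderiv ℝ a₀ p.1).toLinearMap
          (fderiv ℝ aₙ p.1).toLinearMap p.2)
        = finrank ℝ (FrameJet.focalKer (a₀ x₀) (aₙ x₀) (fderiv ℝ a₀ x₀).toLinearMap
          (fderiv ℝ aₙ x₀).toLinearMap s₀) → p.2 = σ p.1) ∧
      (finrank ℝ (FrameJet.focalKer (a₀ x₀) (aₙ x₀) (fderiv ℝ a₀ x₀).toLinearMap
          (fderiv ℝ aₙ x₀).toLinearMap s₀) = 1 →
        ∀ᶠ x in 𝓝 x₀, finrank ℝ (FrameJet.focalKer (a₀ x) (aₙ x) (fderiv ℝ a₀ x).toLinearMap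
          (fderiv ℝ aₙ x).toLinearMap (σ x)) = 1) := by
  have hev : ∀ᶠ x in 𝓝 x₀, x ∈ Ω := h.mem_nhds hx₀
  obtain ⟨σ, h1, h2, h3, h4⟩ := exists_smooth_root (E := E) (u := x₀) (s₀ := s₀)
    (N := fun x => formOp (fderiv ℝ aₙ x) (fderiv ℝ a₀ x))
    (G := fun x => formOp (fderiv ℝ a₀ x) (fderiv ℝ a₀ x))
    (hev.mono fun x hx =>
      contDiffAt_formOp (h.contDiffAt_fderiv_last hx) (h.contDiffAt_fderiv_zero hx))
    (hev.mono fun x hx =>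
      contDiffAt_formOp (h.contDiffAt_fderiv_zero hx) (h.contDiffAt_fderiv_zero hx))
    ((h.jet x₀ hx₀).inner_formOp_symm s₀)
    (fun X hX => by
      rw [inner_formOp]
      exact (h.jet x₀ hx₀).g_pos hX)
    (by rw [(h.jet x₀ hx₀).ker_formOp]; exact hD)
  rw [(h.jet x₀ hx₀).ker_formOp] at h3 h4
  refine ⟨σ, h1, h2, ?_, fun hd => ?_⟩
  · have hfst : Tendsto (Prod.fst : E × ℝ → E) (𝓝 (x₀, s₀)) (𝓝 x₀) := continuous_fst.tendsto _
    filter_upwards [h3, hfst.eventually hev] with p hp hpΩ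
    rwa [(h.jet p.1 hpΩ).ker_formOp] at hp
  · filter_upwards [h4 hd, hev] with x hx hxΩ
    rwa [(h.jet x hxΩ).ker_formOp] at hx

/-- A smooth field `aₙ + s a₀` of foci of a constant multiplicity in coordinates. -/
structure FocalCoord (n m : ℕ) {E : Type*} [NormedAddCommGroup E] [NormedSpace ℝ E]
    (a₀ aₙ : E → LSpace n) (s : E → ℝ) (Ω : Set E) : Prop extends CoordFrame n a₀ aₙ Ω where
  smooth_root : ∀ x ∈ Ω, ContDiffAt ℝ ∞ s x
  finrank_ker : ∀ x ∈ Ω, finrank ℝ (FrameJet.focalKer (a₀ x) (aₙ x) (fderiv ℝ a₀ x).toLinearMap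
    (fderiv ℝ aₙ x).toLinearMap (s x)) = m

end CoordinateFoci

section FocusFields

variable {n : ℕ} {M : Type*} [TopologicalSpace M] [ChartedSpace (EuclideanSpace ℝ (Fin (n - 1))) M]
  [IsManifold (𝓡 (n - 1)) ∞ M]

/-- The singular directions do not depend on the chart in which the frame is differentiated. -/
theorem focalKer_chart {gen : M → Submodule ℝ (LSpace n)} {u w : M} {A₀ Aₙ : M → LSpace n}
    (hw : w ∈ (chartAt (EuclideanSpace ℝ (Fin (n - 1))) u).source)
    (hF : IsFrameAt gen w A₀ Aₙ) (s : ℝ) :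
    FrameJet.focalKer (A₀ w) (Aₙ w) (diff A₀ w) (diff Aₙ w) s
      = (FrameJet.focalKer (A₀ w) (Aₙ w)
          (fderiv ℝ (fun x => A₀ ((chartAt (EuclideanSpace ℝ (Fin (n - 1))) u).symm x))
            (chartAt (EuclideanSpace ℝ (Fin (n - 1))) u w)).toLinearMap
          (fderiv ℝ (fun x => Aₙ ((chartAt (EuclideanSpace ℝ (Fin (n - 1))) u).symm x))
            (chartAt (EuclideanSpace ℝ (Fin (n - 1))) u w)).toLinearMap s).comap
        (chartDeriv u hw).toLinearMap := by
  ext X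
  simp only [FrameJet.focalKer, Submodule.mem_comap, LinearMap.add_apply, LinearMap.smul_apply]
  rw [diff_apply u hw hF.smooth_zero.self_of_nhds, diff_apply u hw hF.smooth_last.self_of_nhds]
  rfl

theorem finrank_comap_equiv {V W : Type*} [AddCommGroup V] [Module ℝ V] [AddCommGroup W]
    [Module ℝ W] (e : V ≃ₗ[ℝ] W) (S : Submodule ℝ W) :
    finrank ℝ (S.comap e.toLinearMap) = finrank ℝ S := by
  have h : S.comap e.toLinearMap = S.map e.symm.toLinearMap :=
    (Submodule.map_equiv_eq_comap_symm e.symm S).symm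
  rw [h]
  exact (e.symm.submoduleMap S).symm.finrank_eq

/-- Near each point, a continuous field of foci of a constant multiplicity is of the form
`Aₙ + s A₀` with a smooth function `s`. -/
theorem LightlikeHypersurface.exists_focalCoord (U : LightlikeHypersurface n M)
    (hn : 1 ≤ n) (hU : U.HasMaximalRank) {N : Set M} {B : M → ℙ ℝ (LSpace n)} {m : ℕ}
    (hB : IsFocusField U.gen N B m) {u : M} (hu : u ∈ N) {O : Set M} (hO : O ∈ 𝓝 u) :
    ∃ (A₀ Aₙ : M → LSpace n) (s : EuclideanSpace ℝ (Fin (n - 1)) → ℝ)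
      (Ω : Set (EuclideanSpace ℝ (Fin (n - 1)))),
      chartAt (EuclideanSpace ℝ (Fin (n - 1))) u u ∈ Ω ∧
      Ω ⊆ (chartAt (EuclideanSpace ℝ (Fin (n - 1))) u).target ∧
      FocalCoord n m (fun x => A₀ ((chartAt (EuclideanSpace ℝ (Fin (n - 1))) u).symm x))
        (fun x => Aₙ ((chartAt (EuclideanSpace ℝ (Fin (n - 1))) u).symm x)) s Ω ∧
      ∀ w (hw : w ∈ (chartAt (EuclideanSpace ℝ (Fin (n - 1))) u).source),
        chartAt (EuclideanSpace ℝ (Fin (n - 1))) u w ∈ Ω →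
        w ∈ N ∧ w ∈ O ∧ IsFrameAt U.gen w A₀ Aₙ ∧
        (B w).submodule = ℝ ∙ (Aₙ w + s (chartAt (EuclideanSpace ℝ (Fin (n - 1))) u w) • A₀ w) ∧
        singularDirections U.gen w (B w) = (FrameJet.focalKer (A₀ w) (Aₙ w)
          (fderiv ℝ (fun x => A₀ ((chartAt (EuclideanSpace ℝ (Fin (n - 1))) u).symm x))
            (chartAt (EuclideanSpace ℝ (Fin (n - 1))) u w)).toLinearMap
          (fderiv ℝ (fun x => Aₙ ((chartAt (EuclideanSpace ℝ (Fin (n - 1))) u).symm x))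
            (chartAt (EuclideanSpace ℝ (Fin (n - 1))) u w)).toLinearMap
            (s (chartAt (EuclideanSpace ℝ (Fin (n - 1))) u w))).comap
          (chartDeriv u hw).toLinearMap := by
  obtain ⟨A₀, Aₙ, hF⟩ := U.exists_frame u
  obtain ⟨Ω, huΩ, hΩt, hΩ, hΩF⟩ := U.exists_coordFrame hn hU hF
    (Filter.inter_mem (hB.isOpen.mem_nhds hu) hO)
  have hus := mem_chart_source (EuclideanSpace ℝ (Fin (n - 1))) u
  set φ := chartAt (EuclideanSpace ℝ (Fin (n - 1))) u with hφ
  have ht : Tendsto φ.symm (𝓝 (φ u)) (𝓝 u) := tendsto_chart_symm u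
  have hex : ∀ x ∈ Ω, ∃ s : ℝ, (B (φ.symm x)).submodule = ℝ ∙ (Aₙ (φ.symm x) + s • A₀ (φ.symm x)) ∧
      finrank ℝ (FrameJet.focalKer (A₀ (φ.symm x)) (Aₙ (φ.symm x))
        (fderiv ℝ (fun x => A₀ (φ.symm x)) x).toLinearMap
        (fderiv ℝ (fun x => Aₙ (φ.symm x)) x).toLinearMap s) = m := by
    intro x hx
    obtain ⟨⟨hxN, -⟩, hxF⟩ := hΩF x hx
    obtain ⟨-, s, h1, h2⟩ := (U.isFocus_iff hn hU hxF).1 (hB.focus _ hxN)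
    refine ⟨s, h1, ?_⟩
    rw [focalKer_chart (φ.map_target (hΩt hx)) hxF, finrank_comap_equiv] at h2
    rw [← hφ, φ.right_inv (hΩt hx)] at h2
    exact h2
  choose! s hs1 hs2 using hex
  have huu : φ.symm (φ u) = u := φ.left_inv hus
  -- continuity of the root at the centre of the chart
  have hsc : ContinuousAt s (φ u) := by
    obtain ⟨v, hv, hvc⟩ := hB.continuous u hu
    obtain ⟨e, he⟩ := exists_lorentz_ne_zero hF.adapted.self_of_nhds.1
    have c0 := (hΩ.smooth_zero _ huΩ).continuousAt
    have cn := (hΩ.smooth_last _ huΩ).continuousAt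
    have cv : ContinuousAt (fun x => v (φ.symm x)) (φ u) := by
      refine ContinuousAt.comp ?_ ?_
      · rw [huu]; exact hvc
      · rw [ContinuousAt, huu]; exact ht
    have hlc : ∀ {f g : EuclideanSpace ℝ (Fin (n - 1)) → LSpace n}, ContinuousAt f (φ u) →
        ContinuousAt g (φ u) → ContinuousAt (fun x => lorentz n (f x) (g x)) (φ u) := fun hf hg =>
      ((lorentzL n).continuous.continuousAt.comp hf).clm_apply hg
    have key : ∀ᶠ x in 𝓝 (φ u), lorentz n (v (φ.symm x)) (Aₙ (φ.symm x)) ≠ 0 ∧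
        lorentz n (v (φ.symm x)) e = lorentz n (v (φ.symm x)) (Aₙ (φ.symm x)) *
          (lorentz n (Aₙ (φ.symm x)) e + s x * lorentz n (A₀ (φ.symm x)) e) := by
      filter_upwards [ht.eventually hv, hΩ.mem_nhds huΩ] with x hx hxΩ
      have hm := hx.1
      rw [hs1 x hxΩ] at hm
      obtain ⟨c, hc⟩ := Submodule.mem_span_singleton.1 hm
      have hc0 : c ≠ 0 := by
        rintro rfl
        exact hx.2 (by rw [← hc, zero_smul])
      obtain ⟨-, -, k3, k4, -⟩ := (hΩF x hxΩ).2.adapted.self_of_nhds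
      rw [← hc]
      constructor
      · simpa [k3, k4] using hc0
      · simp [k3, k4, mul_add]
    have h0 : lorentz n (A₀ (φ.symm (φ u))) e ≠ 0 := by rw [huu]; exact he
    have hform : s =ᶠ[𝓝 (φ u)] fun x => (lorentz n (v (φ.symm x)) e
        / lorentz n (v (φ.symm x)) (Aₙ (φ.symm x)) - lorentz n (Aₙ (φ.symm x)) e)
        / lorentz n (A₀ (φ.symm x)) e := by
      filter_upwards [key, eventually_lorentz_ne_zero c0 h0] with x hx hx0
      rw [hx.2, mul_div_cancel_left₀ _ hx.1, add_sub_cancel_left, mul_div_cancel_right₀ _ hx0]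
    refine ContinuousAt.congr ?_ hform.symm
    exact (((hlc cv continuousAt_const).div (hlc cv cn) key.self_of_nhds.1).sub
      (hlc cn continuousAt_const)).div (hlc c0 continuousAt_const) h0
  have hm1 : 1 ≤ m := (hB.focus u hu).1
  have hD : FrameJet.focalKer (A₀ (φ.symm (φ u))) (Aₙ (φ.symm (φ u)))
        (fderiv ℝ (fun x => A₀ (φ.symm x)) (φ u)).toLinearMap
        (fderiv ℝ (fun x => Aₙ (φ.symm x)) (φ u)).toLinearMap (s (φ u)) ≠ ⊥ := by
    intro h
    have := hs2 _ huΩ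
    rw [h, finrank_bot] at this
    omega
  obtain ⟨σ, hσ0, hσ1, hσ2, -⟩ := hΩ.exists_root huΩ hD
  have hσs : ∀ᶠ x in 𝓝 (φ u), s x = σ x := by
    have hp : Tendsto (fun x => (x, s x)) (𝓝 (φ u)) (𝓝 (φ u, s (φ u))) :=
      continuousAt_id.prodMk hsc
    filter_upwards [hp.eventually hσ2, hΩ.mem_nhds huΩ] with x hx hxΩ
    exact hx (by rw [hs2 x hxΩ, hs2 _ huΩ])
  obtain ⟨Ω', hΩ', hΩ'o, huΩ'⟩ := eventually_nhds_iff.1 ((hσs.and hσ1).and (hΩ.mem_nhds huΩ))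
  refine ⟨A₀, Aₙ, σ, Ω', huΩ', fun x hx => hΩt (hΩ' x hx).2,
    ⟨hΩ.mono hΩ'o fun x hx => (hΩ' x hx).2, fun x hx => (hΩ' x hx).1.2, fun x hx => ?_⟩,
    fun w hw hwΩ => ?_⟩
  · rw [← (hΩ' x hx).1.1]
    exact hs2 x (hΩ' x hx).2
  · obtain ⟨⟨hsσ, -⟩, hwΩ0⟩ := hΩ' _ hwΩ
    have hww : φ.symm (φ w) = w := φ.left_inv hw
    obtain ⟨⟨hwN, hwO⟩, hwF⟩ := hΩF _ hwΩ0
    have hBw := hs1 _ hwΩ0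
    rw [hww] at hwN hwO hwF hBw
    rw [hsσ] at hBw
    refine ⟨hwN, hwO, hwF, hBw, ?_⟩
    rw [hwF.singularDirections_eq_focalKer hBw]
    exact focalKer_chart hw hwF _

/-- A simple focus belongs to a continuous field of simple foci. -/
theorem LightlikeHypersurface.exists_focusField (U : LightlikeHypersurface n M)
    (hn : 1 ≤ n) (hU : U.HasMaximalRank) {u : M} {p : ℙ ℝ (LSpace n)} (hp : IsFocus U.gen u p 1) :
    ∃ (N : Set M) (B : M → ℙ ℝ (LSpace n)), u ∈ N ∧ B u = p ∧ IsFocusField U.gen N B 1 := by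
  obtain ⟨A₀, Aₙ, hF⟩ := U.exists_frame u
  obtain ⟨Ω, huΩ, hΩt, hΩ, hΩF⟩ := U.exists_coordFrame hn hU hF univ_mem
  have hus := mem_chart_source (EuclideanSpace ℝ (Fin (n - 1))) u
  obtain ⟨-, s₀, hp1, hp2⟩ := (U.isFocus_iff hn hU hF).1 hp
  rw [focalKer_chart hus hF, finrank_comap_equiv] at hp2
  set φ := chartAt (EuclideanSpace ℝ (Fin (n - 1))) u with hφ
  have huu : φ.symm (φ u) = u := φ.left_inv hus
  have hp2' : finrank ℝ (FrameJet.focalKer (A₀ (φ.symm (φ u))) (Aₙ (φ.symm (φ u)))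
        (fderiv ℝ (fun x => A₀ (φ.symm x)) (φ u)).toLinearMap
        (fderiv ℝ (fun x => Aₙ (φ.symm x)) (φ u)).toLinearMap s₀) = 1 := by
    rw [huu]
    exact hp2
  have hD : FrameJet.focalKer (A₀ (φ.symm (φ u))) (Aₙ (φ.symm (φ u)))
        (fderiv ℝ (fun x => A₀ (φ.symm x)) (φ u)).toLinearMap
        (fderiv ℝ (fun x => Aₙ (φ.symm x)) (φ u)).toLinearMap s₀ ≠ ⊥ := by
    intro h
    rw [h, finrank_bot] at hp2'
    omega
  obtain ⟨σ, hσ0, hσ1, -, hσ2⟩ := hΩ.exists_root huΩ hD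
  obtain ⟨Ω', hΩ', hΩ'o, huΩ'⟩ := eventually_nhds_iff.1
    ((hσ1.and (hσ2 hp2')).and (hΩ.mem_nhds huΩ))
  let N : Set M := φ.source ∩ φ ⁻¹' Ω'
  have hNo : IsOpen N := φ.isOpen_inter_preimage hΩ'o
  let v : M → LSpace n := fun w => Aₙ w + σ (φ w) • A₀ w
  have hNF : ∀ w ∈ N, IsFrameAt U.gen w A₀ Aₙ := fun w hw => by
    have := (hΩF _ (hΩ' _ hw.2).2).2
    rwa [φ.left_inv hw.1] at this
  have hv : ∀ w ∈ N, v w ≠ 0 := fun w hw => (hNF w hw).focus_ne_zero _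
  classical
  let B : M → ℙ ℝ (LSpace n) := fun w => if h : v w ≠ 0 then Projectivization.mk ℝ (v w) h else p
  have hBv : ∀ w ∈ N, (B w).submodule = ℝ ∙ v w := fun w hw => by
    simp only [B]
    rw [dif_pos (hv w hw), Projectivization.submodule_mk]
  have huN : u ∈ N := ⟨hus, huΩ'⟩
  refine ⟨N, B, huN, ?_, hNo, fun w hw => ?_, fun w hw => ?_⟩
  · apply Projectivization.submodule_injective
    rw [hBv u huN, hp1]
    simp only [v]
    rw [hσ0]
  · refine ⟨v, ?_, ?_⟩
    · filter_upwards [hNo.mem_nhds hw] with y hy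
      refine ⟨?_, hv y hy⟩
      rw [hBv y hy]
      exact Submodule.mem_span_singleton_self _
    · have h1 := (hNF w hw).smooth_zero.self_of_nhds.continuousAt
      have h2 := (hNF w hw).smooth_last.self_of_nhds.continuousAt
      have h3 : ContinuousAt (fun w => σ (φ w)) w :=
        ContinuousAt.comp (hΩ' _ hw.2).1.1.continuousAt (φ.continuousAt hw.1)
      exact h2.add (h3.smul h1)
  · rw [U.isFocus_iff hn hU (hNF w hw)]
    refine ⟨le_rfl, σ (φ w), hBv w hw, ?_⟩
    rw [focalKer_chart hw.1 (hNF w hw), finrank_comap_equiv]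
    have := (hΩ' _ hw.2).1.2
    rwa [φ.left_inv hw.1] at this

end FocusFields

/-! ### The displacement of a field of foci -/

namespace FocalCoord

section

variable {n m : ℕ} {E : Type*} [NormedAddCommGroup E] [NormedSpace ℝ E]
  {a₀ aₙ : E → LSpace n} {s : E → ℝ} {Ω : Set E}

/-- The directions at `x` in which the focus `aₙ + s a₀` is displaced only along the generator. -/
def ker (a₀ aₙ : E → LSpace n) (s : E → ℝ) (x : E) : Submodule ℝ E :=
  FrameJet.focalKer (a₀ x) (aₙ x) (fderiv ℝ a₀ x).toLinearMap (fderiv ℝ aₙ x).toLinearMap (s x)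

/-- The normalized representative of the focus. -/
def focus (a₀ aₙ : E → LSpace n) (s : E → ℝ) (x : E) : LSpace n := aₙ x + s x • a₀ x

theorem contDiffAt_focus (h : FocalCoord n m a₀ aₙ s Ω) {x : E} (hx : x ∈ Ω) :
    ContDiffAt ℝ ∞ (focus a₀ aₙ s) x :=
  (h.smooth_last x hx).add ((h.smooth_root x hx).smul (h.smooth_zero x hx))

theorem fderiv_focus (h : FocalCoord n m a₀ aₙ s Ω) {x : E} (hx : x ∈ Ω) (X : E) :
    fderiv ℝ (focus a₀ aₙ s) x X
      = fderiv ℝ aₙ x X + s x • fderiv ℝ a₀ x X + fderiv ℝ s x X • a₀ x := by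
  have h0 := ((h.smooth_zero x hx).differentiableAt (by simp)).hasFDerivAt
  have hn := ((h.smooth_last x hx).differentiableAt (by simp)).hasFDerivAt
  have hs := ((h.smooth_root x hx).differentiableAt (by simp)).hasFDerivAt
  have key : HasFDerivAt (focus a₀ aₙ s) _ x := hn.add (hs.smul h0)
  rw [key.fderiv]
  simp only [add_apply, smul_apply, ContinuousLinearMap.smulRight_apply]
  abel

theorem mem_ker_iff (h : FocalCoord n m a₀ aₙ s Ω) {x : E} (hx : x ∈ Ω) {X : E} :
    X ∈ ker a₀ aₙ s x ↔ fderiv ℝ (focus a₀ aₙ s) x X ∈ ℝ ∙ a₀ x := by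
  rw [ker, (h.jet x hx).mem_focalKer_iff_mem_span_zero, h.fderiv_focus hx]
  have : fderiv ℝ s x X • a₀ x ∈ ℝ ∙ a₀ x :=
    Submodule.smul_mem _ _ (Submodule.mem_span_singleton_self _)
  exact (Submodule.add_mem_iff_left _ this).symm

theorem lorentz_focus_zero (h : FocalCoord n m a₀ aₙ s Ω) {x : E} (hx : x ∈ Ω) :
    lorentz n (a₀ x) (focus a₀ aₙ s x) = 0 := by
  have hj := h.jet x hx
  simp [focus, hj.orth, hj.null]

theorem lorentz_focus_self (h : FocalCoord n m a₀ aₙ s Ω) {x : E} (hx : x ∈ Ω) :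
    lorentz n (focus a₀ aₙ s x) (focus a₀ aₙ s x) = 1 := by
  have hj := h.jet x hx
  have := hj.orth
  rw [lorentz_comm] at this
  simp [focus, hj.orth, hj.null, hj.unit, this]

theorem lorentz_fderiv_focus_zero (h : FocalCoord n m a₀ aₙ s Ω) {x : E} (hx : x ∈ Ω) (X : E) :
    lorentz n (fderiv ℝ (focus a₀ aₙ s) x X) (a₀ x) = 0 := by
  have hj := h.jet x hx
  have h1 := hj.α_zero X
  have h2 := hj.ν_zero X
  simp only [ContinuousLinearMap.coe_coe] at h1 h2
  rw [h.fderiv_focus hx]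
  simp [h1, h2, hj.null]

theorem lorentz_fderiv_focus_self (h : FocalCoord n m a₀ aₙ s Ω) {x : E} (hx : x ∈ Ω) (X : E) :
    lorentz n (fderiv ℝ (focus a₀ aₙ s) x X) (focus a₀ aₙ s x) = 0 := by
  have hd := (h.contDiffAt_focus hx).differentiableAt (by simp)
  have := lorentz_fderiv_of_const hd hd (c := 1) (by
    filter_upwards [h.mem_nhds hx] with y hy
    exact h.lorentz_focus_self hy) X
  rw [lorentz_comm (focus a₀ aₙ s x)] at this
  linarith

/-- The displacement of the focus is spacelike, except in the singular directions. -/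
theorem lorentz_fderiv_focus_pos (h : FocalCoord n m a₀ aₙ s Ω) {x : E} (hx : x ∈ Ω) {X : E}
    (hX : X ∉ ker a₀ aₙ s x) :
    0 < lorentz n (fderiv ℝ (focus a₀ aₙ s) x X) (fderiv ℝ (focus a₀ aₙ s) x X) := by
  have hj := h.jet x hx
  obtain ⟨h1, h2⟩ := lorentz_self_of_orthogonal_null hj.ne_zero hj.null
    (by rw [lorentz_comm]; exact h.lorentz_fderiv_focus_zero hx X)
  exact lt_of_le_of_ne h1 fun e => hX ((h.mem_ker_iff hx).2 (h2 e.symm))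

theorem mem_ker_of_fderiv_eq_zero (h : FocalCoord n m a₀ aₙ s Ω) {x : E} (hx : x ∈ Ω) {X : E}
    (hX : fderiv ℝ (focus a₀ aₙ s) x X = 0) : X ∈ ker a₀ aₙ s x := by
  rw [h.mem_ker_iff hx, hX]
  exact Submodule.zero_mem _

end

theorem span_pair_eq {n : ℕ} {E : Type*} (a₀ aₙ : E → LSpace n) (s : E → ℝ) (x : E) :
    Submodule.span ℝ {a₀ x, aₙ x} = Submodule.span ℝ {a₀ x, focus a₀ aₙ s x} := by
  apply le_antisymm <;> rw [Submodule.span_le] <;> rintro z (rfl | rfl)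
  · exact Submodule.subset_span (by simp)
  · exact Submodule.mem_span_pair.2 ⟨-s x, 1, by simp only [focus]; module⟩
  · exact Submodule.subset_span (by simp)
  · exact Submodule.mem_span_pair.2 ⟨s x, 1, by simp only [focus]; module⟩

section

variable {n m : ℕ} {E : Type*} [NormedAddCommGroup E] [InnerProductSpace ℝ E]
  [FiniteDimensional ℝ E] {a₀ aₙ : E → LSpace n} {s : E → ℝ} {Ω : Set E}

/-- The operator on `E` with the symmetric form `(dB X, dA₀ Y)`. -/
def focalOp (a₀ aₙ : E → LSpace n) (s : E → ℝ) (x : E) : E →L[ℝ] E :=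
  formOp (fderiv ℝ aₙ x) (fderiv ℝ a₀ x) + s x • formOp (fderiv ℝ a₀ x) (fderiv ℝ a₀ x)

theorem contDiffAt_focalOp (h : FocalCoord n m a₀ aₙ s Ω) {x : E} (hx : x ∈ Ω) :
    ContDiffAt ℝ ∞ (focalOp a₀ aₙ s) x :=
  (contDiffAt_formOp (h.contDiffAt_fderiv_last hx) (h.contDiffAt_fderiv_zero hx)).add
    ((h.smooth_root x hx).smul
      (contDiffAt_formOp (h.contDiffAt_fderiv_zero hx) (h.contDiffAt_fderiv_zero hx)))

theorem ker_focalOp (h : FocalCoord n m a₀ aₙ s Ω) {x : E} (hx : x ∈ Ω) :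
    LinearMap.ker (focalOp a₀ aₙ s x).toLinearMap = ker a₀ aₙ s x :=
  (h.jet x hx).ker_formOp (s x)

theorem eventually_finrank_ker_focalOp (h : FocalCoord n m a₀ aₙ s Ω) {x : E} (hx : x ∈ Ω) :
    ∀ᶠ y in 𝓝 x, finrank ℝ (LinearMap.ker (focalOp a₀ aₙ s y).toLinearMap)
      = finrank ℝ (LinearMap.ker (focalOp a₀ aₙ s x).toLinearMap) := by
  filter_upwards [h.mem_nhds hx] with y hy
  rw [h.ker_focalOp hy, h.ker_focalOp hx]
  exact (h.finrank_ker y hy).trans (h.finrank_ker x hx).symm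

/-- If the multiplicity is constant, the second-order displacement of the focus in two singular
directions `Z`, `X` has the component `θ(X) (dA₀ Z, dA₀ Y)` along `dA₀ Y`, where
`dB(X) = θ(X) A₀`. -/
theorem lorentz_fderiv_fderiv_focus (h : FocalCoord n m a₀ aₙ s Ω) {x : E} (hx : x ∈ Ω)
    {X Y : E} (Z : E) {θ : ℝ} (hX : X ∈ ker a₀ aₙ s x) (hY : Y ∈ ker a₀ aₙ s x)
    (hθ : fderiv ℝ (focus a₀ aₙ s) x X = θ • a₀ x) :
    lorentz n (fderiv ℝ (fderiv ℝ (focus a₀ aₙ s)) x Z X) (fderiv ℝ a₀ x Y)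
      = θ * lorentz n (fderiv ℝ a₀ x Z) (fderiv ℝ a₀ x Y) := by
  set κ : E → E →L[ℝ] E := focalOp a₀ aₙ s with hκdef
  have hκ : ContDiffAt ℝ ∞ κ x := h.contDiffAt_focalOp hx
  have hker : LinearMap.ker (κ x).toLinearMap = ker a₀ aₙ s x := h.ker_focalOp hx
  have hX' : κ x X = 0 := by
    rw [← hker] at hX
    exact hX
  have hY' : κ x Y = 0 := by
    rw [← hker] at hY
    exact hY
  have hz := inner_fderiv_ker_eq_zero hκ ((h.jet x hx).inner_formOp_symm (s x))
    (h.eventually_finrank_ker_focalOp hx) Z hX' hY'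
  have hv := h.contDiffAt_focus hx
  have hdv : DifferentiableAt ℝ (fderiv ℝ (focus a₀ aₙ s)) x :=
    (hv.fderiv_right (m := 1) (WithTop.coe_le_coe.2 le_top)).differentiableAt (by simp)
  have hd0 : DifferentiableAt ℝ (fderiv ℝ a₀) x :=
    (h.contDiffAt_fderiv_zero hx).differentiableAt (by simp)
  have hdvX : HasFDerivAt (fun y => fderiv ℝ (focus a₀ aₙ s) y X)
      ((ContinuousLinearMap.apply ℝ (LSpace n) X).comp (fderiv ℝ (fderiv ℝ (focus a₀ aₙ s)) x)) x :=
    (ContinuousLinearMap.apply ℝ (LSpace n) X).hasFDerivAt.comp x hdv.hasFDerivAt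
  have hd0Y : HasFDerivAt (fun y => fderiv ℝ a₀ y Y)
      ((ContinuousLinearMap.apply ℝ (LSpace n) Y).comp (fderiv ℝ (fderiv ℝ a₀) x)) x :=
    (ContinuousLinearMap.apply ℝ (LSpace n) Y).hasFDerivAt.comp x hd0.hasFDerivAt
  -- the form `(κ X, Y)` is `(dB X, dA₀ Y)`
  have hform : (fun y => inner ℝ (κ y X) Y) =ᶠ[𝓝 x]
      fun y => lorentz n (fderiv ℝ (focus a₀ aₙ s) y X) (fderiv ℝ a₀ y Y) := by
    filter_upwards [h.mem_nhds hx] with y hy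
    have hα := (h.jet y hy).α_zero Y
    rw [lorentz_comm] at hα
    simp only [ContinuousLinearMap.coe_coe] at hα
    rw [h.fderiv_focus hy]
    simp [κ, focalOp, inner_add_left, real_inner_smul_left, inner_formOp, hα]
  obtain ⟨L, hL, hLZ⟩ := hasFDerivAt_lorentz hdvX.differentiableAt hd0Y.differentiableAt
  have hκX : HasFDerivAt (fun y => κ y X)
      ((ContinuousLinearMap.apply ℝ E X).comp (fderiv ℝ κ x)) x :=
    (ContinuousLinearMap.apply ℝ E X).hasFDerivAt.comp x
      (hκ.differentiableAt (by simp)).hasFDerivAt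
  have h1 := (hform.hasFDerivAt_iff.1 (hκX.inner ℝ (hasFDerivAt_const Y x))).unique hL
  have h2 := DFunLike.congr_fun h1 Z
  rw [hLZ, hdvX.fderiv, hd0Y.fderiv] at h2
  simp only [ContinuousLinearMap.comp_apply, ContinuousLinearMap.prod_apply, fderivInnerCLM_apply,
    zero_apply, inner_zero_right, zero_add, ContinuousLinearMap.apply_apply] at h2
  rw [hz, hθ] at h2
  -- `(A₀, ∂∂A₀) = -(dA₀, dA₀)`
  have h3 := lorentz_fderiv_of_const ((h.smooth_zero x hx).differentiableAt (by simp))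
    hd0Y.differentiableAt (c := 0) (by
      filter_upwards [h.mem_nhds hx] with y hy
      rw [lorentz_comm]
      exact (h.jet y hy).α_zero Y) Z
  rw [hd0Y.fderiv] at h3
  simp only [ContinuousLinearMap.comp_apply, ContinuousLinearMap.apply_apply] at h3
  rw [map_smul, LinearMap.smul_apply, smul_eq_mul] at h2
  linear_combination -h2 - θ * h3

/-- A focus of a constant multiplicity `m ≥ 2` is conic: the form `θ(X) g(Z, Y)` is symmetric in the
singular directions `X`, `Z`, so `θ(X) Z = θ(Z) X`, which is impossible for independent `X`, `Z`
unless `θ = 0`. -/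
theorem fderiv_focus_eq_zero (h : FocalCoord n m a₀ aₙ s Ω) (hm : 2 ≤ m) {x : E} (hx : x ∈ Ω)
    {X : E} (hX : X ∈ ker a₀ aₙ s x) : fderiv ℝ (focus a₀ aₙ s) x X = 0 := by
  obtain ⟨θ, hθ⟩ := Submodule.mem_span_singleton.1 ((h.mem_ker_iff hx).1 hX)
  by_cases hθ0 : θ = 0
  · rw [← hθ, hθ0, zero_smul]
  exfalso
  have hle : finrank ℝ (ker a₀ aₙ s x) ≤ 1 := by
    refine finrank_le_one ⟨X, hX⟩ fun ⟨Z, hZ⟩ => ?_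
    obtain ⟨η, hη⟩ := Submodule.mem_span_singleton.1 ((h.mem_ker_iff hx).1 hZ)
    have hY : θ • Z - η • X ∈ ker a₀ aₙ s x :=
      Submodule.sub_mem _ (Submodule.smul_mem _ _ hZ) (Submodule.smul_mem _ _ hX)
    have e1 := h.lorentz_fderiv_fderiv_focus hx Z hX hY hθ.symm
    have e2 := h.lorentz_fderiv_fderiv_focus hx X hZ hY hη.symm
    have hsymm : fderiv ℝ (fderiv ℝ (focus a₀ aₙ s)) x Z X
        = fderiv ℝ (fderiv ℝ (focus a₀ aₙ s)) x X Z :=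
      ((h.contDiffAt_focus hx).isSymmSndFDerivAt
        (by simpa using (ENat.LEInfty.out : (2 : WithTop ℕ∞) ≤ ∞))) Z X
    rw [hsymm, e2] at e1
    have hz : θ • Z - η • X = 0 := by
      apply (h.jet x hx).g_eq_zero
      simp only [ContinuousLinearMap.coe_coe]
      have hlin : ∀ z, lorentz n (fderiv ℝ a₀ x (θ • Z - η • X)) z
          = θ * lorentz n (fderiv ℝ a₀ x Z) z - η * lorentz n (fderiv ℝ a₀ x X) z := fun z => by
        simp
      rw [hlin, e1, sub_self]
    refine ⟨η / θ, Subtype.ext ?_⟩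
    change (η / θ) • X = Z
    rw [div_eq_inv_mul, mul_smul, ← sub_eq_zero.1 hz, smul_smul, inv_mul_cancel₀ hθ0, one_smul]
  have := h.finrank_ker x hx
  change finrank ℝ (ker a₀ aₙ s x) = m at this
  omega

end

end FocalCoord

/-! ### Foliated coordinates -/

/-- A chart with values in a product can be restricted so that its target is a box. -/
theorem exists_box {E A C : Type*} [TopologicalSpace E] [NormedAddCommGroup A] [NormedSpace ℝ A]
    [NormedAddCommGroup C] [NormedSpace ℝ C] (e : OpenPartialHomeomorph E (A × C)) {x : E}
    (hx : x ∈ e.source) :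
    ∃ (e' : OpenPartialHomeomorph E (A × C)) (r : ℝ), 0 < r ∧ (∀ y, e' y = e y) ∧
      (∀ p, e'.symm p = e.symm p) ∧ x ∈ e'.source ∧ e'.source ⊆ e.source ∧
      e'.target = Metric.ball (e x).1 r ×ˢ Metric.ball (e x).2 r ∧ e'.target ⊆ e.target := by
  obtain ⟨r, hr, hball⟩ := Metric.nhds_basis_ball.mem_iff.1
    (e.open_target.mem_nhds (e.map_source hx))
  rw [← ball_prod_same] at hball
  have ho : IsOpen (Metric.ball (e x).1 r ×ˢ Metric.ball (e x).2 r) :=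
    Metric.isOpen_ball.prod Metric.isOpen_ball
  have ht : (e.symm.restrOpen _ ho).symm.target
      = Metric.ball (e x).1 r ×ˢ Metric.ball (e x).2 r := by
    change e.symm.source ∩ _ = _
    exact inter_eq_right.2 hball
  refine ⟨(e.symm.restrOpen _ ho).symm, r, hr, fun y => rfl, fun p => rfl, ?_, ?_, ht, ?_⟩
  · have hmem : e x ∈ (e.symm.restrOpen _ ho).symm.target := by
      rw [ht]
      exact ⟨Metric.mem_ball_self hr, Metric.mem_ball_self hr⟩
    have := (e.symm.restrOpen _ ho).symm.map_target hmem
    change e.symm (e x) ∈ _ at this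
    rwa [e.left_inv hx] at this
  · intro y hy
    have h1 := (e.symm.restrOpen _ ho).symm.map_source hy
    have h2 := (e.symm.restrOpen _ ho).symm.left_inv hy
    rw [ht] at h1
    change e.symm (e y) = y at h2
    rw [← h2]
    exact e.map_target (hball h1)
  · rw [ht]
    exact hball

/-- The derivatives of a smooth chart and of its inverse are inverse to each other. -/
theorem fderiv_symm_fderiv {E F : Type*} [NormedAddCommGroup E] [NormedSpace ℝ E]
    [NormedAddCommGroup F] [NormedSpace ℝ F] (e : OpenPartialHomeomorph E F)
    (he : ∀ x ∈ e.source, ContDiffAt ℝ ∞ e x) (hs : ∀ y ∈ e.target, ContDiffAt ℝ ∞ e.symm y)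
    {x : E} (hx : x ∈ e.source) (X : E) : fderiv ℝ e.symm (e x) (fderiv ℝ e x X) = X := by
  have h1 : HasFDerivAt (e.symm ∘ e) ((fderiv ℝ e.symm (e x)).comp (fderiv ℝ e x)) x :=
    ((hs _ (e.map_source hx)).differentiableAt (by simp)).hasFDerivAt.comp x
      ((he x hx).differentiableAt (by simp)).hasFDerivAt
  have h2 : (e.symm ∘ e) =ᶠ[𝓝 x] id := by
    filter_upwards [e.open_source.mem_nhds hx] with y hy
    exact e.left_inv hy
  have h3 := (h2.hasFDerivAt_iff.1 h1).unique (hasFDerivAt_id x)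
  exact DFunLike.congr_fun h3 X

theorem fderiv_fderiv_symm {E F : Type*} [NormedAddCommGroup E] [NormedSpace ℝ E]
    [NormedAddCommGroup F] [NormedSpace ℝ F] (e : OpenPartialHomeomorph E F)
    (he : ∀ x ∈ e.source, ContDiffAt ℝ ∞ e x) (hs : ∀ y ∈ e.target, ContDiffAt ℝ ∞ e.symm y)
    {y : F} (hy : y ∈ e.target) (Y : F) : fderiv ℝ e (e.symm y) (fderiv ℝ e.symm y Y) = Y := by
  have := fderiv_symm_fderiv e.symm hs (by simpa using he) hy Y
  simpa using this

theorem fderiv_snd_comp {E A C : Type*} [NormedAddCommGroup E] [NormedSpace ℝ E]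
    [NormedAddCommGroup A] [NormedSpace ℝ A] [NormedAddCommGroup C] [NormedSpace ℝ C]
    {f : E → A × C} {x : E} (hf : DifferentiableAt ℝ f x) (X : E) :
    fderiv ℝ (fun y => (f y).2) x X = (fderiv ℝ f x X).2 := by
  have : HasFDerivAt (fun y => (f y).2) ((ContinuousLinearMap.snd ℝ A C).comp (fderiv ℝ f x)) x :=
    hasFDerivAt_snd.comp x hf.hasFDerivAt
  rw [this.fderiv]
  rfl

/-- The tangent spaces of the plaques of a chart have the dimension of the first factor. -/
theorem finrank_ker_snd {E A C : Type*} [NormedAddCommGroup E] [NormedSpace ℝ E]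
    [NormedAddCommGroup A] [NormedSpace ℝ A] [NormedAddCommGroup C] [NormedSpace ℝ C]
    (e : OpenPartialHomeomorph E (A × C))
    (he : ∀ x ∈ e.source, ContDiffAt ℝ ∞ e x) (hs : ∀ y ∈ e.target, ContDiffAt ℝ ∞ e.symm y)
    {x : E} (hx : x ∈ e.source) :
    finrank ℝ (LinearMap.ker (fderiv ℝ (fun y => (e y).2) x).toLinearMap) = finrank ℝ A := by
  let L : E ≃ₗ[ℝ] A × C :=
    { (fderiv ℝ e x).toLinearMap with
      invFun := fderiv ℝ e.symm (e x)
      left_inv := fun X => fderiv_symm_fderiv e he hs hx X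
      right_inv := fun Y => by
        have := fderiv_fderiv_symm e he hs (e.map_source hx) Y
        rwa [e.left_inv hx] at this }
  have h1 : LinearMap.ker (fderiv ℝ (fun y => (e y).2) x).toLinearMap
      = (LinearMap.ker (LinearMap.snd ℝ A C)).comap L.toLinearMap := by
    ext X
    change fderiv ℝ (fun y => (e y).2) x X = 0 ↔ (fderiv ℝ e x X).2 = 0
    rw [fderiv_snd_comp ((he x hx).differentiableAt (by simp))]
  rw [h1, finrank_comap_equiv, LinearMap.ker_snd,
    LinearMap.finrank_range_of_inj LinearMap.inl_injective]

/-! ### Maps of constant rank -/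

section ConstantRank

variable {E F : Type*} [NormedAddCommGroup E] [NormedSpace ℝ E] [FiniteDimensional ℝ E]
  [NormedAddCommGroup F] [NormedSpace ℝ F] [FiniteDimensional ℝ F]

/-- A subspace of dimension `k` admits linear coordinates that are defined on the whole space. -/
theorem exists_coordinates {k : ℕ} (K : Submodule ℝ F) (hK : finrank ℝ K = k) :
    ∃ q : F →L[ℝ] EuclideanSpace ℝ (Fin k), ∀ X ∈ K, q X = 0 → X = 0 := by
  let i : K ≃ₗ[ℝ] EuclideanSpace ℝ (Fin k) := LinearEquiv.ofFinrankEq _ _ (by simp [hK])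
  obtain ⟨g, hg⟩ := LinearMap.exists_leftInverse_of_injective
    (K.subtype ∘ₗ i.symm.toLinearMap)
    (LinearMap.ker_eq_bot.2 (K.injective_subtype.comp i.symm.injective))
  refine ⟨LinearMap.toContinuousLinearMap g, fun X hX h0 => ?_⟩
  have := LinearMap.congr_fun hg (i ⟨X, hX⟩)
  simp only [LinearMap.comp_apply, LinearEquiv.coe_coe, LinearEquiv.symm_apply_apply,
    Submodule.subtype_apply, LinearMap.id_apply] at this
  change g X = 0 at h0
  rw [h0] at this
  have h2 := i.symm.map_zero
  rw [this, i.symm_apply_apply] at h2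
  exact congrArg Subtype.val h2

/-- The constant rank theorem: a map whose differentials have kernels of the constant dimension
`m` is constant on the plaques of a chart tangent to these kernels, and the transversal coordinates
of this chart are linear functions of the value of the map. -/
theorem exists_constantRank_chart {v : E → F} {Ω : Set E} (hΩ : IsOpen Ω)
    (hv : ∀ x ∈ Ω, ContDiffAt ℝ ∞ v x) {m c : ℕ} (hd : finrank ℝ E = m + c)
    (hk : ∀ x ∈ Ω, finrank ℝ (LinearMap.ker (fderiv ℝ v x).toLinearMap) = m)
    {x₀ : E} (hx₀ : x₀ ∈ Ω) :
    ∃ (e : OpenPartialHomeomorph E (EuclideanSpace ℝ (Fin m) × EuclideanSpace ℝ (Fin c)))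
      (π : F →L[ℝ] EuclideanSpace ℝ (Fin c)) (r : ℝ), 0 < r ∧ x₀ ∈ e.source ∧ e.source ⊆ Ω ∧
      e.target = Metric.ball (e x₀).1 r ×ˢ Metric.ball (e x₀).2 r ∧
      (∀ x ∈ e.source, ContDiffAt ℝ ∞ e x) ∧ (∀ p ∈ e.target, ContDiffAt ℝ ∞ e.symm p) ∧
      (∀ x, (e x).2 = π (v x)) ∧
      (∀ x ∈ e.source, LinearMap.ker (fderiv ℝ (fun y => (e y).2) x).toLinearMap
        = LinearMap.ker (fderiv ℝ v x).toLinearMap) ∧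
      ∀ x ∈ e.source, ∀ y ∈ e.source, (e x).2 = (e y).2 → v x = v y := by
  obtain ⟨q, hq⟩ := exists_coordinates _ (hk x₀ hx₀)
  obtain ⟨π, hπ⟩ := exists_coordinates (k := c) (LinearMap.range (fderiv ℝ v x₀).toLinearMap) (by
    have := LinearMap.finrank_range_add_finrank_ker (fderiv ℝ v x₀).toLinearMap
    rw [hk x₀ hx₀] at this
    omega)
  let f : E → EuclideanSpace ℝ (Fin m) × EuclideanSpace ℝ (Fin c) := fun x => (q x, π (v x))
  have hf : ∀ x ∈ Ω, ContDiffAt ℝ ∞ f x := fun x hx =>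
    q.contDiff.contDiffAt.prodMk (π.contDiff.contDiffAt.comp x (hv x hx))
  have hfd : ∀ x ∈ Ω, ∀ X, fderiv ℝ f x X = (q X, π (fderiv ℝ v x X)) := by
    intro x hx X
    have h1 : HasFDerivAt f (q.prod (π.comp (fderiv ℝ v x))) x :=
      q.hasFDerivAt.prodMk
        (π.hasFDerivAt.comp x ((hv x hx).differentiableAt (by simp)).hasFDerivAt)
    rw [h1.fderiv]
    rfl
  obtain ⟨e₁, he₁, hx₁, hs₁, hsm₁, hsymm₁⟩ := exists_localDiffeo_of_injective
    (hΩ.mem_nhds hx₀) (eventually_of_mem (hΩ.mem_nhds hx₀) hf) (by simp [hd]) (by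
      intro X hX
      rw [hfd x₀ hx₀, Prod.mk_eq_zero] at hX
      exact hq X (hπ _ ⟨X, rfl⟩ hX.2) hX.1)
  obtain ⟨e, r, hr, he, hes, hx, hs, ht, htt⟩ := exists_box e₁ hx₁
  have hef : (e : E → _) = f := funext fun x => (he x).trans (he₁ x)
  have hsm : ∀ x ∈ e.source, ContDiffAt ℝ ∞ e x := fun x hx => by
    rw [hef]
    exact hsm₁ x (hs hx)
  have hsymm : ∀ p ∈ e.target, ContDiffAt ℝ ∞ e.symm p := fun p hp => by
    have : (e.symm : _ → E) = e₁.symm := funext hes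
    rw [this]
    exact hsymm₁ p (htt hp)
  have hker : ∀ x ∈ e.source, LinearMap.ker (fderiv ℝ (fun y => (e y).2) x).toLinearMap
      = LinearMap.ker (fderiv ℝ v x).toLinearMap := by
    intro x hx
    symm
    refine Submodule.eq_of_le_of_finrank_eq (fun X hX => ?_) ?_
    · change fderiv ℝ v x X = 0 at hX
      change fderiv ℝ (fun y => (e y).2) x X = 0
      rw [fderiv_snd_comp ((hsm x hx).differentiableAt (by simp)), hef, hfd x (hs₁ (hs hx)), hX,
        map_zero]
    · rw [hk x (hs₁ (hs hx)), finrank_ker_snd e hsm hsymm hx]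
      simp
  refine ⟨e, π, r, hr, hx, hs.trans hs₁, ?_, hsm, hsymm, fun x => by rw [hef], hker, ?_⟩
  · rw [ht, he₁, hef]
  intro x hx y hy hxy
  have hxt := e.map_source hx
  have hyt := e.map_source hy
  rw [ht] at hxt hyt
  have hmem : ∀ p ∈ Metric.ball (e₁ x₀).1 r, (p, (e x).2) ∈ e.target := fun p hp => by
    rw [ht]
    exact ⟨hp, hxt.2⟩
  have hderiv : ∀ p ∈ Metric.ball (e₁ x₀).1 r,
      HasFDerivAt (fun p => v (e.symm (p, (e x).2)))
        (0 : EuclideanSpace ℝ (Fin m) →L[ℝ] F) p := by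
    intro p hp
    have h1 := ((hsymm _ (hmem p hp)).differentiableAt (by simp)).hasFDerivAt
    have h2 := ((hv _ (hs₁ (hs (e.map_target (hmem p hp))))).differentiableAt (by simp)).hasFDerivAt
    have h3 : HasFDerivAt (fun p => v (e.symm (p, (e x).2))) _ p :=
      h2.comp p (h1.comp p ((hasFDerivAt_id p).prodMk (hasFDerivAt_const (e x).2 p)))
    refine h3.congr_fderiv (ContinuousLinearMap.ext fun X => ?_)
    have h4 : fderiv ℝ e.symm (p, (e x).2) (X, 0)
        ∈ LinearMap.ker (fderiv ℝ v (e.symm (p, (e x).2))).toLinearMap := by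
      rw [← hker _ (e.map_target (hmem p hp))]
      change fderiv ℝ (fun y => (e y).2) _ _ = 0
      rw [fderiv_snd_comp ((hsm _ (e.map_target (hmem p hp))).differentiableAt (by simp)),
        fderiv_fderiv_symm e hsm hsymm (hmem p hp)]
    exact h4
  have := Metric.isOpen_ball.is_const_of_fderiv_eq_zero (𝕜 := ℝ)
    (f := fun p => v (e.symm (p, (e x).2)))
    (convex_ball (e₁ x₀).1 r).isPreconnected
    (fun p hp => (hderiv p hp).differentiableAt.differentiableWithinAt)
    (fun p hp => (hderiv p hp).fderiv) hxt.1 hyt.1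
  rw [show ((e x).1, (e x).2) = e x from rfl, e.left_inv hx, hxy,
    show ((e y).1, (e y).2) = e y from rfl, e.left_inv hy] at this
  exact this

end ConstantRank

/-! ### Spheres and second-order cones -/

theorem lorentz_nondegenerate (n : ℕ) : (lorentz n).Nondegenerate :=
  ⟨fun _ h => eq_zero_of_lorentz_eq_zero h,
    fun x h => eq_zero_of_lorentz_eq_zero fun y => by rw [lorentz_comm]; exact h y⟩

/-- The polar subspace of a spacelike subspace, which is spanned by `b` and by the image of `T`. -/
theorem exists_polar {n c : ℕ} {b : LSpace n} {T : EuclideanSpace ℝ (Fin c) →ₗ[ℝ] LSpace n}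
    (hpos : ∀ (a : ℝ) (z : EuclideanSpace ℝ (Fin c)), (a ≠ 0 ∨ z ≠ 0) →
      0 < lorentz n (a • b + T z) (a • b + T z)) :
    ∃ S : Submodule ℝ (LSpace n), finrank ℝ S + (c + 1) = n + 2 ∧
      (∀ z, z ∈ S ↔ lorentz n z b = 0 ∧ ∀ w, lorentz n z (T w) = 0) ∧
      ∀ z ∈ S, (∀ w ∈ S, lorentz n z w = 0) → z = 0 := by
  let R : ℝ × EuclideanSpace ℝ (Fin c) →ₗ[ℝ] LSpace n :=
    (LinearMap.toSpanSingleton ℝ _ b).coprod T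
  have hR : ∀ p, R p = p.1 • b + T p.2 := fun p => rfl
  have hinj : Function.Injective R := by
    rw [← LinearMap.ker_eq_bot, LinearMap.ker_eq_bot']
    intro p hp
    by_contra hne
    have h1 : p.1 ≠ 0 ∨ p.2 ≠ 0 := by
      by_contra! hcon
      exact hne (Prod.ext hcon.1 hcon.2)
    have := hpos p.1 p.2 h1
    rw [← hR, hp] at this
    simp at this
  have hrefl : (lorentz n).IsRefl := fun x y h => by rw [lorentz_comm]; exact h
  have hW : finrank ℝ (LinearMap.range R) = c + 1 := by
    rw [LinearMap.finrank_range_of_inj hinj]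
    simp [add_comm]
  have hle : finrank ℝ (LinearMap.range R) ≤ n + 2 := by
    simpa using Submodule.finrank_le (LinearMap.range R)
  have hmem : ∀ z, z ∈ (lorentz n).orthogonal (LinearMap.range R) ↔
      lorentz n z b = 0 ∧ ∀ w, lorentz n z (T w) = 0 := by
    intro z
    rw [LinearMap.BilinForm.mem_orthogonal_iff]
    constructor
    · intro h
      refine ⟨?_, fun w => ?_⟩
      · rw [lorentz_comm]
        exact h b ⟨(1, 0), by simp [hR]⟩
      · rw [lorentz_comm]
        exact h (T w) ⟨(0, w), by simp [hR]⟩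
    · rintro ⟨h1, h2⟩ _ ⟨p, rfl⟩
      rw [lorentz_comm, hR]
      simp [h1, h2]
  refine ⟨(lorentz n).orthogonal (LinearMap.range R), ?_, hmem, fun z hz h => ?_⟩
  · rw [LinearMap.BilinForm.finrank_orthogonal (lorentz_nondegenerate n), hW]
    simp only [finrank_fintype_fun_eq_card, Fintype.card_fin]
    omega
  · have h1 : z ∈ (lorentz n).orthogonal ((lorentz n).orthogonal (LinearMap.range R)) := by
      rw [LinearMap.BilinForm.mem_orthogonal_iff]
      intro w hw
      rw [lorentz_comm]
      exact h w hw
    rw [LinearMap.BilinForm.orthogonal_orthogonal (lorentz_nondegenerate n) hrefl] at h1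
    obtain ⟨p, rfl⟩ := h1
    rw [hmem] at hz
    by_contra hne
    have h2 : p.1 ≠ 0 ∨ p.2 ≠ 0 := by
      by_contra! hcon
      exact hne (by rw [hR, hcon.1, hcon.2]; simp)
    have h3 := hpos p.1 p.2 h2
    rw [← hR] at h3
    have h4 : lorentz n (R p) (R p) = p.1 * lorentz n (R p) b + lorentz n (R p) (T p.2) := by
      conv_lhs => rw [hR p, map_add, map_smul, ← hR p]
      rfl
    rw [h4, hz.1, hz.2] at h3
    simp at h3

/-- An immersed family `γ` of points of the section of the absolute quadric by the subspace `S`,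
with as many parameters as the dimension of this section, sweeps out an open part of it: near a
point of the family every vector of `S` is `d γ(a) + e h` with a fixed vector `h`, and it is null
only if `e = 0`. -/
theorem eventually_mem_span_of_null {n : ℕ} {A : Type*} [NormedAddCommGroup A] [NormedSpace ℝ A]
    [FiniteDimensional ℝ A] {S : Submodule ℝ (LSpace n)} (hS : finrank ℝ S = finrank ℝ A + 2)
    (hnd : ∀ z ∈ S, (∀ w ∈ S, lorentz n z w = 0) → z = 0) {γ : A → LSpace n} {D : Set A}
    (hD : IsOpen D) (hγ : ∀ a ∈ D, ContDiffAt ℝ ∞ γ a) (hγS : ∀ a ∈ D, γ a ∈ S)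
    (hnull : ∀ a ∈ D, lorentz n (γ a) (γ a) = 0) (hne : ∀ a ∈ D, γ a ≠ 0)
    (hinj : ∀ a ∈ D, ∀ X, fderiv ℝ γ a X ∈ ℝ ∙ γ a → X = 0) {a : A} (ha : a ∈ D)
    {x : LSpace n} (hx : x ∈ ℝ ∙ γ a) (hx0 : x ≠ 0) :
    ∀ᶠ z in 𝓝 x, z ∈ S → lorentz n z z = 0 → ∃ a' ∈ D, z ∈ ℝ ∙ γ a' := by
  obtain ⟨k, rfl⟩ := Submodule.mem_span_singleton.1 hx
  have hk : k ≠ 0 := fun h => hx0 (by rw [h, zero_smul])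
  obtain ⟨h, hhS, hh⟩ : ∃ h ∈ S, lorentz n (γ a) h ≠ 0 := by
    by_contra! hcon
    exact hne a ha (hnd _ (hγS a ha) hcon)
  obtain ⟨p₀, hp₀⟩ := LinearMap.exists_leftInverse_of_injective S.subtype (by simp)
  let p : LSpace n →L[ℝ] S := LinearMap.toContinuousLinearMap p₀
  have hp : ∀ z ∈ S, (p z : LSpace n) = z := fun z hz =>
    congrArg Subtype.val (LinearMap.congr_fun hp₀ ⟨z, hz⟩)
  let Ψ : A × ℝ × ℝ → LSpace n := fun y => y.2.1 • γ y.1 + y.2.2 • h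
  have hΨ : ∀ y : A × ℝ × ℝ, y.1 ∈ D → ContDiffAt ℝ ∞ Ψ y := fun y hy =>
    (contDiff_snd.fst.contDiffAt.smul ((hγ y.1 hy).comp y contDiff_fst.contDiffAt)).add
      (contDiff_snd.snd.contDiffAt.smul contDiffAt_const)
  have hΨd : ∀ X : A × ℝ × ℝ, fderiv ℝ Ψ (a, k, 0) X
      = k • fderiv ℝ γ a X.1 + X.2.1 • γ a + X.2.2 • h := by
    intro X
    have h1 : HasFDerivAt (fun y : A × ℝ × ℝ => γ y.1)
        ((fderiv ℝ γ a).comp (ContinuousLinearMap.fst ℝ A (ℝ × ℝ))) (a, k, 0) :=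
      HasFDerivAt.comp (a, k, 0)
        (((hγ a ha).differentiableAt (by simp)).hasFDerivAt) hasFDerivAt_fst
    have h2 : HasFDerivAt (fun y : A × ℝ × ℝ => y.2.1)
        ((ContinuousLinearMap.fst ℝ ℝ ℝ).comp (ContinuousLinearMap.snd ℝ A (ℝ × ℝ)))
        (a, k, 0) := ((ContinuousLinearMap.fst ℝ ℝ ℝ).comp
          (ContinuousLinearMap.snd ℝ A (ℝ × ℝ))).hasFDerivAt
    have h3 : HasFDerivAt (fun y : A × ℝ × ℝ => y.2.2)
        ((ContinuousLinearMap.snd ℝ ℝ ℝ).comp (ContinuousLinearMap.snd ℝ A (ℝ × ℝ)))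
        (a, k, 0) := ((ContinuousLinearMap.snd ℝ ℝ ℝ).comp
          (ContinuousLinearMap.snd ℝ A (ℝ × ℝ))).hasFDerivAt
    have h4 : HasFDerivAt Ψ _ (a, k, 0) := (h2.smul h1).add (h3.smul_const h)
    rw [h4.fderiv]
    simp
  have hdS : ∀ X, fderiv ℝ γ a X ∈ S := by
    intro X
    have h1 : HasFDerivAt (fun a' => (p (γ a') : LSpace n))
        ((S.subtypeL.comp p).comp (fderiv ℝ γ a)) a :=
      (S.subtypeL.comp p).hasFDerivAt.comp a ((hγ a ha).differentiableAt (by simp)).hasFDerivAt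
    have h2 : (fun a' => (p (γ a') : LSpace n)) =ᶠ[𝓝 a] γ := by
      filter_upwards [hD.mem_nhds ha] with a' ha'
      exact hp _ (hγS a' ha')
    rw [(h2.hasFDerivAt_iff.1 h1).fderiv]
    exact (p (fderiv ℝ γ a X)).2
  have hdγ : ∀ X, lorentz n (fderiv ℝ γ a X) (γ a) = 0 := by
    intro X
    have hd := (hγ a ha).differentiableAt (n := ∞) (by simp)
    have := lorentz_fderiv_of_const hd hd (c := 0) (by
      filter_upwards [hD.mem_nhds ha] with y hy
      exact hnull y hy) X
    rw [lorentz_comm (γ a)] at this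
    linarith
  -- where this number does not vanish, `d γ(a') + e h` is null only if `e = 0`
  let O : Set (A × ℝ × ℝ) :=
    {y | y.1 ∈ D ∧ 2 * y.2.1 * lorentz n (γ y.1) h + y.2.2 * lorentz n h h ≠ 0}
  have hO : O ∈ 𝓝 (a, k, (0 : ℝ)) := by
    have hc : ContinuousAt (fun y : A × ℝ × ℝ =>
        2 * y.2.1 * lorentz n (γ y.1) h + y.2.2 * lorentz n h h) (a, k, 0) := by
      have h1 : ContinuousAt (fun y : A × ℝ × ℝ => lorentzL n (γ y.1) h) (a, k, 0) :=
        ((lorentzL n).flip h).continuous.continuousAt.comp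
          (((hγ a ha).continuousAt).comp (x := (a, k, (0 : ℝ))) continuous_fst.continuousAt)
      simp only [lorentzL_apply] at h1
      fun_prop
    have h0 : 2 * k * lorentz n (γ a) h + 0 * lorentz n h h ≠ 0 := by
      simp [hk, hh]
    filter_upwards [hc.eventually_ne h0,
      continuous_fst.continuousAt.eventually (hD.mem_nhds ha)] with y h1 h2
    exact ⟨h2, h1⟩
  obtain ⟨e, he, hae, heO, -, -⟩ := exists_localDiffeo_of_injective (f := fun y => p (Ψ y))
    (a := (a, k, 0)) hO (by
      filter_upwards [hO] with y hy
      exact p.contDiff.contDiffAt.comp y (hΨ y hy.1)) (by simp [hS]) (by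
      intro X hX
      have h1 : HasFDerivAt (fun y => p (Ψ y)) (p.comp (fderiv ℝ Ψ (a, k, 0))) (a, k, 0) :=
        p.hasFDerivAt.comp _ ((hΨ (a, k, 0) ha).differentiableAt (by simp)).hasFDerivAt
      rw [h1.fderiv] at hX
      change p (fderiv ℝ Ψ (a, k, 0) X) = 0 at hX
      have h2 : k • fderiv ℝ γ a X.1 + X.2.1 • γ a + X.2.2 • h ∈ S :=
        S.add_mem (S.add_mem (S.smul_mem _ (hdS _)) (S.smul_mem _ (hγS a ha))) (S.smul_mem _ hhS)
      rw [hΨd] at hX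
      have h3 := hp _ h2
      rw [hX] at h3
      have h4 : X.2.2 = 0 := by
        have h5 := congrArg (lorentz n (γ a)) h3
        have h6 := hdγ X.1
        rw [lorentz_comm] at h6
        simp [h6, hnull a ha, hh] at h5
        exact h5
      rw [h4, zero_smul, add_zero] at h3
      have h5 : X.1 = 0 := by
        apply hinj a ha
        refine Submodule.mem_span_singleton.2 ⟨-(k⁻¹ * X.2.1), ?_⟩
        have h6 : k • fderiv ℝ γ a X.1 = -(X.2.1 • γ a) :=
          eq_neg_of_add_eq_zero_left h3.symm
        rw [neg_smul, mul_smul, ← smul_neg, ← h6, smul_smul, inv_mul_cancel₀ hk, one_smul]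
      rw [h5, map_zero, smul_zero, zero_add] at h3
      have h6 : X.2.1 = 0 := (smul_eq_zero.1 h3.symm).resolve_right (hne a ha)
      exact Prod.ext h5 (Prod.ext h6 h4))
  have hpx : p (k • γ a) ∈ e.target := by
    have := e.map_source hae
    rw [he] at this
    simpa [Ψ] using this
  filter_upwards [p.continuous.continuousAt.eventually (e.open_target.mem_nhds hpx)]
    with z hz hzS hzz
  have h1 := e.map_target hz
  have h2 := e.right_inv hz
  obtain ⟨hyD, hy⟩ := heO h1
  set y := e.symm (p z) with hydef
  rw [he] at h2
  have h3 : Ψ y = z := by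
    rw [← hp z hzS, ← h2]
    exact (hp _ (S.add_mem (S.smul_mem _ (hγS _ hyD)) (S.smul_mem _ hhS))).symm
  have h4 : y.2.2 = 0 := by
    have h5 : lorentz n (Ψ y) (Ψ y) = y.2.2 *
        (2 * y.2.1 * lorentz n (γ y.1) h + y.2.2 * lorentz n h h) := by
      simp only [Ψ, map_add, map_smul, LinearMap.add_apply, LinearMap.smul_apply, smul_eq_mul,
        hnull y.1 hyD, lorentz_comm h (γ y.1)]
      ring
    rw [h3, hzz] at h5
    exact (mul_eq_zero.1 h5.symm).resolve_right hy
  refine ⟨y.1, hyD, Submodule.mem_span_singleton.2 ⟨y.2.1, ?_⟩⟩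
  rw [← h3]
  simp [Ψ, h4]

section Cones

variable {n : ℕ} {M : Type*}

theorem IsSphericalGenerator.comp {M' : Type*} {gen : M → Submodule ℝ (LSpace n)} {P : Set M}
    {b : LSpace n} {m : ℕ} (h : IsSphericalGenerator gen P b m)
    {gen' : M' → Submodule ℝ (LSpace n)} {P' : Set M'} {f : M' → M} (hf : f '' P' = P)
    (hgen : ∀ u ∈ P', gen' u = gen (f u)) : IsSphericalGenerator gen' P' b m := by
  subst hf
  obtain ⟨S, h1, h2, h3, h4⟩ := h
  refine ⟨S, h1, h2, h3, fun u hu x hx hx0 hxx => ?_⟩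
  rw [hgen u hu] at hx
  obtain ⟨h5, h6⟩ := h4 (f u) ⟨u, hu, rfl⟩ x hx hx0 hxx
  refine ⟨h5, h6.mono fun z hz hzS hzz => ?_⟩
  obtain ⟨_, ⟨w, hw, rfl⟩, hzw⟩ := hz hzS hzz
  exact ⟨w, hw, by rwa [hgen w hw]⟩

theorem SweepsQuadraticCone.comp {M' : Type*} {gen : M → Submodule ℝ (LSpace n)} {P : Set M}
    {b : LSpace n} {d : ℕ} (h : SweepsQuadraticCone gen P b d)
    {gen' : M' → Submodule ℝ (LSpace n)} {P' : Set M'} {f : M' → M} (hf : f '' P' = P)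
    (hgen : ∀ u ∈ P', gen' u = gen (f u)) : SweepsQuadraticCone gen' P' b d := by
  subst hf
  obtain ⟨S, ψ, h1, h2, h3, h4, h5, h6⟩ := h
  refine ⟨S, ψ, h1, h2, h3, h4, fun u hu => ?_, fun u hu x hx hxb => ?_⟩
  · rw [hgen u hu]
    exact h5 (f u) ⟨u, hu, rfl⟩
  · rw [hgen u hu] at hx
    refine (h6 (f u) ⟨u, hu, rfl⟩ x hx hxb).mono fun z hz hzS hzz => ?_
    obtain ⟨_, ⟨w, hw, rfl⟩, hzw⟩ := hz hzS hzz
    exact ⟨w, hw, by rwa [hgen w hw]⟩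

/-- Lines that join a point `b` with the points of an immersed family on the absolute quadric, polar
to `b` and to the subspace spanned by `T`, with as many parameters as possible, touch the quadric
along an open part of a sphere and sweep out an open part of the cone over this sphere with the
vertex `b`. -/
theorem isSphericalGenerator_and_sweepsQuadraticCone {gen : M → Submodule ℝ (LSpace n)} {P : Set M}
    {c : ℕ} {b : LSpace n} {T : EuclideanSpace ℝ (Fin c) →ₗ[ℝ] LSpace n}
    (hb : lorentz n b b = 1)
    (hpos : ∀ (a : ℝ) (z : EuclideanSpace ℝ (Fin c)), (a ≠ 0 ∨ z ≠ 0) →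
      0 < lorentz n (a • b + T z) (a • b + T z))
    {A : Type*} [NormedAddCommGroup A] [NormedSpace ℝ A] [FiniteDimensional ℝ A]
    (hdim : finrank ℝ A + (c + 1) = n) {γ : A → LSpace n} {D : Set A}
    (hD : IsOpen D) (hDne : D.Nonempty) (hγ : ∀ a ∈ D, ContDiffAt ℝ ∞ γ a)
    (hnull : ∀ a ∈ D, lorentz n (γ a) (γ a) = 0) (hne : ∀ a ∈ D, γ a ≠ 0)
    (hinj : ∀ a ∈ D, ∀ X, fderiv ℝ γ a X ∈ ℝ ∙ γ a → X = 0)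
    (hγb : ∀ a ∈ D, lorentz n (γ a) b = 0) (hγT : ∀ a ∈ D, ∀ z, lorentz n (γ a) (T z) = 0)
    (hP : ∀ u ∈ P, ∃ a ∈ D, gen u = Submodule.span ℝ {γ a, b})
    (hPD : ∀ a ∈ D, ∃ u ∈ P, gen u = Submodule.span ℝ {γ a, b}) :
    IsSphericalGenerator gen P b (finrank ℝ A) ∧
      SweepsQuadraticCone gen P b (finrank ℝ A + 1) := by
  obtain ⟨S, hSd, hSm, hnd⟩ := exists_polar hpos
  have hS : finrank ℝ S = finrank ℝ A + 2 := by omega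
  have hγS : ∀ a ∈ D, γ a ∈ S := fun a ha => (hSm _).2 ⟨hγb a ha, hγT a ha⟩
  have hSb : ∀ z ∈ S, lorentz n z b = 0 := fun z hz => ((hSm z).1 hz).1
  have hsweep := fun {a : A} (ha : a ∈ D) {x : LSpace n} =>
    eventually_mem_span_of_null (x := x) hS hnd hD hγ hγS hnull hne hinj ha
  have hbne : b ≠ 0 := by
    rintro rfl
    simp at hb
  have hbS : b ∉ S := fun h => by
    have := hSb b h
    rw [hb] at this
    exact one_ne_zero this
  have hγb' : ∀ a ∈ D, lorentz n b (γ a) = 0 := fun a ha => by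
    rw [lorentz_comm]
    exact hγb a ha
  constructor
  · refine ⟨S, hS, ?_, hSb, fun u hu x hx hx0 hxx => ?_⟩
    · obtain ⟨a, ha⟩ := hDne
      obtain ⟨h, hhS, hh⟩ : ∃ h ∈ S, lorentz n (γ a) h ≠ 0 := by
        by_contra! hcon
        exact hne a ha (hnd _ (hγS a ha) hcon)
      -- this multiple of `γ a` makes the square equal to `-1`
      refine ⟨h + (-(lorentz n h h + 1) / (2 * lorentz n (γ a) h)) • γ a,
        S.add_mem hhS (S.smul_mem _ (hγS a ha)), ?_⟩
      simp only [map_add, map_smul, LinearMap.add_apply, LinearMap.smul_apply, smul_eq_mul,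
        hnull a ha, lorentz_comm h (γ a)]
      have h1 : -(lorentz n h h + 1) / (2 * lorentz n (γ a) h) * lorentz n (γ a) h
          = -(lorentz n h h + 1) / 2 := by
        field_simp
      rw [h1]
      linarith
    · obtain ⟨a, ha, hgen⟩ := hP u hu
      rw [hgen] at hx
      obtain ⟨k, j, rfl⟩ := Submodule.mem_span_pair.1 hx
      have hj : j = 0 := by
        simp [hnull a ha, hγb a ha, hγb' a ha, hb] at hxx
        exact hxx
      subst hj
      rw [zero_smul, add_zero] at hx0 ⊢
      refine ⟨S.smul_mem _ (hγS a ha), ?_⟩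
      refine (hsweep ha (Submodule.smul_mem _ _ (Submodule.mem_span_singleton_self _))
        hx0).mono fun z hz hzS hzz => ?_
      obtain ⟨a', ha', hza⟩ := hz hzS hzz
      obtain ⟨w, hw, hgw⟩ := hPD a' ha'
      exact ⟨w, hw, hgw ▸ Submodule.span_mono (by simp) hza⟩
  · -- the cone consists of the vectors whose projections to `S` are null
    let ψ : QuadraticForm ℝ (LSpace n) := (lorentz n).toQuadraticMap
      - QuadraticMap.sq.comp ((lorentz n) b)
    have hψ : ∀ z, ψ z = lorentz n z z - lorentz n b z * lorentz n b z := fun z => rfl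
    have hpolar : ∀ x z, QuadraticMap.polar ψ x z
        = 2 * (lorentz n (x - lorentz n b x • b) z) := by
      intro x z
      rw [QuadraticMap.polar, hψ, hψ, hψ]
      simp only [map_add, map_sub, map_smul, LinearMap.add_apply, LinearMap.sub_apply,
        LinearMap.smul_apply, smul_eq_mul, lorentz_comm z x]
      ring
    have hE : ∀ z, z ∈ S ⊔ ℝ ∙ b ↔ z - lorentz n b z • b ∈ S := by
      intro z
      constructor
      · intro hz
        obtain ⟨w, hw, _, hy, rfl⟩ := Submodule.mem_sup.1 hz
        obtain ⟨t, rfl⟩ := Submodule.mem_span_singleton.1 hy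
        have h1 : lorentz n b w = 0 := by
          rw [lorentz_comm]
          exact hSb w hw
        simpa [h1, hb] using hw
      · intro hz
        rw [← sub_add_cancel z (lorentz n b z • b)]
        exact Submodule.add_mem_sup hz
          (Submodule.smul_mem _ _ (Submodule.mem_span_singleton_self _))
    refine ⟨S ⊔ ℝ ∙ b, ψ, ?_, hbne,
      (le_sup_right : ℝ ∙ b ≤ S ⊔ ℝ ∙ b) (Submodule.mem_span_singleton_self b), ?_, ?_, ?_⟩
    · have h1 := Submodule.finrank_sup_add_finrank_inf_eq S (ℝ ∙ b)
      have h2 : S ⊓ ℝ ∙ b = ⊥ := by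
        rw [Submodule.eq_bot_iff]
        rintro z ⟨hz, hzb⟩
        obtain ⟨t, rfl⟩ := Submodule.mem_span_singleton.1 hzb
        have := hSb _ hz
        simp [hb] at this
        rw [this, zero_smul]
      rw [h2, finrank_bot, finrank_span_singleton hbne, hS] at h1
      omega
    · intro x hx
      constructor
      · intro h
        have h1 := hnd _ ((hE x).1 hx) fun w hw => by
          have := h w ((le_sup_left : S ≤ S ⊔ ℝ ∙ b) hw)
          rw [hpolar] at this
          linarith
        rw [sub_eq_zero.1 h1]
        exact Submodule.smul_mem _ _ (Submodule.mem_span_singleton_self _)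
      · intro h z _
        obtain ⟨t, rfl⟩ := Submodule.mem_span_singleton.1 h
        rw [hpolar]
        simp [hb]
    · intro u hu
      obtain ⟨a, ha, hgen⟩ := hP u hu
      rw [hgen]
      refine ⟨Submodule.subset_span (by simp), fun x hx => ?_⟩
      obtain ⟨k, j, rfl⟩ := Submodule.mem_span_pair.1 hx
      constructor
      · exact Submodule.add_mem_sup (S.smul_mem _ (hγS a ha))
          (Submodule.smul_mem _ _ (Submodule.mem_span_singleton_self _))
      · rw [hψ]
        simp [hnull a ha, hγb a ha, hγb' a ha, hb]
    · intro u hu x hx hxb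
      obtain ⟨a, ha, hgen⟩ := hP u hu
      rw [hgen] at hx
      obtain ⟨k, j, rfl⟩ := Submodule.mem_span_pair.1 hx
      have hk : k • γ a ≠ 0 := by
        intro hk
        rw [hk, zero_add] at hxb
        exact hxb (Submodule.smul_mem _ _ (Submodule.mem_span_singleton_self _))
      have hc : Continuous fun z : LSpace n => z - lorentz n b z • b :=
        continuous_id.sub ((lorentzL n b).continuous.smul continuous_const)
      have hx' : k • γ a + j • b - lorentz n b (k • γ a + j • b) • b = k • γ a := by
        simp [hγb' a ha, hb]
      have h1 := hsweep ha (Submodule.smul_mem _ k (Submodule.mem_span_singleton_self _)) hk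
      rw [← hx'] at h1
      refine (hc.continuousAt.eventually h1).mono fun z hz hzE hzz => ?_
      obtain ⟨a', ha', hza⟩ := hz ((hE z).1 hzE) (by
        rw [hψ] at hzz
        simp only [map_sub, map_smul, LinearMap.sub_apply, LinearMap.smul_apply, smul_eq_mul, hb,
          lorentz_comm z b]
        linarith)
      obtain ⟨w, hw, hgw⟩ := hPD a' ha'
      refine ⟨w, hw, ?_⟩
      rw [hgw, ← sub_add_cancel z (lorentz n b z • b)]
      exact Submodule.add_mem _ (Submodule.span_mono (by simp) hza)
        (Submodule.smul_mem _ _ (Submodule.subset_span (by simp)))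

end Cones

namespace FocalCoord

variable {n m : ℕ} {E : Type*} [NormedAddCommGroup E] [NormedSpace ℝ E]
  [FiniteDimensional ℝ E] {a₀ aₙ : E → LSpace n} {s : E → ℝ} {Ω : Set E}

/-- If the foci are conic, the field of foci has constant rank: it is constant along the leaves
of the singular directions, it describes a spacelike submanifold, and the generators along a leaf
form a cone over a sphere. -/
theorem exists_conicChart (h : FocalCoord n m a₀ aₙ s Ω)
    (hc : ∀ x ∈ Ω, ∀ X ∈ ker a₀ aₙ s x, fderiv ℝ (focus a₀ aₙ s) x X = 0) {x₀ : E}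
    (hx₀ : x₀ ∈ Ω) :
    ∃ (e : OpenPartialHomeomorph E
        (EuclideanSpace ℝ (Fin m) × EuclideanSpace ℝ (Fin (n - 1 - m)))) (r : ℝ)
      (β : EuclideanSpace ℝ (Fin (n - 1 - m)) → LSpace n), x₀ ∈ e.source ∧ e.source ⊆ Ω ∧
      e.target = Metric.ball (e x₀).1 r ×ˢ Metric.ball (e x₀).2 r ∧
      (∀ x ∈ e.source, ContDiffAt ℝ ∞ e x) ∧ (∀ p ∈ e.target, ContDiffAt ℝ ∞ e.symm p) ∧
      (∀ x ∈ e.source, LinearMap.ker (fderiv ℝ (fun y => (e y).2) x).toLinearMap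
        = ker a₀ aₙ s x) ∧
      IsSpacelikeSubmanifold β (Metric.ball (e x₀).2 r) ∧
      (∀ x ∈ e.source, focus a₀ aₙ s x = β (e x).2) ∧
      ∀ y ∈ Metric.ball (e x₀).2 r,
        IsSphericalGenerator (fun x => Submodule.span ℝ {a₀ x, aₙ x})
          {x | x ∈ e.source ∧ (e x).2 = y} (β y) m ∧
        SweepsQuadraticCone (fun x => Submodule.span ℝ {a₀ x, aₙ x})
          {x | x ∈ e.source ∧ (e x).2 = y} (β y) (m + 1) := by
  set v := focus a₀ aₙ s with hvdef
  -- on this set the representatives of the foci are determined by the foci without a sign ambiguity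
  let Ω' : Set E := Ω ∩ {x | 0 < lorentz n (v x) (v x₀)}
  have hΩ' : IsOpen Ω' := by
    have hcont : ContinuousOn (fun x => lorentz n (v x) (v x₀)) Ω := fun x hx =>
      (((lorentzL n).flip (v x₀)).continuous.continuousAt.comp
        (h.contDiffAt_focus hx).continuousAt).continuousWithinAt
    exact hcont.isOpen_inter_preimage h.isOpen isOpen_Ioi
  have hΩΩ : Ω' ⊆ Ω := inter_subset_left
  have hx₀' : x₀ ∈ Ω' := ⟨hx₀, by
    change 0 < lorentz n (v x₀) (v x₀)
    rw [h.lorentz_focus_self hx₀]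
    exact one_pos⟩
  have hker : ∀ x ∈ Ω, LinearMap.ker (fderiv ℝ v x).toLinearMap = ker a₀ aₙ s x := fun x hx =>
    Submodule.ext fun X => ⟨fun hX => h.mem_ker_of_fderiv_eq_zero hx hX, fun hX => hc x hx X hX⟩
  have hfin : finrank ℝ E + 1 = n := (h.jet x₀ hx₀).finrank_eq
  have hkm : ∀ x ∈ Ω, finrank ℝ (ker a₀ aₙ s x) = m := h.finrank_ker
  have hmE : m ≤ finrank ℝ E := by
    rw [← hkm x₀ hx₀]
    exact Submodule.finrank_le _
  obtain ⟨e, π, r, hr, hxe, hs, ht, hsm, hsymm, hπ, hek, hconst⟩ :=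
    exists_constantRank_chart (m := m) (c := n - 1 - m) hΩ'
      (fun x hx => h.contDiffAt_focus (hΩΩ hx)) (by omega)
      (fun x hx => by rw [hker x (hΩΩ hx), hkm x (hΩΩ hx)]) hx₀'
  have hsΩ : e.source ⊆ Ω := hs.trans hΩΩ
  have hmem : ∀ a ∈ Metric.ball (e x₀).1 r, ∀ y ∈ Metric.ball (e x₀).2 r, (a, y) ∈ e.target :=
    fun a ha y hy => by
      rw [ht]
      exact ⟨ha, hy⟩
  have hc₀ : (e x₀).1 ∈ Metric.ball (e x₀).1 r := Metric.mem_ball_self hr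
  let β : EuclideanSpace ℝ (Fin (n - 1 - m)) → LSpace n := fun y => v (e.symm ((e x₀).1, y))
  have hβ : ∀ a ∈ Metric.ball (e x₀).1 r, ∀ y ∈ Metric.ball (e x₀).2 r,
      v (e.symm (a, y)) = β y := by
    intro a ha y hy
    apply hconst _ (e.map_target (hmem a ha y hy)) _ (e.map_target (hmem _ hc₀ y hy))
    rw [e.right_inv (hmem a ha y hy), e.right_inv (hmem _ hc₀ y hy)]
  have hπβ : ∀ y ∈ Metric.ball (e x₀).2 r, π (β y) = y := by
    intro y hy
    rw [← hπ, e.right_inv (hmem _ hc₀ y hy)]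
  have hβd : ∀ a ∈ Metric.ball (e x₀).1 r, ∀ y ∈ Metric.ball (e x₀).2 r, ∀ z,
      fderiv ℝ β y z = fderiv ℝ v (e.symm (a, y)) (fderiv ℝ e.symm (a, y) (0, z)) := by
    intro a ha y hy z
    have h1 := ((hsymm _ (hmem a ha y hy)).differentiableAt (by simp)).hasFDerivAt
    have h2 : HasFDerivAt v (fderiv ℝ v (e.symm (a, y))) (e.symm (a, y)) :=
      ((h.contDiffAt_focus (hsΩ (e.map_target (hmem a ha y hy)))).differentiableAt
        (by simp)).hasFDerivAt
    have h3 : HasFDerivAt (v ∘ e.symm ∘ Prod.mk a) _ y :=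
      HasFDerivAt.comp y h2 (h1.comp y (hasFDerivAt_prodMk_right a y))
    have h4 : v ∘ e.symm ∘ Prod.mk a =ᶠ[𝓝 y] β := by
      filter_upwards [Metric.isOpen_ball.mem_nhds hy] with y' hy'
      exact hβ a ha y' hy'
    rw [(h4.hasFDerivAt_iff.1 h3).fderiv]
    rfl
  have hunit : ∀ y ∈ Metric.ball (e x₀).2 r, lorentz n (β y) (β y) = 1 := fun y hy =>
    h.lorentz_focus_self (hsΩ (e.map_target (hmem _ hc₀ y hy)))
  have hspace : ∀ y ∈ Metric.ball (e x₀).2 r, ∀ (a : ℝ) (z : EuclideanSpace ℝ (Fin (n - 1 - m))),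
      (a ≠ 0 ∨ z ≠ 0) →
      0 < lorentz n (a • β y + fderiv ℝ β y z) (a • β y + fderiv ℝ β y z) := by
    intro y hy a z haz
    have hxs := e.map_target (hmem _ hc₀ y hy)
    have h1 := hβd _ hc₀ y hy z
    have h2 : lorentz n (fderiv ℝ β y z) (β y) = 0 := by
      rw [h1]
      exact h.lorentz_fderiv_focus_self (hsΩ hxs) _
    have h3 : lorentz n (a • β y + fderiv ℝ β y z) (a • β y + fderiv ℝ β y z)
        = a ^ 2 + lorentz n (fderiv ℝ β y z) (fderiv ℝ β y z) := by
      have h4 := h2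
      rw [lorentz_comm] at h4
      simp only [map_add, map_smul, LinearMap.add_apply, LinearMap.smul_apply, smul_eq_mul, h2, h4,
        hunit y hy]
      ring
    rw [h3]
    by_cases hz : z = 0
    · have ha : a ≠ 0 := haz.resolve_right (by simpa using hz)
      rw [hz, map_zero]
      simpa using pow_pos (abs_pos.2 ha) 2
    · have h4 : fderiv ℝ e.symm ((e x₀).1, y) (0, z) ∉ ker a₀ aₙ s (e.symm ((e x₀).1, y)) := by
        rw [← hker _ (hsΩ hxs), ← hek _ hxs]
        intro h5
        change fderiv ℝ (fun y => (e y).2) _ _ = 0 at h5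
        rw [fderiv_snd_comp ((hsm _ hxs).differentiableAt (by simp)),
          fderiv_fderiv_symm e hsm hsymm (hmem _ hc₀ y hy)] at h5
        exact hz h5
      have h5 := h.lorentz_fderiv_focus_pos (hsΩ hxs) h4
      rw [← hvdef, ← h1] at h5
      positivity
  have hfocus : ∀ x ∈ e.source, v x = β (e x).2 := by
    intro x hx
    have hxt := e.map_source hx
    rw [ht] at hxt
    rw [← hβ _ hxt.1 _ hxt.2, show ((e x).1, (e x).2) = e x from rfl, e.left_inv hx]
  refine ⟨e, r, β, hxe, hsΩ, ht, hsm, hsymm, fun x hx => by rw [hek x hx, hker x (hsΩ hx)],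
    ⟨fun y hy => ?_, hunit, ?_, hspace⟩, hfocus, fun y hy => ?_⟩
  · have h1 := hmem _ hc₀ y hy
    exact ((h.contDiffAt_focus (hsΩ (e.map_target h1))).comp y
      ((hsymm _ h1).comp y (contDiffAt_const.prodMk contDiffAt_id))).contDiffWithinAt
  · intro y hy y' hy' hyy
    obtain ⟨k, hk⟩ := Submodule.mem_span_singleton.1 hyy
    have h1 : k * k = 1 := by
      have := hunit y' hy'
      rw [← hk] at this
      simpa [hunit y hy] using this
    have h2 : 0 < lorentz n (β y) (v x₀) := (hs (e.map_target (hmem _ hc₀ y hy))).2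
    have h3 : 0 < lorentz n (β y') (v x₀) := (hs (e.map_target (hmem _ hc₀ y' hy'))).2
    rw [← hk, map_smul, LinearMap.smul_apply, smul_eq_mul] at h3
    have h4 : 0 < k := pos_of_mul_pos_left h3 h2.le
    have h5 : k = 1 := by nlinarith
    rw [h5, one_smul] at hk
    rw [← hπβ y hy, ← hπβ y' hy', hk]
  · have hmain := isSphericalGenerator_and_sweepsQuadraticCone
      (gen := fun x => Submodule.span ℝ {a₀ x, aₙ x}) (P := {x | x ∈ e.source ∧ (e x).2 = y})
      (T := (fderiv ℝ β y).toLinearMap) (hunit y hy) (hspace y hy) (A := EuclideanSpace ℝ (Fin m))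
      (by simp; omega) (γ := fun a => a₀ (e.symm (a, y))) (D := Metric.ball (e x₀).1 r)
      Metric.isOpen_ball ⟨_, hc₀⟩ ?_ ?_ ?_ ?_ ?_ ?_ ?_ ?_
    · simpa using hmain
    · intro a ha
      have h1 := hmem a ha y hy
      exact (h.smooth_zero _ (hsΩ (e.map_target h1))).comp a
        ((hsymm _ h1).comp a (contDiffAt_id.prodMk contDiffAt_const))
    · intro a ha
      exact (h.jet _ (hsΩ (e.map_target (hmem a ha y hy)))).null
    · intro a ha
      exact (h.jet _ (hsΩ (e.map_target (hmem a ha y hy)))).ne_zero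
    · intro a ha X hX
      have h0 := hmem a ha y hy
      have h1 := ((hsymm _ h0).differentiableAt (by simp)).hasFDerivAt
      have h2 := ((h.smooth_zero _ (hsΩ (e.map_target h0))).differentiableAt
        (by simp)).hasFDerivAt
      have h3 : HasFDerivAt (fun a => a₀ (e.symm (a, y))) _ a :=
        h2.comp a (h1.comp a (hasFDerivAt_prodMk_left a y))
      rw [h3.fderiv] at hX
      have h4 := (h.jet _ (hsΩ (e.map_target h0))).inj (fderiv ℝ e.symm (a, y) (X, 0)) hX
      have h5 := fderiv_fderiv_symm e hsm hsymm h0 (X, 0)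
      rw [h4, map_zero] at h5
      exact (congrArg Prod.fst h5).symm
    · intro a ha
      rw [← hβ a ha y hy]
      exact h.lorentz_focus_zero (hsΩ (e.map_target (hmem a ha y hy)))
    · intro a ha z
      change lorentz n _ (fderiv ℝ β y z) = 0
      rw [hβd a ha y hy, lorentz_comm]
      exact h.lorentz_fderiv_focus_zero (hsΩ (e.map_target (hmem a ha y hy))) _
    · rintro x ⟨hx, rfl⟩
      have hxt := e.map_source hx
      rw [ht] at hxt
      refine ⟨(e x).1, hxt.1, ?_⟩
      rw [show ((e x).1, (e x).2) = e x from rfl, e.left_inv hx, ← hfocus x hx]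
      exact span_pair_eq a₀ aₙ s x
    · intro a ha
      have h0 := hmem a ha y hy
      refine ⟨e.symm (a, y), ⟨e.map_target h0, by rw [e.right_inv h0]⟩, ?_⟩
      rw [← hβ a ha y hy]
      exact span_pair_eq a₀ aₙ s _

end FocalCoord

/-! ### Folds and torses -/

/-- The line as a one-dimensional Euclidean space. -/
def lineEquiv : ℝ ≃L[ℝ] EuclideanSpace ℝ (Fin 1) :=
  (ContinuousLinearEquiv.funUnique (Fin 1) ℝ ℝ).symm.trans (EuclideanSpace.equiv (Fin 1) ℝ).symm

theorem lineEquiv_apply (t : ℝ) : lineEquiv t = !₂[t] := by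
  ext i
  fin_cases i
  rfl

/-- A flow box of a smooth vector field, as a chart with values in a box. -/
theorem exists_flowChart {E : Type*} [NormedAddCommGroup E] [NormedSpace ℝ E]
    [FiniteDimensional ℝ E] {c : ℕ} {V : E → E} {u : E} {O : Set E} (hO : O ∈ 𝓝 u)
    (hV : ∀ᶠ x in 𝓝 u, ContDiffAt ℝ ∞ V x) (hne : V u ≠ 0) (hdim : c + 1 = finrank ℝ E) :
    ∃ (e : OpenPartialHomeomorph E (EuclideanSpace ℝ (Fin 1) × EuclideanSpace ℝ (Fin c))) (r : ℝ),
      u ∈ e.source ∧ e.source ⊆ O ∧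
      e.target = Metric.ball (e u).1 r ×ˢ Metric.ball (e u).2 r ∧
      (∀ x ∈ e.source, ContDiffAt ℝ ∞ e x) ∧ (∀ p ∈ e.target, ContDiffAt ℝ ∞ e.symm p) ∧
      ∀ (t : ℝ) (y : EuclideanSpace ℝ (Fin c)), (!₂[t], y) ∈ e.target →
        HasDerivAt (fun t => e.symm (!₂[t], y)) (V (e.symm (!₂[t], y))) t := by
  obtain ⟨e₀, h0, hu, ht, hs, hss, hd⟩ := exists_flowBox (F := EuclideanSpace ℝ (Fin c)) hO hV hne
    (by simpa using hdim)
  let L : (ℝ × EuclideanSpace ℝ (Fin c)) ≃L[ℝ]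
      EuclideanSpace ℝ (Fin 1) × EuclideanSpace ℝ (Fin c) :=
    lineEquiv.prodCongr (ContinuousLinearEquiv.refl ℝ _)
  let e₁ := e₀.symm.trans L.toHomeomorph.toOpenPartialHomeomorph
  have hsrc : e₁.source = e₀.target := by simp [e₁]
  have hut : u ∈ e₀.target := hu ▸ e₀.map_source h0
  obtain ⟨e, r, hr, he, hes, hx, hs', ht', htt⟩ := exists_box e₁ (x := u) (hsrc ▸ hut)
  have hef : (e : E → _) = fun x => L (e₀.symm x) := funext he
  have hesf : (e.symm : _ → E) = fun p => e₀ (L.symm p) := funext hes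
  have hmem : ∀ p ∈ e.target, L.symm p ∈ e₀.source := fun p hp => by
    have := htt hp
    simpa [e₁] using this
  refine ⟨e, r, hx, ?_, ?_, fun x hx => ?_, fun p hp => ?_, fun t y hty => ?_⟩
  · rw [hsrc] at hs'
    exact hs'.trans ht
  · rw [ht', he]
  · rw [hef]
    exact L.contDiff.contDiffAt.comp x (hss x (hsrc ▸ hs' hx))
  · rw [hesf]
    exact (hs _ (hmem p hp)).comp p L.symm.contDiff.contDiffAt
  · have hL : ∀ t : ℝ, L.symm (!₂[t], y) = (t, y) := fun t => by
      rw [ContinuousLinearEquiv.symm_apply_eq]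
      exact Prod.ext (lineEquiv_apply t).symm rfl
    have h1 := hd _ (hmem _ hty)
    simp only [hesf, hL] at h1 ⊢
    exact h1

namespace FocalCoord

/-- A curve through `aₙ + s a₀` with the velocity `θ a₀ ≠ 0`, along which the null vector moves in
the direction of some `X ≠ 0`, is regular there and has no inflection. -/
theorem linearIndependent_curve {n : ℕ} {T : Type*} [AddCommGroup T] [Module ℝ T]
    {a₀ aₙ : LSpace n} {α ν : T →ₗ[ℝ] LSpace n} (h : FrameJet n a₀ aₙ α ν) {X : T} (hX : X ≠ 0)
    {θ η s : ℝ} (hθ : θ ≠ 0) :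
    LinearIndependent ℝ ![aₙ + s • a₀, θ • a₀, η • a₀ + θ • α X] := by
  rw [Fintype.linearIndependent_iff]
  intro g hg
  simp only [Fin.sum_univ_three, Matrix.cons_val_zero, Matrix.cons_val_one, Matrix.cons_val] at hg
  obtain ⟨h1, h2, h3⟩ := h.combination_eq_zero (c := g 0 * s + g 1 * θ + g 2 * η) (d := g 0)
    (X := (g 2 * θ) • X) (by rw [← hg, map_smul]; module)
  have h4 : g 2 = 0 := by
    rw [smul_eq_zero, mul_eq_zero] at h3
    exact (h3.resolve_right hX).resolve_right hθ
  have h5 : g 1 = 0 := by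
    simpa [h2, h4, hθ] using h1
  intro i
  fin_cases i
  · exact h2
  · exact h5
  · exact h4

variable {n : ℕ} {E : Type*} [NormedAddCommGroup E] [InnerProductSpace ℝ E]
  [FiniteDimensional ℝ E] {a₀ aₙ : E → LSpace n} {s : E → ℝ} {Ω : Set E}

/-- Along an integral curve of the singular directions the velocity of a focus that is a fold is
`θ A₀` with `θ ≠ 0`, so the generators are the tangent lines of the curve described by the focus. -/
theorem exists_foldChart (h : FocalCoord n 1 a₀ aₙ s Ω)
    (hf : ∀ x ∈ Ω, ∀ X ∈ ker a₀ aₙ s x, fderiv ℝ (focus a₀ aₙ s) x X = 0 → X = 0) {x₀ : E}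
    (hx₀ : x₀ ∈ Ω) :
    ∃ (e : OpenPartialHomeomorph E (EuclideanSpace ℝ (Fin 1) × EuclideanSpace ℝ (Fin (n - 2))))
      (r : ℝ), x₀ ∈ e.source ∧ e.source ⊆ Ω ∧
      e.target = Metric.ball (e x₀).1 r ×ˢ Metric.ball (e x₀).2 r ∧
      (∀ x ∈ e.source, ContDiffAt ℝ ∞ e x) ∧ (∀ p ∈ e.target, ContDiffAt ℝ ∞ e.symm p) ∧
      (∀ x ∈ e.source, LinearMap.ker (fderiv ℝ (fun y => (e y).2) x).toLinearMap
        = ker a₀ aₙ s x) ∧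
      ∀ (t : ℝ) (y : EuclideanSpace ℝ (Fin (n - 2))), (!₂[t], y) ∈ e.target →
        ∀ c : ℝ → LSpace n, (∀ r, c r = focus a₀ aₙ s (e.symm (!₂[r], y))) →
        ContDiffAt ℝ ∞ c t ∧ LinearIndependent ℝ ![c t, deriv c t, deriv (deriv c) t] ∧
        Submodule.span ℝ {a₀ (e.symm (!₂[t], y)), aₙ (e.symm (!₂[t], y))}
          = Submodule.span ℝ {c t, deriv c t} := by
  have hfin : finrank ℝ E + 1 = n := (h.jet x₀ hx₀).finrank_eq
  have hk : ∀ x ∈ Ω, finrank ℝ (ker a₀ aₙ s x) = 1 := h.finrank_ker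
  have hE : 1 ≤ finrank ℝ E := by
    rw [← hk x₀ hx₀]
    exact Submodule.finrank_le _
  have : Nontrivial (ker a₀ aₙ s x₀) := nontrivial_of_finrank_pos (R := ℝ) (by
    rw [hk x₀ hx₀]
    exact one_pos)
  obtain ⟨⟨X, hX⟩, hX0⟩ := exists_ne (0 : ker a₀ aₙ s x₀)
  obtain ⟨V, hVX, hV⟩ := exists_kernel_field (κ := focalOp a₀ aₙ s) (X := X)
    (by
      filter_upwards [h.mem_nhds hx₀] with x hx
      exact h.contDiffAt_focalOp hx)
    ((h.jet x₀ hx₀).inner_formOp_symm (s x₀)) (h.eventually_finrank_ker_focalOp hx₀) (by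
      rw [← h.ker_focalOp hx₀] at hX
      exact hX)
  have hVne : V x₀ ≠ 0 := by
    rw [hVX]
    exact fun e => hX0 (Subtype.ext e)
  let O : Set E := {x | x ∈ Ω ∧ ContDiffAt ℝ ∞ V x ∧ V x ∈ ker a₀ aₙ s x ∧ V x ≠ 0}
  have hO : O ∈ 𝓝 x₀ := by
    filter_upwards [h.mem_nhds hx₀, hV, hV.self_of_nhds.1.continuousAt.eventually_ne hVne]
      with x h1 h2 h3
    refine ⟨h1, h2.1, ?_, h3⟩
    rw [← h.ker_focalOp h1]
    exact h2.2
  obtain ⟨e, r, hx₀e, hs, ht, hsm, hsymm, hflow⟩ := exists_flowChart (c := n - 2) hO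
    (hV.mono fun x hx => hx.1) hVne (by omega)
  refine ⟨e, r, hx₀e, fun x hx => (hs hx).1, ht, hsm, hsymm, fun x hx => ?_, ?_⟩
  · symm
    refine Submodule.eq_of_le_of_finrank_eq ?_ ?_
    · -- the kernel is spanned by `V`, the transversal coordinates are constant along the flow
      have hVk : V x ∈ LinearMap.ker (fderiv ℝ (fun y => (e y).2) x).toLinearMap := by
        have hxt := e.map_source hx
        set t : ℝ := (e x).1 0 with htdef
        have htx : (!₂[t], (e x).2) = e x := by
          refine Prod.ext ?_ rfl
          ext i
          fin_cases i
          rfl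
        have h1 := hflow t (e x).2 (by rw [htx]; exact hxt)
        rw [htx, e.left_inv hx] at h1
        have h2 : HasFDerivAt (fun y => (e y).2) (fderiv ℝ (fun y => (e y).2) x)
            (e.symm (!₂[t], (e x).2)) := by
          rw [htx, e.left_inv hx]
          exact (contDiffAt_snd.comp x (hsm x hx)).differentiableAt (by simp) |>.hasFDerivAt
        have h3 := h2.comp_hasDerivAt t h1
        have h4 : (fun y => (e y).2) ∘ (fun t => e.symm (!₂[t], (e x).2))
            =ᶠ[𝓝 t] fun _ => (e x).2 := by
          have hc : Continuous fun t : ℝ =>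
              ((!₂[t] : EuclideanSpace ℝ (Fin 1)), (e x).2) := by
            simp only [← lineEquiv_apply]
            exact lineEquiv.continuous.prodMk continuous_const
          filter_upwards [hc.continuousAt.eventually
            (e.open_target.mem_nhds
              (show (!₂[t], (e x).2) ∈ e.target by rw [htx]; exact hxt))] with t' ht'
          simp only [Function.comp_apply]
          rw [e.right_inv ht']
        exact (h4.hasDerivAt_iff.1 h3).unique (hasDerivAt_const t _)
      have hVker := (hs hx).2.2.1
      intro Y hY
      obtain ⟨a, ha⟩ := (finrank_eq_one_iff_of_nonzero' (⟨V x, hVker⟩ : ker a₀ aₙ s x)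
        (fun e => (hs hx).2.2.2 (congrArg Subtype.val e))).1 (hk x (hs hx).1) ⟨Y, hY⟩
      have ha' : a • V x = Y := congrArg Subtype.val ha
      rw [← ha']
      exact Submodule.smul_mem _ _ hVk
    · rw [hk x (hs hx).1, finrank_ker_snd e hsm hsymm hx]
      simp
  · intro t y hty c hc
    let ζ : ℝ → E := fun t => e.symm (!₂[t], y)
    have hι : Continuous fun t : ℝ => ((!₂[t] : EuclideanSpace ℝ (Fin 1)), y) := by
      simp only [← lineEquiv_apply]
      exact lineEquiv.continuous.prodMk continuous_const
    have hnear : ∀ᶠ t' in 𝓝 t, ((!₂[t'] : EuclideanSpace ℝ (Fin 1)), y) ∈ e.target :=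
      hι.continuousAt.eventually (e.open_target.mem_nhds hty)
    have hζs : ContDiffAt ℝ ∞ ζ t := by
      have h1 : ContDiff ℝ ∞ fun t : ℝ => ((!₂[t] : EuclideanSpace ℝ (Fin 1)), y) := by
        simp only [← lineEquiv_apply]
        exact lineEquiv.contDiff.prodMk contDiff_const
      exact (hsymm _ hty).comp t h1.contDiffAt
    have hζO : ∀ t', ((!₂[t'] : EuclideanSpace ℝ (Fin 1)), y) ∈ e.target → ζ t' ∈ O :=
      fun t' ht' => hs (e.map_target ht')
    have hζt := hζO t hty
    have hcf : c = fun t => focus a₀ aₙ s (ζ t) := funext hc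
    have hcs : ContDiffAt ℝ ∞ c t := by
      rw [hcf]
      exact (h.contDiffAt_focus hζt.1).comp t hζs
    have hcd : ∀ᶠ t' in 𝓝 t, deriv c t' = fderiv ℝ (focus a₀ aₙ s) (ζ t') (V (ζ t')) := by
      filter_upwards [hnear] with t' ht'
      rw [hcf]
      exact (((h.contDiffAt_focus (hζO t' ht').1).differentiableAt
        (by simp)).hasFDerivAt.comp_hasDerivAt t' (hflow t' y ht')).deriv
    -- the coefficient `θ` in `c' = θ a₀`, computed with an auxiliary vector `z`
    obtain ⟨z, hz⟩ := exists_lorentz_ne_zero (h.jet _ hζt.1).ne_zero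
    have ha₀ζ : ContDiffAt ℝ ∞ (fun t => a₀ (ζ t)) t := (h.smooth_zero _ hζt.1).comp t hζs
    let θ : ℝ → ℝ := fun t => lorentzL n (deriv c t) z / lorentzL n (a₀ (ζ t)) z
    have hθ : ∀ᶠ t' in 𝓝 t, deriv c t' = θ t' • a₀ (ζ t') := by
      filter_upwards [hcd, hnear, eventually_lorentz_ne_zero ha₀ζ.continuousAt hz]
        with t' h1 h2 h3
      obtain ⟨η, hη⟩ := Submodule.mem_span_singleton.1
        ((h.mem_ker_iff (hζO t' h2).1).1 (hζO t' h2).2.2.1)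
      rw [← h1] at hη
      simp only [θ, lorentzL_apply]
      rw [← hη]
      simp [h3]
    have hθ0 : θ t ≠ 0 := by
      intro h0
      have h1 := hθ.self_of_nhds
      rw [h0, zero_smul, hcd.self_of_nhds] at h1
      exact hζt.2.2.2 (hf _ hζt.1 _ hζt.2.2.1 h1)
    have hc' : ContDiffAt ℝ ∞ (deriv c) t :=
      (hcs.fderiv_right (m := ∞) le_rfl).clm_apply contDiffAt_const
    have hθd : DifferentiableAt ℝ θ t := by
      have h1 : ContDiffAt ℝ ∞ (fun t => lorentzL n (deriv c t) z) t :=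
        ((lorentzL n).flip z).contDiff.contDiffAt.comp t hc'
      have h2 : ContDiffAt ℝ ∞ (fun t => lorentzL n (a₀ (ζ t)) z) t :=
        ((lorentzL n).flip z).contDiff.contDiffAt.comp t ha₀ζ
      exact (h1.div h2 hz).differentiableAt (by simp)
    have hc'' : deriv (deriv c) t
        = deriv θ t • a₀ (ζ t) + θ t • fderiv ℝ a₀ (ζ t) (V (ζ t)) := by
      have h1 : HasDerivAt (fun t => a₀ (ζ t)) (fderiv ℝ a₀ (ζ t) (V (ζ t))) t :=
        (((h.smooth_zero _ hζt.1).differentiableAt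
          (by simp)).hasFDerivAt.comp_hasDerivAt t (hflow t y hty))
      have h2 : deriv c =ᶠ[𝓝 t] fun t => θ t • a₀ (ζ t) := hθ
      rw [h2.deriv_eq, add_comm (deriv θ t • a₀ (ζ t))]
      exact (hθd.hasDerivAt.smul h1).deriv
    refine ⟨hcs, ?_, ?_⟩
    · rw [hc'', hθ.self_of_nhds, hc]
      exact linearIndependent_curve (h.jet _ hζt.1) hζt.2.2.2 hθ0
    · rw [hθ.self_of_nhds, hc, span_pair_eq a₀ aₙ s]
      change Submodule.span ℝ {a₀ (ζ t), focus a₀ aₙ s (ζ t)}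
        = Submodule.span ℝ {focus a₀ aₙ s (ζ t), θ t • a₀ (ζ t)}
      apply le_antisymm <;> rw [Submodule.span_le] <;> rintro w (rfl | rfl)
      · exact Submodule.mem_span_pair.2 ⟨0, (θ t)⁻¹, by simp [smul_smul, hθ0]⟩
      · exact Submodule.subset_span (by simp)
      · exact Submodule.subset_span (by simp)
      · exact Submodule.mem_span_pair.2 ⟨θ t, 0, by simp⟩

end FocalCoord

/-! ### Folds and conic foci on the parameter manifold -/

section Manifold

variable {n : ℕ} {M : Type*} [TopologicalSpace M] [ChartedSpace (EuclideanSpace ℝ (Fin (n - 1))) M]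
  [IsManifold (𝓡 (n - 1)) ∞ M]

/-- Foliated coordinates in the range of a chart of `M` give a foliated chart of `M`. -/
def FoliatedChart.ofCoord {k c : ℕ} (u : M)
    (e : OpenPartialHomeomorph (EuclideanSpace ℝ (Fin (n - 1)))
      (EuclideanSpace ℝ (Fin k) × EuclideanSpace ℝ (Fin c)))
    (hs : e.source ⊆ (chartAt (EuclideanSpace ℝ (Fin (n - 1))) u).target)
    (a : EuclideanSpace ℝ (Fin k)) (b : EuclideanSpace ℝ (Fin c)) (r : ℝ)
    (ht : e.target = Metric.ball a r ×ˢ Metric.ball b r)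
    (hsm : ∀ x ∈ e.source, ContDiffAt ℝ ∞ e x)
    (hsymm : ∀ p ∈ e.target, ContDiffAt ℝ ∞ e.symm p) : FoliatedChart n M k c where
  toHomeo := (chartAt (EuclideanSpace ℝ (Fin (n - 1))) u).trans e
  leafDom := Metric.ball a r
  paramDom := Metric.ball b r
  leaf_open := Metric.isOpen_ball
  leaf_convex := convex_ball a r
  param_open := Metric.isOpen_ball
  param_convex := convex_ball b r
  target_eq := by
    rw [OpenPartialHomeomorph.trans_target, ← ht]
    exact inter_eq_left.2 fun p hp => hs (e.map_target hp)
  smooth := fun w hw => by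
    rw [OpenPartialHomeomorph.trans_source] at hw
    exact (contMDiffAt_comp_chart u hw.1 (hsm _ hw.2)).contMDiffWithinAt
  smooth_symm := fun p hp => by
    rw [OpenPartialHomeomorph.trans_target] at hp
    have h1 : ContMDiffAt (𝓡 (n - 1)) (𝓡 (n - 1)) ∞
        (chartAt (EuclideanSpace ℝ (Fin (n - 1))) u).symm (e.symm p) :=
      (contMDiffOn_chart_symm (I := 𝓡 (n - 1)) (n := ∞) (x := u)).contMDiffAt
        ((chartAt (EuclideanSpace ℝ (Fin (n - 1))) u).open_target.mem_nhds hp.2)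
    exact (ContMDiffAt.comp p h1 (hsymm p hp.1).contMDiffAt).contMDiffWithinAt

/-- The tangent spaces of the plaques in coordinates. -/
theorem ker_mfderiv_snd {k c : ℕ} {u w : M}
    (hw : w ∈ (chartAt (EuclideanSpace ℝ (Fin (n - 1))) u).source)
    {e : OpenPartialHomeomorph (EuclideanSpace ℝ (Fin (n - 1)))
      (EuclideanSpace ℝ (Fin k) × EuclideanSpace ℝ (Fin c))}
    (hsm : ContDiffAt ℝ ∞ e (chartAt (EuclideanSpace ℝ (Fin (n - 1))) u w)) :
    LinearMap.ker (mfderiv (𝓡 (n - 1)) 𝓘(ℝ, EuclideanSpace ℝ (Fin c))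
        (fun w => (e (chartAt (EuclideanSpace ℝ (Fin (n - 1))) u w)).2) w).toLinearMap
      = (LinearMap.ker (fderiv ℝ (fun x => (e x).2)
          (chartAt (EuclideanSpace ℝ (Fin (n - 1))) u w)).toLinearMap).comap
        (chartDeriv u hw).toLinearMap := by
  set φ := chartAt (EuclideanSpace ℝ (Fin (n - 1))) u with hφ
  have h1 : ContDiffAt ℝ ∞ (fun x => (e x).2) (φ w) := contDiffAt_snd.comp _ hsm
  have h2 : (fun x => (e (φ (φ.symm x))).2) =ᶠ[𝓝 (φ w)] fun x => (e x).2 := by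
    filter_upwards [φ.open_target.mem_nhds (φ.map_source hw)] with x hx
    rw [φ.right_inv hx]
  ext X
  change mfderiv (𝓡 (n - 1)) 𝓘(ℝ, EuclideanSpace ℝ (Fin c)) (fun w => (e (φ w)).2) w X = 0 ↔
    fderiv ℝ (fun x => (e x).2) (φ w) (chartDeriv u hw X) = 0
  rw [mfderiv_eq_fderiv_chart u hw (contMDiffAt_comp_chart u hw h1) X]
  rw [← hφ, h2.fderiv_eq]
  rfl

/-- Two smooth fields of representatives of a field of points have differentials that vanish
modulo the point in the same directions; if one of them is normalized, its differential does not
meet the point. -/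
theorem IsLiftAt.diff_mem_iff {B : M → ℙ ℝ (LSpace n)} {u w : M}
    (hw : w ∈ (chartAt (EuclideanSpace ℝ (Fin (n - 1))) u).source) {τ : M → LSpace n}
    (hτ : IsLiftAt B w τ) (hτs : IsSmoothNear τ w) {v : EuclideanSpace ℝ (Fin (n - 1)) → LSpace n}
    (hv : ContDiffAt ℝ ∞ v (chartAt (EuclideanSpace ℝ (Fin (n - 1))) u w))
    (hB : ∀ᶠ y in 𝓝 w, (B y).submodule = ℝ ∙ v (chartAt (EuclideanSpace ℝ (Fin (n - 1))) u y))
    (hv1 : ∀ᶠ x in 𝓝 (chartAt (EuclideanSpace ℝ (Fin (n - 1))) u w), lorentz n (v x) (v x) = 1)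
    (X : TangentSpace (𝓡 (n - 1)) w) :
    diff τ w X ∈ (B w).submodule ↔
      fderiv ℝ v (chartAt (EuclideanSpace ℝ (Fin (n - 1))) u w) (chartDeriv u hw X) = 0 := by
  rw [diff_apply u hw hτs.self_of_nhds, hB.self_of_nhds]
  set φ := chartAt (EuclideanSpace ℝ (Fin (n - 1))) u with hφ
  set Y := chartDeriv u hw X
  set t : EuclideanSpace ℝ (Fin (n - 1)) → LSpace n := fun x => τ (φ.symm x) with htdef
  have ht : DifferentiableAt ℝ t (φ w) :=
    (contDiffAt_comp_chart_symm u hw hτs.self_of_nhds).differentiableAt (by simp)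
  have hvd : DifferentiableAt ℝ v (φ w) := hv.differentiableAt (by simp)
  let c : EuclideanSpace ℝ (Fin (n - 1)) → ℝ := fun x => lorentz n (t x) (v x)
  have hc : DifferentiableAt ℝ c (φ w) := by
    obtain ⟨L, hL, -⟩ := hasFDerivAt_lorentz ht hvd
    exact hL.differentiableAt
  have hsymm : Tendsto φ.symm (𝓝 (φ w)) (𝓝 w) := by
    have h := φ.continuousAt_symm (φ.map_source hw)
    rwa [ContinuousAt, φ.left_inv hw] at h
  have hcv : ∀ᶠ x in 𝓝 (φ w), t x = c x • v x ∧ t x ≠ 0 := by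
    filter_upwards [hsymm.eventually hτ, hsymm.eventually hB, hv1,
      φ.open_target.mem_nhds (φ.map_source hw)] with x h1 h2 h3 h4
    refine ⟨?_, h1.2⟩
    have h5 := h1.1
    rw [h2, φ.right_inv h4] at h5
    obtain ⟨a, ha⟩ := Submodule.mem_span_singleton.1 h5
    have h6 : c x = a := by
      change lorentz n (τ (φ.symm x)) (v x) = a
      rw [← ha]
      simp [h3]
    rw [h6]
    exact ha.symm
  have hc0 : c (φ w) ≠ 0 := by
    intro h0
    obtain ⟨h1, h2⟩ := hcv.self_of_nhds
    rw [h0, zero_smul] at h1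
    exact h2 h1
  have htv : t =ᶠ[𝓝 (φ w)] fun x => c x • v x := hcv.mono fun x hx => hx.1
  have hder : fderiv ℝ t (φ w) Y = c (φ w) • fderiv ℝ v (φ w) Y + fderiv ℝ c (φ w) Y • v (φ w) := by
    rw [(htv.hasFDerivAt_iff.2 (hc.hasFDerivAt.smul hvd.hasFDerivAt)).fderiv]
    simp
  have hperp : lorentz n (fderiv ℝ v (φ w) Y) (v (φ w)) = 0 := by
    have := lorentz_fderiv_of_const hvd hvd hv1 Y
    rw [lorentz_comm (v (φ w))] at this
    linarith
  rw [hder]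
  constructor
  · intro h
    obtain ⟨a, ha⟩ := Submodule.mem_span_singleton.1 h
    have h1 : c (φ w) • fderiv ℝ v (φ w) Y = (a - fderiv ℝ c (φ w) Y) • v (φ w) := by
      rw [sub_smul, ha]
      abel
    have h2 := congrArg (fun z => lorentz n z (v (φ w))) h1
    simp only [map_smul, LinearMap.smul_apply, hperp, hv1.self_of_nhds, smul_eq_mul, mul_zero,
      mul_one] at h2
    rw [← h2, zero_smul] at h1
    exact (smul_eq_zero.1 h1).resolve_left hc0
  · intro h
    rw [h, smul_zero, zero_add]
    exact Submodule.smul_mem _ _ (Submodule.mem_span_singleton_self _)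

/-- Folds and conic foci in coordinates. -/
theorem LightlikeHypersurface.exists_focalChart (U : LightlikeHypersurface n M)
    (hn : 1 ≤ n) (hU : U.HasMaximalRank) {N : Set M} {B : M → ℙ ℝ (LSpace n)} {m : ℕ}
    (hB : IsFocusField U.gen N B m) {u : M} (hu : u ∈ N) {O : Set M} (hO : O ∈ 𝓝 u) :
    ∃ (a₀ aₙ : EuclideanSpace ℝ (Fin (n - 1)) → LSpace n)
      (s : EuclideanSpace ℝ (Fin (n - 1)) → ℝ) (Ω : Set (EuclideanSpace ℝ (Fin (n - 1)))),
      chartAt (EuclideanSpace ℝ (Fin (n - 1))) u u ∈ Ω ∧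
      Ω ⊆ (chartAt (EuclideanSpace ℝ (Fin (n - 1))) u).target ∧ FocalCoord n m a₀ aₙ s Ω ∧
      ∀ w (hw : w ∈ (chartAt (EuclideanSpace ℝ (Fin (n - 1))) u).source) x,
        chartAt (EuclideanSpace ℝ (Fin (n - 1))) u w = x → x ∈ Ω →
        w ∈ N ∧ w ∈ O ∧ U.gen w = Submodule.span ℝ {a₀ x, aₙ x} ∧
        (B w).submodule = ℝ ∙ FocalCoord.focus a₀ aₙ s x ∧
        singularDirections U.gen w (B w)
          = (FocalCoord.ker a₀ aₙ s x).comap (chartDeriv u hw).toLinearMap ∧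
        (IsFoldAt U.gen B w ↔ ∀ X ∈ FocalCoord.ker a₀ aₙ s x,
          fderiv ℝ (FocalCoord.focus a₀ aₙ s) x X = 0 → X = 0) ∧
        (IsConicAt U.gen B w ↔ ∀ X ∈ FocalCoord.ker a₀ aₙ s x,
          fderiv ℝ (FocalCoord.focus a₀ aₙ s) x X = 0) ∧
        HypersphereTangentAt U.gen (FocalCoord.focus a₀ aₙ s x) w := by
  obtain ⟨A₀, Aₙ, s, Ω, huΩ, hΩt, hΩ, hΩw⟩ := U.exists_focalCoord hn hU hB hu hO
  refine ⟨_, _, s, Ω, huΩ, hΩt, hΩ, ?_⟩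
  set φ := chartAt (EuclideanSpace ℝ (Fin (n - 1))) u with hφ
  rintro w hw x rfl hx
  obtain ⟨hwN, hwO, hF, hBw, hsing⟩ := hΩw w hw hx
  set a₀ : EuclideanSpace ℝ (Fin (n - 1)) → LSpace n := fun x => A₀ (φ.symm x) with ha₀
  set aₙ : EuclideanSpace ℝ (Fin (n - 1)) → LSpace n := fun x => Aₙ (φ.symm x) with haₙ
  have e0 : ∀ y ∈ φ.source, a₀ (φ y) = A₀ y := fun y hy => congrArg A₀ (φ.left_inv hy)
  have en : ∀ y ∈ φ.source, aₙ (φ y) = Aₙ y := fun y hy => congrArg Aₙ (φ.left_inv hy)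
  set v := FocalCoord.focus a₀ aₙ s with hv
  have hW : ∀ᶠ y in 𝓝 w, y ∈ φ.source ∧ φ y ∈ Ω :=
    (φ.isOpen_inter_preimage hΩ.isOpen).mem_nhds ⟨hw, hx⟩
  have hBv : ∀ᶠ y in 𝓝 w, (B y).submodule = ℝ ∙ v (φ y) := by
    filter_upwards [hW] with y hy
    rw [(hΩw y hy.1 hy.2).2.2.2.1, hv, FocalCoord.focus, e0 y hy.1, en y hy.1]
  have hv1 : ∀ᶠ x in 𝓝 (φ w), lorentz n (v x) (v x) = 1 := by
    filter_upwards [hΩ.mem_nhds hx] with x hx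
    exact hΩ.lorentz_focus_self hx
  have hsing' : singularDirections U.gen w (B w)
      = (FocalCoord.ker a₀ aₙ s (φ w)).comap (chartDeriv u hw).toLinearMap := by
    rw [hsing, FocalCoord.ker, e0 w hw, en w hw]
  have hmem : ∀ Y ∈ FocalCoord.ker a₀ aₙ s (φ w), ∃ X ∈ singularDirections U.gen w (B w),
      chartDeriv u hw X = Y := fun Y hY =>
    ⟨(chartDeriv u hw).symm Y, by
      rw [hsing', Submodule.mem_comap]
      simpa using hY, by simp⟩
  -- the normalized field of representatives of the foci
  have hlift : IsLiftAt B w fun y => v (φ y) := by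
    filter_upwards [hBv, hW] with y h1 h2
    rw [h1]
    refine ⟨Submodule.mem_span_singleton_self _, fun h0 => ?_⟩
    have := hΩ.lorentz_focus_self h2.2
    rw [← hv, h0] at this
    simp at this
  have hsmooth : IsSmoothNear (fun y => v (φ y)) w := by
    filter_upwards [hW] with y hy
    exact contMDiffAt_comp_chart u hy.1 (hΩ.contDiffAt_focus hy.2)
  have hcv := hΩ.contDiffAt_focus hx
  refine ⟨hwN, hwO, ?_, hBv.self_of_nhds, hsing', ?_, ?_, ?_⟩
  · rw [hF.adapted.self_of_nhds.2.2.2.2, ← e0 w hw, ← en w hw]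
  · constructor
    · rintro ⟨τ, h1, h2, h3⟩ Y hY hY0
      obtain ⟨X, hX, rfl⟩ := hmem Y hY
      by_contra hne
      refine h3 X hX (fun h0 => hne (by rw [h0, map_zero])) ?_
      exact (h1.diff_mem_iff hw h2 hcv hBv hv1 X).2 hY0
    · intro h
      refine ⟨_, hlift, hsmooth, fun X hX hX0 hmemB => hX0 ?_⟩
      have h1 := (hlift.diff_mem_iff hw hsmooth hcv hBv hv1 X).1 hmemB
      rw [hsing'] at hX
      exact (chartDeriv u hw).map_eq_zero_iff.1 (h _ hX h1)
  · constructor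
    · rintro ⟨τ, h1, h2, h3⟩ Y hY
      obtain ⟨X, hX, rfl⟩ := hmem Y hY
      exact (h1.diff_mem_iff hw h2 hcv hBv hv1 X).1 (h3 X hX)
    · intro h
      refine ⟨_, hlift, hsmooth, fun X hX => ?_⟩
      rw [hsing'] at hX
      exact (hlift.diff_mem_iff hw hsmooth hcv hBv hv1 X).2 (h _ hX)
  · rintro σ ⟨⟨hσs, hσ⟩, hσ0⟩
    have hσA : ∀ᶠ y in 𝓝 w, σ y ∈ ℝ ∙ a₀ (φ y) := by
      filter_upwards [hσ, hσ0, hW] with y h1 h2 h3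
      have hFy := (hΩw y h3.1 h3.2).2.2.1.adapted.self_of_nhds
      have h4 := h1.1
      rw [hFy.2.2.2.2] at h4
      obtain ⟨a, b, hab⟩ := Submodule.mem_span_pair.1 h4
      have h5 := hFy.2.2.1
      rw [lorentz_comm] at h5
      rw [← hab] at h2 ⊢
      have hb : b = 0 := by
        simp [hFy.2.1, hFy.2.2.1, hFy.2.2.2.1, h5] at h2
        exact h2
      rw [hb, zero_smul, add_zero, e0 y h3.1]
      exact Submodule.smul_mem _ _ (Submodule.mem_span_singleton_self _)
    have hσv : ∀ᶠ y in 𝓝 w, lorentz n (σ y) (v (φ y)) = 0 := by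
      filter_upwards [hσA, hW] with y h1 h2
      obtain ⟨a, ha⟩ := Submodule.mem_span_singleton.1 h1
      rw [← ha, map_smul, LinearMap.smul_apply, hΩ.lorentz_focus_zero h2.2, smul_zero]
    refine ⟨hσv.self_of_nhds, fun X => ?_⟩
    have h1 := lorentz_diff_of_const hσs.self_of_nhds hsmooth.self_of_nhds hσv X
    obtain ⟨a, ha⟩ := Submodule.mem_span_singleton.1 hσA.self_of_nhds
    have h2 : lorentz n (σ w) (diff (fun y => v (φ y)) w X) = 0 := by
      have h3 : (fun x => v (φ (φ.symm x))) =ᶠ[𝓝 (φ w)] v := by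
        filter_upwards [φ.open_target.mem_nhds (φ.map_source hw)] with x hx
        rw [φ.right_inv hx]
      rw [diff_apply u hw hsmooth.self_of_nhds, ← hφ, h3.fderiv_eq, ← ha, map_smul,
        LinearMap.smul_apply, lorentz_comm, hΩ.lorentz_fderiv_focus_zero hx, smul_zero]
    linarith

end Manifold

/-! ### Foliations into torses and cones -/

section Foliations

variable {n : ℕ} {M : Type*} [TopologicalSpace M] [ChartedSpace (EuclideanSpace ℝ (Fin (n - 1))) M]
  [IsManifold (𝓡 (n - 1)) ∞ M]

/-- The foci of a field of simple foci are folds or conic: the singular directions form a line. -/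
theorem LightlikeHypersurface.isFoldAt_or_isConicAt (U : LightlikeHypersurface n M)
    (hn : 1 ≤ n) (hU : U.HasMaximalRank) {N : Set M} {B : M → ℙ ℝ (LSpace n)}
    (hB : IsFocusField U.gen N B 1) {u : M} (hu : u ∈ N) :
    (IsFoldAt U.gen B u ∨ IsConicAt U.gen B u) ∧ ¬(IsFoldAt U.gen B u ∧ IsConicAt U.gen B u) := by
  obtain ⟨a₀, aₙ, s, Ω, huΩ, -, hΩ, hw⟩ := U.exists_focalChart hn hU hB hu univ_mem
  obtain ⟨-, -, -, -, -, hfold, hconic, -⟩ := hw u (mem_chart_source _ u) _ rfl huΩ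
  rw [hfold, hconic]
  set x := chartAt (EuclideanSpace ℝ (Fin (n - 1))) u u
  have hk : finrank ℝ (FocalCoord.ker a₀ aₙ s x) = 1 := hΩ.finrank_ker x huΩ
  obtain ⟨⟨X, hX⟩, hX0, hspan⟩ := finrank_eq_one_iff'.1 hk
  have hX0' : X ≠ 0 := fun h => hX0 (Subtype.ext h)
  refine ⟨?_, fun h => hX0' (h.1 X hX (h.2 X hX))⟩
  by_cases hd : fderiv ℝ (FocalCoord.focus a₀ aₙ s) x X = 0
  · refine Or.inr fun Y hY => ?_
    obtain ⟨c, hc⟩ := hspan ⟨Y, hY⟩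
    rw [← show c • X = Y from congrArg Subtype.val hc, map_smul, hd, smul_zero]
  · refine Or.inl fun Y hY hY0 => ?_
    obtain ⟨c, hc⟩ := hspan ⟨Y, hY⟩
    have hcY : c • X = Y := congrArg Subtype.val hc
    rw [← hcY, map_smul] at hY0
    rw [← hcY, (smul_eq_zero.1 hY0).resolve_right hd, zero_smul]

/-- The foci of a constant multiplicity `m ≥ 2` are conic. -/
theorem LightlikeHypersurface.isConicAt_of_two_le (U : LightlikeHypersurface n M)
    (hn : 1 ≤ n) (hU : U.HasMaximalRank) {N : Set M} {B : M → ℙ ℝ (LSpace n)} {m : ℕ}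
    (hm : 2 ≤ m) (hB : IsFocusField U.gen N B m) {u : M} (hu : u ∈ N) : IsConicAt U.gen B u := by
  obtain ⟨a₀, aₙ, s, Ω, huΩ, -, hΩ, hw⟩ := U.exists_focalChart hn hU hB hu univ_mem
  obtain ⟨-, -, -, -, -, -, hconic, -⟩ := hw u (mem_chart_source _ u) _ rfl huΩ
  exact hconic.2 fun X hX => hΩ.fderiv_focus_eq_zero hm huΩ hX

/-- The folds are the foci at which the field of foci is an immersion. -/
theorem LightlikeHypersurface.isOpen_setOf_isFoldAt (U : LightlikeHypersurface n M)
    (hn : 1 ≤ n) (hU : U.HasMaximalRank) {N : Set M} {B : M → ℙ ℝ (LSpace n)} {m : ℕ}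
    (hB : IsFocusField U.gen N B m) : IsOpen {u ∈ N | IsFoldAt U.gen B u} := by
  rw [isOpen_iff_mem_nhds]
  rintro u ⟨hu, huf⟩
  obtain ⟨a₀, aₙ, s, Ω, huΩ, -, hΩ, hw⟩ := U.exists_focalChart hn hU hB hu univ_mem
  set φ := chartAt (EuclideanSpace ℝ (Fin (n - 1))) u with hφ
  have hus : u ∈ φ.source := mem_chart_source _ u
  have hcont : ContinuousAt (fun w => fderiv ℝ (FocalCoord.focus a₀ aₙ s) (φ w)) u :=
    ContinuousAt.comp (((hΩ.contDiffAt_focus huΩ).fderiv_right (m := ∞) le_rfl).continuousAt)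
      (φ.continuousAt hus)
  have hinj : Function.Injective (fderiv ℝ (FocalCoord.focus a₀ aₙ s) (φ u)) := by
    rw [injective_iff_map_eq_zero]
    intro X hX
    exact (hw u hus _ rfl huΩ).2.2.2.2.2.1.1 huf X (hΩ.mem_ker_of_fderiv_eq_zero huΩ hX) hX
  filter_upwards [hcont.eventually (ContinuousLinearMap.isOpen_injective.mem_nhds hinj),
    (φ.isOpen_inter_preimage hΩ.isOpen).mem_nhds ⟨hus, huΩ⟩] with w h1 h2
  obtain ⟨hwN, -, -, -, -, hfold, -, -⟩ := hw w h2.1 _ rfl h2.2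
  exact ⟨hwN, hfold.2 fun X _ hX => (injective_iff_map_eq_zero _).1 h1 X hX⟩

/-- Over an open set of conic foci the hypersurface is foliated into second-order cones. -/
theorem LightlikeHypersurface.isFoliatedByCones (U : LightlikeHypersurface n M)
    (hn : 1 ≤ n) (hU : U.HasMaximalRank) {N : Set M} {B : M → ℙ ℝ (LSpace n)} {m : ℕ}
    (hB : IsFocusField U.gen N B m) {N' : Set M} (hN' : IsOpen N') (hNN : N' ⊆ N)
    (hc : ∀ u ∈ N', IsConicAt U.gen B u) : IsFoliatedByCones U.gen N' B m := by
  intro u hu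
  obtain ⟨a₀, aₙ, s, Ω, huΩ, hΩt, hΩ, hw⟩ :=
    U.exists_focalChart hn hU hB (hNN hu) (hN'.mem_nhds hu)
  have hus : u ∈ (chartAt (EuclideanSpace ℝ (Fin (n - 1))) u).source := mem_chart_source _ u
  obtain ⟨e, r, β, hue, hs, ht, hsm, hsymm, hker, hβ, hfocus, hcone⟩ := hΩ.exists_conicChart
    (fun x hx => by
      have hx' := hΩt hx
      obtain ⟨-, hwN', -, -, -, -, hconic, -⟩ := hw _
        ((chartAt (EuclideanSpace ℝ (Fin (n - 1))) u).map_target hx') x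
        ((chartAt (EuclideanSpace ℝ (Fin (n - 1))) u).right_inv hx') hx
      exact hconic.1 (hc _ hwN')) huΩ
  let Φ := FoliatedChart.ofCoord u e (hs.trans hΩt) _ _ r ht hsm hsymm
  set φ := chartAt (EuclideanSpace ℝ (Fin (n - 1))) u with hφ
  have hsrc : ∀ w ∈ Φ.toHomeo.source, w ∈ φ.source ∧ φ w ∈ e.source := fun w hw => by
    change w ∈ (φ.trans e).source at hw
    rwa [OpenPartialHomeomorph.trans_source] at hw
  have hsrc' : ∀ w, w ∈ φ.source → φ w ∈ e.source → w ∈ Φ.toHomeo.source := fun w h1 h2 => by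
    change w ∈ (φ.trans e).source
    rw [OpenPartialHomeomorph.trans_source]
    exact ⟨h1, h2⟩
  have himg : ∀ y, φ '' Φ.plaque y = {x | x ∈ e.source ∧ (e x).2 = y} := by
    intro y
    ext x
    constructor
    · rintro ⟨w, ⟨h1, h2⟩, rfl⟩
      exact ⟨(hsrc w h1).2, h2⟩
    · rintro ⟨h1, h2⟩
      have hx := hΩt (hs h1)
      have hr := φ.right_inv hx
      refine ⟨φ.symm x, ⟨hsrc' _ (φ.map_target hx) (by rwa [hr]), ?_⟩, hr⟩
      change (e (φ (φ.symm x))).2 = y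
      rw [hr, h2]
  have hgen : ∀ y, ∀ w ∈ Φ.plaque y, U.gen w = Submodule.span ℝ {a₀ (φ w), aₙ (φ w)} :=
    fun y w h => (hw w (hsrc w h.1).1 _ rfl (hs (hsrc w h.1).2)).2.2.1
  refine ⟨Φ, β, hsrc' u hus hue, ⟨fun w h => ?_, fun w h => ?_⟩, hβ, fun w h => ?_,
    fun y hy => (hcone y hy).2.comp (himg y) (hgen y), fun w h => ?_,
    fun y hy => (hcone y hy).1.comp (himg y) (hgen y)⟩
  · exact (hw w (hsrc w h).1 _ rfl (hs (hsrc w h).2)).2.1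
  · obtain ⟨h1, h2⟩ := hsrc w h
    change singularDirections U.gen w (B w) = _
    rw [(hw w h1 _ rfl (hs h2)).2.2.2.2.1, ← hker _ h2]
    exact (ker_mfderiv_snd h1 (hsm _ h2)).symm
  · obtain ⟨h1, h2⟩ := hsrc w h
    rw [(hw w h1 _ rfl (hs h2)).2.2.2.1, hfocus _ h2]
    rfl
  · obtain ⟨h1, h2⟩ := hsrc w h
    have := (hw w h1 _ rfl (hs h2)).2.2.2.2.2.2.2
    rwa [hfocus _ h2] at this

/-- Over an open set of folds the hypersurface is foliated into torses. -/
theorem LightlikeHypersurface.isFoliatedByTorses (U : LightlikeHypersurface n M)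
    (hn : 1 ≤ n) (hU : U.HasMaximalRank) {N : Set M} {B : M → ℙ ℝ (LSpace n)}
    (hB : IsFocusField U.gen N B 1) {N' : Set M} (hN' : IsOpen N') (hNN : N' ⊆ N)
    (hf : ∀ u ∈ N', IsFoldAt U.gen B u) : IsFoliatedByTorses U.gen N' B := by
  intro u hu
  obtain ⟨a₀, aₙ, s, Ω, huΩ, hΩt, hΩ, hw⟩ :=
    U.exists_focalChart hn hU hB (hNN hu) (hN'.mem_nhds hu)
  have hus : u ∈ (chartAt (EuclideanSpace ℝ (Fin (n - 1))) u).source := mem_chart_source _ u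
  obtain ⟨e, r, hue, hs, ht, hsm, hsymm, hker, htorse⟩ := hΩ.exists_foldChart
    (fun x hx => by
      have hx' := hΩt hx
      obtain ⟨-, hwN', -, -, -, hfold, -, -⟩ := hw _
        ((chartAt (EuclideanSpace ℝ (Fin (n - 1))) u).map_target hx') x
        ((chartAt (EuclideanSpace ℝ (Fin (n - 1))) u).right_inv hx') hx
      exact hfold.1 (hf _ hwN')) huΩ
  let Φ := FoliatedChart.ofCoord u e (hs.trans hΩt) _ _ r ht hsm hsymm
  set φ := chartAt (EuclideanSpace ℝ (Fin (n - 1))) u with hφ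
  have hsrc : ∀ w ∈ Φ.toHomeo.source, w ∈ φ.source ∧ φ w ∈ e.source := fun w hw => by
    change w ∈ (φ.trans e).source at hw
    rwa [OpenPartialHomeomorph.trans_source] at hw
  refine ⟨Φ, ?_, ⟨fun w h => ?_, fun w h => ?_⟩, fun y hy t hyt => ?_⟩
  · change u ∈ (φ.trans e).source
    rw [OpenPartialHomeomorph.trans_source]
    exact ⟨hus, hue⟩
  · exact (hw w (hsrc w h).1 _ rfl (hs (hsrc w h).2)).2.1
  · obtain ⟨h1, h2⟩ := hsrc w h
    change singularDirections U.gen w (B w) = _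
    rw [(hw w h1 _ rfl (hs h2)).2.2.2.2.1, ← hker _ h2]
    exact (ker_mfderiv_snd h1 (hsm _ h2)).symm
  · refine ⟨fun r => FocalCoord.focus a₀ aₙ s (e.symm (!₂[r], y)), ?_⟩
    have hty : ((!₂[t] : EuclideanSpace ℝ (Fin 1)), y) ∈ e.target := by
      rw [ht]
      exact ⟨hyt, hy⟩
    have hι : Continuous fun t : ℝ => ((!₂[t] : EuclideanSpace ℝ (Fin 1)), y) := by
      simp only [← lineEquiv_apply]
      exact lineEquiv.continuous.prodMk continuous_const
    filter_upwards [hι.continuousAt.eventually (e.open_target.mem_nhds hty)] with q hq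
    obtain ⟨h1, h2, h3⟩ := htorse q y hq _ fun _ => rfl
    have hx := hs (e.map_target hq)
    have hxt := hΩt hx
    obtain ⟨-, -, hgen, hBw, -⟩ := hw _ (φ.map_target hxt) _ (φ.right_inv hxt) hx
    refine ⟨h1, ?_, h2, ?_⟩
    · change _ ∈ (B (φ.symm (e.symm (!₂[q], y)))).submodule
      rw [hBw]
      exact Submodule.mem_span_singleton_self _
    · change U.gen (φ.symm (e.symm (!₂[q], y))) = _
      rw [hgen, h3]

end Foliations

end

end DeSitter

theorem theorem7 (n : ℕ) (hn : 2 ≤ n) {M : Type*} [TopologicalSpace M] [T2Space M]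
    [SecondCountableTopology M] [ChartedSpace (EuclideanSpace ℝ (Fin (n - 1))) M]
    [IsManifold (𝓡 (n - 1)) ∞ M] (U : DeSitter.LightlikeHypersurface n M)
    (hU : U.HasMaximalRank) :
    -- each generator carries `n - 1` real singular points, counted with multiplicity
    (∀ (u : M) (A₀ Aₙ : M → DeSitter.LSpace n), DeSitter.IsFrameAt U.gen u A₀ Aₙ →
      (DeSitter.charPoly A₀ Aₙ u).natDegree = n - 1 ∧
      Multiset.card (DeSitter.charPoly A₀ Aₙ u).roots = n - 1 ∧
      ∀ p : ℙ ℝ (DeSitter.LSpace n), DeSitter.IsSingularPoint U.gen u p ↔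
        ∃ s ∈ (DeSitter.charPoly A₀ Aₙ u).roots, p.submodule = ℝ ∙ (Aₙ u + s • A₀ u)) ∧
    -- every simple focus belongs to a continuous field of simple foci
    (∀ (u : M) (p : ℙ ℝ (DeSitter.LSpace n)), DeSitter.IsFocus U.gen u p 1 →
      ∃ (N : Set M) (B : M → ℙ ℝ (DeSitter.LSpace n)),
        u ∈ N ∧ B u = p ∧ DeSitter.IsFocusField U.gen N B 1) ∧
    -- simple foci: folds and conic ones
    (∀ (N : Set M) (B : M → ℙ ℝ (DeSitter.LSpace n)), DeSitter.IsFocusField U.gen N B 1 →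
      (∀ u ∈ N, (DeSitter.IsFoldAt U.gen B u ∨ DeSitter.IsConicAt U.gen B u) ∧
        ¬(DeSitter.IsFoldAt U.gen B u ∧ DeSitter.IsConicAt U.gen B u)) ∧
      IsOpen {u ∈ N | DeSitter.IsFoldAt U.gen B u} ∧
      DeSitter.IsFoliatedByTorses U.gen {u ∈ N | DeSitter.IsFoldAt U.gen B u} B ∧
      DeSitter.IsFoliatedByCones U.gen (interior {u ∈ N | DeSitter.IsConicAt U.gen B u}) B 1) ∧
    -- foci of a multiplicity `m ≥ 2`
    (∀ (m : ℕ), 2 ≤ m → ∀ (N : Set M) (B : M → ℙ ℝ (DeSitter.LSpace n)),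
      DeSitter.IsFocusField U.gen N B m →
      (∀ u ∈ N, DeSitter.IsConicAt U.gen B u) ∧ DeSitter.IsFoliatedByCones U.gen N B m) := by
  have hn1 : 1 ≤ n := by omega
  refine ⟨fun u A₀ Aₙ hF => ?_, fun u p hp => U.exists_focusField hn1 hU hp, fun N B hB => ?_,
    fun m hm N B hB => ?_⟩
  · obtain ⟨h1, h2, -, -⟩ := U.charPoly_spec hn1 hU hF
    exact ⟨h1, h2, U.isSingularPoint_iff hn1 hU hF⟩
  · have hopen := U.isOpen_setOf_isFoldAt hn1 hU hB
    exact ⟨fun u hu => U.isFoldAt_or_isConicAt hn1 hU hB hu, hopen,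
      U.isFoliatedByTorses hn1 hU hB hopen (fun u h => h.1) fun u h => h.2,
      U.isFoliatedByCones hn1 hU hB isOpen_interior (fun u h => (interior_subset h).1)
        fun u h => (interior_subset h).2⟩
  · have hc : ∀ u ∈ N, DeSitter.IsConicAt U.gen B u := fun u hu =>
      U.isConicAt_of_two_le hn1 hU hm hB hu
    exact ⟨hc, U.isFoliatedByCones hn1 hU hB hB.isOpen subset_rfl hc⟩
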